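/- Fix an integer $r\ge 2$. In Max Exact $r$-SAT AA an instance is a pair $(F,k)$, where $F$ is a formula consisting of a multiset of $m$ clauses on $n$ variables, each clause having exactly $r$ distinct variables, and $k\ge 0$ is an integer, the parameter; the question is whether some truth assignment satisfies at least $(1-2^{-r})m+k2^{-r}$ clauses. In Max $r$-Lin AA an instance is a pair $(S,k)$, where $S$ is a system of linear equations over $\mathbb F_2$, each in at most $r$ variables and each with a positive integral weight, and $k\ge 0$ is an integer, the parameter; the question is whether some assignment of values to the variables has excess at least $k$, the excess being the total weight of the satisfied equations minus the total weight of the falsified equations. A bikernelization from a parameterized problem $L$ to a parameterized problem $L'$ is a polynomial-time algorithm that maps an instance $(x,k)$ to an instance $(x',k')$ (the bikernel) such that $(x,k)\in L$ if and only if $(x',k')\in L'$, $k'\le f(k)$ and $|x'|\le g(k)$ for some functions $f$ and $g$. If $L=L'$, it is called a kernelization and $(x',k')$ a kernel. The bikernel has $O(k\log k)$ variables if the number of variables of $x'$ is at most $h(k)$ for some function $h:\mathbb N\to\mathbb N$ with $h(k)=O(k\log k)$ as $k\to\infty$. Instances are written as words over a finite alphabet, numbers in binary, and algorithms are deterministic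 multi-stack Turing machines. Then, with all functions and constants depending on $r$ only: 1. There is a bikernelization from Max Exact $r$-SAT AA to Max $r$-Lin AA with $O(k\log k)$ variables. 2. Max Exact $r$-SAT AA has a kernel with $O(k\log k)$ variables. 3. Max Exact $r$-SAT AA can be solved in time $2^{O(k\log k)}+m^{O(1)}$: there are a Turing machine, a constant $c$ and a function $h:\mathbb N\to\mathbb N$ with $h(k)=O(k\log k)$ as $k\to\infty$ such that the machine decides every instance $(F,k)$ in at most $2^{h(k)}+N^{c}$ steps, where $N$ is the length of the word that encodes $(F,k)$, and in at most $2^{h(k)}+m^{c}$ steps if every variable of $F$ occurs in some clause of $F$. -/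

import Mathlib

open Computability Turing Filter Asymptotics

namespace MaxExactSat

/-! ### Parameterized problems, bikernelizations, running time -/

/-- A parameterized problem whose instances `x` are written over the finite alphabet `Γ'`
(two bits, brackets, comma, blank), together with the number of variables of an instance.
`yes x k` says that `(x, k)` is a yes-instance. -/
structure ParamProblem where
  Inst : Type
  enc : Inst → List Γ'
  enc_injective : Function.Injective enc
  numVars : Inst → ℕ
  yes : Inst → ℕ → Prop

/-- A natural number in binary, closed by a comma. -/
def encNat (a : ℕ) : List Γ' := (encodeNat a).map Γ'.bit ++ [Γ'.comma]

/-- The word on which an algorithm works: the parameter in binary, then the instance. -/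
def ParamProblem.encPair (L : ParamProblem) (p : L.Inst × ℕ) : List Γ' :=
  encNat p.2 ++ L.enc p.1

/-- A bikernelization from `L` to `L'`: a polynomial-time map `(x, k) ↦ (x', k')` that preserves
membership, with `k' ≤ f k` and `|x'| ≤ g k` for some functions `f` and `g`. -/
structure IsBikernelization (L L' : ParamProblem) (φ : L.Inst × ℕ → L'.Inst × ℕ) : Prop where
  polyTime : Nonempty (TM2ComputableInPolyTime L.encPair L'.encPair φ)
  yes_iff : ∀ p, L.yes p.1 p.2 ↔ L'.yes (φ p).1 (φ p).2
  param_le : ∃ f : ℕ → ℕ, ∀ p, (φ p).2 ≤ f p.2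
  size_le : ∃ g : ℕ → ℕ, ∀ p, (L'.enc (φ p).1).length ≤ g p.2

/-- `h` is `O(k log k)` as `k → ∞`. -/
def IsBigOKLogK (h : ℕ → ℕ) : Prop :=
  (fun k : ℕ => (h k : ℝ)) =O[atTop] (fun k : ℕ => (k : ℝ) * Real.log (k : ℝ))

/-- There is a bikernel from `L` to `L'` with `O(k log k)` variables. -/
def HasBikernelKLogK (L L' : ParamProblem) : Prop :=
  ∃ φ : L.Inst × ℕ → L'.Inst × ℕ, IsBikernelization L L' φ ∧
    ∃ h : ℕ → ℕ, IsBigOKLogK h ∧ ∀ p, L'.numVars (φ p).1 ≤ h p.2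

/-- A kernel is a bikernel from a problem to itself. -/
def HasKernelKLogK (L : ParamProblem) : Prop := HasBikernelKLogK L L

/-- The Turing machine `M`, started on the pair `(x, k)`, halts after at most `t` steps with the
correct one-bit answer to the question whether `(x, k)` is a yes-instance. -/
def ParamProblem.SolvesIn (L : ParamProblem) (M : TM2ComputableAux Γ' Bool)
    (x : L.Inst) (k t : ℕ) : Prop :=
  ∃ b : Bool, (b = true ↔ L.yes x k) ∧
    Nonempty (TM2OutputsInTime M.tm ((L.encPair (x, k)).map M.inputAlphabet.invFun)
      (some ((encodeBool b).map M.outputAlphabet.invFun)) t)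

/-! ### Encodings -/

/-- `f` is a prefix code. -/
def PrefixCode {α : Type} (f : α → List Γ') : Prop :=
  ∀ a a' s s', f a ++ s = f a' ++ s' → a = a' ∧ s = s'

theorem prefixCode_encNat : PrefixCode encNat := by
  intro a a' s s' h
  have key : ∀ (l l' : List Bool) (s s' : List Γ'),
      l.map Γ'.bit ++ Γ'.comma :: s = l'.map Γ'.bit ++ Γ'.comma :: s' → l = l' ∧ s = s' := by
    intro l
    induction l with
    | nil => intro l' s s' h; cases l' <;> simp_all
    | cons b l ih =>
      intro l' s s' h
      cases l' with
      | nil => simp at h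
      | cons b' l' =>
        simp only [List.map_cons, List.cons_append, List.cons.injEq, Γ'.bit.injEq] at h
        obtain ⟨h1, h2⟩ := ih l' s s' h.2
        exact ⟨by rw [h.1, h1], h2⟩
  obtain ⟨h1, h2⟩ := key (encodeNat a) (encodeNat a') s s' (by simpa [encNat] using h)
  exact ⟨by rw [← decode_encodeNat a, h1, decode_encodeNat], h2⟩

theorem encNat_head (a : ℕ) (s t : List Γ') : encNat a ++ s ≠ Γ'.ket :: t := by
  unfold encNat
  cases encodeNat a <;> simp

/-- A list of codewords of a prefix code, none of which starts with `ket`, closed by `ket`. -/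
theorem PrefixCode.flatMap_ket {α : Type} {f : α → List Γ'} (hf : PrefixCode f)
    (hk : ∀ a s t, f a ++ s ≠ Γ'.ket :: t) :
    PrefixCode (fun l : List α => l.flatMap f ++ [Γ'.ket]) := by
  intro l
  induction l with
  | nil =>
    intro l' s s' h
    cases l' with
    | nil => simpa using h
    | cons a' l' => exact absurd (by simpa using h.symm) (hk a' (l'.flatMap f ++ Γ'.ket :: s') s)
  | cons a l ih =>
    intro l' s s' h
    cases l' with
    | nil => exact absurd (by simpa using h) (hk a (l.flatMap f ++ Γ'.ket :: s) s')
    | cons a' l' =>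
      obtain ⟨h1, h2⟩ := hf a a' (l.flatMap f ++ Γ'.ket :: s) (l'.flatMap f ++ Γ'.ket :: s')
        (by simpa using h)
      obtain ⟨h3, h4⟩ := ih l' s s' (by simpa using h2)
      exact ⟨by rw [h1, h3], h4⟩

/-- A list of nonempty codewords of a prefix code. -/
theorem PrefixCode.flatMap_injective {α : Type} {f : α → List Γ'} (hf : PrefixCode f)
    (hk : ∀ a, f a ≠ []) : Function.Injective (fun l : List α => l.flatMap f) := by
  intro l
  induction l with
  | nil =>
    intro l' h
    cases l' with
    | nil => rfl
    | cons a' l' => simp at h; exact absurd h.1 (hk a')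
  | cons a l ih =>
    intro l' h
    cases l' with
    | nil => simp at h; exact absurd h.1 (hk a)
    | cons a' l' =>
      obtain ⟨h1, h2⟩ := hf a a' _ _ (by simpa using h)
      rw [h1, ih h2]

/-! ### Max Exact `r`-SAT above average -/

/-- A literal: a variable and its sign (`true` for `x`, `false` for `¬ x`). -/
abbrev Literal (n : ℕ) := Fin n × Bool

/-- A clause with exactly `r` distinct variables among `n` variables. -/
@[ext] structure Clause (r n : ℕ) where
  lits : List (Literal n)
  nodup : (lits.map Prod.fst).Nodup
  length_eq : lits.length = r

/-- A clause is satisfied if one of its literals is true. -/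
def Clause.Sat {r n : ℕ} (C : Clause r n) (a : Fin n → Bool) : Prop :=
  ∃ l ∈ C.lits, a l.1 = l.2

instance {r n : ℕ} (C : Clause r n) (a : Fin n → Bool) : Decidable (C.Sat a) := by
  unfold Clause.Sat; infer_instance

/-- An exact `r`-CNF formula: `n` variables and a list (repetitions allowed) of clauses. -/
structure Formula (r : ℕ) where
  n : ℕ
  clauses : List (Clause r n)

/-- The number of clauses. -/
def Formula.m {r : ℕ} (F : Formula r) : ℕ := F.clauses.length

/-- The number of clauses satisfied by `a`, with multiplicity. -/
def Formula.numSat {r : ℕ} (F : Formula r) (a : Fin F.n → Bool) : ℕ :=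
  F.clauses.countP (fun C => decide (C.Sat a))

/-- Every variable of the formula occurs in one of its clauses. -/
def Formula.AllOccur {r : ℕ} (F : Formula r) : Prop :=
  ∀ i : Fin F.n, ∃ C ∈ F.clauses, i ∈ C.lits.map Prod.fst

/-- Some assignment satisfies at least `(1 - 2⁻ʳ) m + k 2⁻ʳ` clauses. -/
def Formula.Yes {r : ℕ} (F : Formula r) (k : ℕ) : Prop :=
  ∃ a : Fin F.n → Bool, (1 - 1 / 2 ^ r : ℝ) * F.m + k * (1 / 2 ^ r) ≤ F.numSat a

def encLit {n : ℕ} (l : Literal n) : List Γ' := Γ'.bit l.2 :: encNat l.1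

def encClause {r n : ℕ} (C : Clause r n) : List Γ' :=
  Γ'.bra :: (C.lits.flatMap encLit ++ [Γ'.ket])

def encFormula {r : ℕ} (F : Formula r) : List Γ' := encNat F.n ++ F.clauses.flatMap encClause

theorem prefixCode_encLit {n : ℕ} : PrefixCode (encLit (n := n)) := by
  rintro ⟨i, b⟩ ⟨i', b'⟩ s s' h
  simp only [encLit, List.cons_append, List.cons.injEq, Γ'.bit.injEq] at h
  obtain ⟨h1, h2⟩ := prefixCode_encNat _ _ _ _ h.2
  exact ⟨Prod.ext (Fin.ext h1) h.1, h2⟩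

theorem prefixCode_encClause {r n : ℕ} : PrefixCode (encClause (r := r) (n := n)) := by
  intro C C' s s' h
  simp only [encClause, List.cons_append, List.cons.injEq, true_and] at h
  obtain ⟨h1, h2⟩ := prefixCode_encLit.flatMap_ket (by simp [encLit]) _ _ _ _ h
  exact ⟨Clause.ext h1, h2⟩

theorem encFormula_injective (r : ℕ) : Function.Injective (encFormula (r := r)) := by
  rintro ⟨n, cs⟩ ⟨n', cs'⟩ h
  obtain ⟨h1, h2⟩ := prefixCode_encNat _ _ _ _ h
  dsimp only at h1
  subst h1
  exact congrArg (Formula.mk n) (prefixCode_encClause.flatMap_injective (by simp [encClause]) h2)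

/-- Max Exact `r`-SAT AA. -/
def maxExactSatAA (r : ℕ) : ParamProblem where
  Inst := Formula r
  enc := encFormula
  enc_injective := encFormula_injective r
  numVars := Formula.n
  yes := Formula.Yes

/-! ### Max `r`-Lin above average -/

/-- A weighted equation `∑ i ∈ vars, z i = rhs` over the two-element field, in at most `r` distinct
variables among `n` variables, with a positive integral weight. The right-hand side is stored as a
bit, see `Equation.Sat`. -/
@[ext] structure Equation (r n : ℕ) where
  vars : List (Fin n)
  rhs : Bool
  weight : ℕ
  nodup : vars.Nodup
  length_le : vars.length ≤ r
  weight_pos : 0 < weight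

/-- `z` satisfies the equation. -/
def Equation.Sat {r n : ℕ} (e : Equation r n) (z : Fin n → ZMod 2) : Prop :=
  (e.vars.map z).sum = if e.rhs then 1 else 0

instance {r n : ℕ} (e : Equation r n) (z : Fin n → ZMod 2) : Decidable (e.Sat z) := by
  unfold Equation.Sat; infer_instance

/-- A weighted system of linear equations in `n` variables. -/
structure LinSystem (r : ℕ) where
  n : ℕ
  eqs : List (Equation r n)

/-- Total weight of the satisfied equations minus total weight of the falsified ones. -/
def LinSystem.excess {r : ℕ} (A : LinSystem r) (z : Fin A.n → ZMod 2) : ℤ :=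
  (A.eqs.map fun e => if e.Sat z then (e.weight : ℤ) else -(e.weight : ℤ)).sum

/-- The maximum excess is at least `k`. -/
def LinSystem.Yes {r : ℕ} (A : LinSystem r) (k : ℕ) : Prop :=
  ∃ z : Fin A.n → ZMod 2, (k : ℤ) ≤ A.excess z

def encEquation {r n : ℕ} (e : Equation r n) : List Γ' :=
  Γ'.bra :: Γ'.bit e.rhs :: (encNat e.weight ++
    (e.vars.flatMap (fun i : Fin n => encNat i) ++ [Γ'.ket]))

def encLinSystem {r : ℕ} (A : LinSystem r) : List Γ' := encNat A.n ++ A.eqs.flatMap encEquation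

theorem prefixCode_encEquation {r n : ℕ} : PrefixCode (encEquation (r := r) (n := n)) := by
  intro e e' s s' h
  simp only [encEquation, List.cons_append, List.cons.injEq, true_and, Γ'.bit.injEq] at h
  obtain ⟨hb, h⟩ := h
  rw [List.append_assoc (encNat e.weight), List.append_assoc (encNat e'.weight)] at h
  obtain ⟨hw, h⟩ := prefixCode_encNat _ _ _ _ h
  have hfin : PrefixCode (fun i : Fin n => encNat i) := by
    intro i i' s s' h
    obtain ⟨h1, h2⟩ := prefixCode_encNat _ _ _ _ h
    exact ⟨Fin.ext h1, h2⟩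
  obtain ⟨hv, h⟩ := hfin.flatMap_ket (fun i => encNat_head _) _ _ _ _ h
  exact ⟨Equation.ext hv hb hw, h⟩

theorem encLinSystem_injective (r : ℕ) : Function.Injective (encLinSystem (r := r)) := by
  rintro ⟨n, es⟩ ⟨n', es'⟩ h
  obtain ⟨h1, h2⟩ := prefixCode_encNat _ _ _ _ h
  dsimp only at h1
  subst h1
  exact congrArg (LinSystem.mk n)
    (prefixCode_encEquation.flatMap_injective (by simp [encEquation]) h2)

/-- Max `r`-Lin AA. -/
def maxLinAA (r : ℕ) : ParamProblem where
  Inst := LinSystem r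
  enc := encLinSystem
  enc_injective := encLinSystem_injective r
  numVars := LinSystem.n
  yes := LinSystem.Yes

/-! ### Solvability in time `2^{O(k log k)} + m^{O(1)}` -/

/-- One Turing machine solves Max Exact `r`-SAT AA in `2^{O(k log k)} + m^{O(1)}` steps on formulas
in which every variable occurs. A machine that reads its input has to pay also for variables that do
not occur; on arbitrary formulas `m` is replaced by the length of the input. -/
def SolvableKLogK (r : ℕ) : Prop :=
  ∃ (M : TM2ComputableAux Γ' Bool) (h : ℕ → ℕ) (c : ℕ), IsBigOKLogK h ∧
    ∀ (F : Formula r) (k : ℕ),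
      (maxExactSatAA r).SolvesIn M F k
        (2 ^ h k + ((maxExactSatAA r).encPair (F, k)).length ^ c) ∧
      (F.AllOccur → (maxExactSatAA r).SolvesIn M F k (2 ^ h k + F.m ^ c))

end MaxExactSat

/-!
For a clause `C` and an assignment, put `x_l = -1` if the literal `l` of `C` is true and `x_l = 1`
otherwise. Then `1 - ∏ (1 + x_l)` is `2 ^ r` times the difference between 1 (`C` satisfied) or
0 (`C` falsified) and the average `1 - 2 ^ (-r)`. Expanded, it is a sum of nonempty products of
signs, each of which is the contribution of an equation over `ZMod 2` of weight one to the excess.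
So a formula turns into an instance of Max `r`-Lin AA with the same parameter, in which equations
with the same left-hand side are combined.

Let `M` be the set of coefficient vectors. If its rank exceeds `k log |M|`, then some vector of the
span is not a sum of fewer than `k` vectors from `M`. The shortest `K ⊆ M` with such a vector as its
sum is linearly independent, and no sum of two or more of its elements lies in `M`. Averaged over
the solutions of the equations in `K`, all other equations contribute 0, so the excess reaches `k`.
The same holds if one equation has weight `k`. Otherwise the number `n` of variables is
`O(k log |M|)`, which `|M| ≤ (n + 1) ^ r` improves to `O(k log k)`, and all weights are below `k`.

To return to SAT, every equation is padded to `r` variables, and each unit of its weight is replaced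
by the `2 ^ (r - 1)` clauses in these variables whose falsifying assignment falsifies the equation;
this multiplies the excess by `2 ^ (r - 1)`. The decision algorithm tries all assignments to the
reduced system.

Polynomial running time is a property, with closure rules, of maps between types encoded by binary
trees; it is witnessed by structured programs on stacks, which compile to multi-stack Turing
machines.
-/

/-! ### Structured stack programs and their compilation to `TM2` machines -/

namespace StackProg

/-- `b` is reached from `a` within `t` steps of the partial function `f`: the propositional form of
`StateTransition.EvalsToInTime`. -/
def ReachesIn {C : Type*} (f : C → Option C) (t : ℕ) (a b : C) : Prop :=
  Nonempty (StateTransition.EvalsToInTime f a (some b) t)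

namespace ReachesIn

variable {C : Type*} {f : C → Option C} {t t' : ℕ} {a b c : C}

theorem single (h : f a = some b) : ReachesIn f 1 a b := ⟨⟨1, h⟩, le_rfl⟩

theorem trans (hab : ReachesIn f t a b) (hbc : ReachesIn f t' b c) : ReachesIn f (t + t') a c := by
  obtain ⟨hab⟩ := hab
  obtain ⟨hbc⟩ := hbc
  exact ⟨add_comm t t' ▸ hab.trans f t t' a b _ hbc⟩

theorem mono (h : ReachesIn f t a b) (ht : t ≤ t') : ReachesIn f t' a b :=
  h.map fun e => ⟨e.toEvalsTo, e.steps_le_m.trans ht⟩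

end ReachesIn

/-- Structured programs over a family of stacks. `pop k f` pops stack `k` and continues with `f o`,
where `o` is the symbol found, if any; `loop k final f` pops stack `k` and runs `f o` on the symbol
`o` found, until `final o` holds. -/
inductive Cmd (K : Type) (Γ : K → Type) : Type
  | skip : Cmd K Γ
  | push (k : K) (a : Γ k) : Cmd K Γ
  | pop (k : K) (f : Option (Γ k) → Cmd K Γ) : Cmd K Γ
  | seq (c d : Cmd K Γ) : Cmd K Γ
  | loop (k : K) (final : Option (Γ k) → Bool) (f : Option (Γ k) → Cmd K Γ) : Cmd K Γ

section Compile

variable {K : Type} {Γ : K → Type}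

/-- The labels of the machine that executes a program. The label `none` of a `pop` or a `loop` is
the instruction that pops the stack. -/
def Label : Cmd K Γ → Type
  | .skip => Unit
  | .push _ _ => Unit
  | .pop k f => Option (Σ o : Option (Γ k), Label (f o))
  | .seq c d => Label c ⊕ Label d
  | .loop k _ f => Option (Σ o : Option (Γ k), Label (f o))

/-- The label at which the execution of a program starts. -/
def entry : (c : Cmd K Γ) → Label c
  | .skip => ()
  | .push _ _ => ()
  | .pop _ _ => (none : Option _)
  | .seq c _ => Sum.inl (entry c)
  | .loop _ _ _ => (none : Option _)

theorem finite_label [∀ k, Finite (Γ k)] (c : Cmd K Γ) : Finite (Label c) := by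
  induction c with
  | skip | push => exact inferInstanceAs (Finite Unit)
  | pop k f _ | loop k _ f _ =>
    exact inferInstanceAs (Finite (Option (Σ o : Option (Γ k), Label (f o))))
  | seq c d _ _ => exact inferInstanceAs (Finite (Label c ⊕ Label d))

variable [DecidableEq K]

/-- Big-step semantics: started with the stacks `s`, the program terminates within `t` steps with
the stacks `s'`. -/
inductive Runs : Cmd K Γ → (∀ k, List (Γ k)) → (∀ k, List (Γ k)) → ℕ → Prop
  | skip {s} : Runs .skip s s 1
  | push {s k a} : Runs (.push k a) s (Function.update s k (a :: s k)) 1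
  | pop {s k f s' t} : Runs (f (s k).head?) (Function.update s k (s k).tail) s' t →
      Runs (.pop k f) s s' (1 + t)
  | seq {c d s s' s'' t t'} : Runs c s s' t → Runs d s' s'' t' → Runs (.seq c d) s s'' (t + t')
  | loop_exit {s k final f} : final (s k).head? = true →
      Runs (.loop k final f) s (Function.update s k (s k).tail) 1
  | loop_step {s k final f s' s'' t t'} : final (s k).head? = false →
      Runs (f (s k).head?) (Function.update s k (s k).tail) s' t →
      Runs (.loop k final f) s' s'' t' → Runs (.loop k final f) s s'' (1 + t + t')
  | mono {c s s' t t'} : Runs c s s' t → t ≤ t' → Runs c s s' t'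

/-- Runs `f a` on the symbols `a` popped from stack `k` until it is empty. -/
def each (k : K) (f : Γ k → Cmd K Γ) : Cmd K Γ :=
  .loop k (fun o => o.isNone) fun
    | none => .skip
    | some a => f a

section Each

variable {s s' s'' : ∀ k, List (Γ k)} {k : K} {f : Γ k → Cmd K Γ} {t t' : ℕ}

theorem Runs.each_nil (hk : s k = []) : Runs (each k f) s s 1 := by
  have hexit := Runs.loop_exit (s := s) (k := k) (final := fun o => o.isNone)
    (f := fun
      | none => .skip
      | some a => f a) (by rw [hk]; rfl)
  rwa [hk, List.tail_nil, ← hk, Function.update_eq_self] at hexit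

theorem Runs.each_cons {a : Γ k} {l : List (Γ k)} (hk : s k = a :: l)
    (hbody : Runs (f a) (Function.update s k l) s' t) (hrest : Runs (each k f) s' s'' t') :
    Runs (each k f) s s'' (1 + t + t') := by
  refine .loop_step (by rw [hk]; rfl) ?_ hrest
  rw [hk]
  exact hbody

end Each

/-- The statements of the machine. The labels of the program are embedded into those of the machine
by `emb`, and the machine continues at the label `ex` when the program is done. Its internal state
records the symbol popped last from each stack. -/
def code {Λ : Type} : (c : Cmd K Γ) → (Label c → Λ) → Λ → Label c →
    TM2.Stmt Γ Λ (∀ k, Option (Γ k))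
  | .skip, _, ex, _ => .goto fun _ => ex
  | .push k a, _, ex, _ => .push k (fun _ => a) (.goto fun _ => ex)
  | .pop k f, emb, ex, l => match l with
    | none => .pop k (fun v o => Function.update v k o)
        (.goto fun v => emb (some ⟨v k, entry (f (v k))⟩))
    | some ⟨o, l⟩ => code (f o) (fun l => emb (some ⟨o, l⟩)) ex l
  | .seq c d, emb, ex, l => match l with
    | Sum.inl l => code c (fun l => emb (Sum.inl l)) (emb (Sum.inr (entry d))) l
    | Sum.inr l => code d (fun l => emb (Sum.inr l)) ex l
  | .loop k final f, emb, ex, l => match l with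
    | none => .pop k (fun v o => Function.update v k o)
        (.goto fun v => if final (v k) then ex else emb (some ⟨v k, entry (f (v k))⟩))
    | some ⟨o, l⟩ => code (f o) (fun l => emb (some ⟨o, l⟩)) (emb none) l

theorem reachesIn_of_stepAux {Λ σ : Type} {M : Λ → TM2.Stmt Γ Λ σ} {l : Λ} {S : TM2.Stmt Γ Λ σ}
    (hl : M l = S) {v : σ} {s : ∀ k, List (Γ k)} {c : TM2.Cfg Γ Λ σ}
    (h : TM2.stepAux S v s = c) : ReachesIn (TM2.step M) 1 ⟨some l, v, s⟩ c :=
  .single (by rw [TM2.step, hl, h])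

theorem Runs.reachesIn {c : Cmd K Γ} {s s' : ∀ k, List (Γ k)} {t : ℕ} (h : Runs c s s' t) :
    ∀ {Λ : Type} (M : Λ → TM2.Stmt Γ Λ (∀ k, Option (Γ k))) (emb : Label c → Λ) (ex : Λ),
      (∀ l, M (emb l) = code c emb ex l) → ∀ v, ∃ v',
        ReachesIn (TM2.step M) t ⟨some (emb (entry c)), v, s⟩ ⟨some ex, v', s'⟩ := by
  induction h with
  | skip => exact fun M emb ex hM v => ⟨v, reachesIn_of_stepAux (hM _) rfl⟩
  | push => exact fun M emb ex hM v => ⟨v, reachesIn_of_stepAux (hM _) rfl⟩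
  | @pop s k f _ _ _ ih =>
    intro Λ M emb ex hM v
    obtain ⟨v', hbody⟩ := ih M (fun l => emb (some ⟨_, l⟩)) ex (fun l => hM _)
      (Function.update v k (s k).head?)
    refine ⟨v', (reachesIn_of_stepAux (hM none) ?_).trans hbody⟩
    simp only [code, TM2.stepAux]
    rw [Function.update_self]
  | @seq c d _ _ _ _ _ _ _ ihc ihd =>
    intro Λ M emb ex hM v
    obtain ⟨v', hc⟩ := ihc M (fun l => emb (Sum.inl l)) (emb (Sum.inr (entry d))) (fun l => hM _) v
    obtain ⟨v'', hd⟩ := ihd M (fun l => emb (Sum.inr l)) ex (fun l => hM _) v'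
    exact ⟨v'', hc.trans hd⟩
  | @loop_exit s k final f hfinal =>
    intro Λ M emb ex hM v
    refine ⟨Function.update v k (s k).head?, reachesIn_of_stepAux (hM none) ?_⟩
    simp only [code, TM2.stepAux, Function.update_self, hfinal, if_true]
  | @loop_step s k final f _ _ _ _ hfinal _ _ ihbody ihrest =>
    intro Λ M emb ex hM v
    obtain ⟨v', hbody⟩ := ihbody M (fun l => emb (some ⟨_, l⟩)) (emb none) (fun l => hM _)
      (Function.update v k (s k).head?)
    obtain ⟨v'', hrest⟩ := ihrest M emb ex hM v'
    refine ⟨v'', ((reachesIn_of_stepAux (hM none) ?_).trans hbody).trans hrest⟩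
    simp only [code, TM2.stepAux]
    rw [Function.update_self, hfinal]
    rfl
  | mono _ ht ih => exact fun M emb ex hM v => (ih M emb ex hM v).imp fun _ h => h.mono ht

/-- The machine that executes a program and halts, with input stack `k₀` and output stack `k₁`. -/
noncomputable def machine [Fintype K] [∀ k, Fintype (Γ k)] (k₀ k₁ : K) (c : Cmd K Γ) :
    FinTM2 where
  K := K
  k₀ := k₀
  k₁ := k₁
  Γ := Γ
  Λ := Option (Label c)
  main := some (entry c)
  ΛFin := by
    haveI := finite_label c
    exact Fintype.ofFinite _
  σ := ∀ k, Option (Γ k)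
  initialState := fun _ => none
  σFin := inferInstance
  Γk₀Fin := inferInstance
  m
    | none => .load (fun _ _ => none) .halt
    | some l => code c some none l

/-- The stacks with `w` on stack `k` and all other stacks empty. -/
def single (k : K) (w : List (Γ k)) : ∀ k, List (Γ k) := Function.update (fun _ => []) k w

theorem single_eq_dite (k₀ : K) (w : List (Γ k₀)) :
    single k₀ w =
      fun k => if h : k = k₀ then (by rw [h]; exact w : List (Γ k)) else [] := by
  funext k
  by_cases hk : k = k₀
  · subst hk; simp [single]
  · simp [single, hk]

theorem Runs.outputs [Fintype K] [∀ k, Fintype (Γ k)] {k₀ k₁ : K} {c : Cmd K Γ}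
    {w : List (Γ k₀)} {w' : List (Γ k₁)} {t : ℕ} (h : Runs c (single k₀ w) (single k₁ w') t) :
    Nonempty (TM2OutputsInTime (machine k₀ k₁ c) w (some w') (t + 1)) := by
  obtain ⟨v', hrun⟩ := h.reachesIn (machine k₀ k₁ c).m some none (fun _ => rfl) (fun _ => none)
  have hhalt : ReachesIn (TM2.step (machine k₀ k₁ c).m) 1 ⟨some none, v', single k₁ w'⟩
      ⟨none, fun _ => none, single k₁ w'⟩ := .single rfl
  have hinit : initList (machine k₀ k₁ c) w =
      ⟨some (some (entry c)), fun _ => none, single k₀ w⟩ :=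
    congrArg (TM2.Cfg.mk _ _) (single_eq_dite k₀ w).symm
  have hfinal : haltList (machine k₀ k₁ c) w' = ⟨none, fun _ => none, single k₁ w'⟩ :=
    congrArg (TM2.Cfg.mk _ _) (single_eq_dite k₁ w').symm
  obtain ⟨⟨n, hn⟩, hle⟩ := hrun.trans hhalt
  exact ⟨⟨⟨n, (congrArg (fun a => (flip Bind.bind _)^[n] (some a)) hinit).trans
    (hn.trans (congrArg some hfinal.symm))⟩, hle⟩⟩

end Compile

end StackProg

/-! ### A machine working on a stack of binary trees -/

namespace StackProg

/-- Prefix notation of binary trees. Binary trees are the universal data type of the machine. -/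
def treeBits : BinaryTree Unit → List Bool
  | .nil => [false]
  | .node () l r => true :: (treeBits l ++ treeBits r)

theorem treeBits_length_pos (t : BinaryTree Unit) : 0 < (treeBits t).length := by
  cases t <;> simp [treeBits]

/-- The working stacks: values, saved values, two scratch stacks and a counter. -/
inductive Bank : Type
  | val | ret | aux | tmp | cnt
  deriving DecidableEq

instance : Fintype Bank where
  elems := {.val, .ret, .aux, .tmp, .cnt}
  complete i := by cases i <;> decide

/-- The stacks of the machine: input word, output word, one-bit answer, and the working stacks. -/
inductive Stack : Type
  | inp | out | ans
  | bank (i : Bank)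
  deriving DecidableEq

instance : Fintype Stack where
  elems := {.inp, .out, .ans} ∪ Finset.univ.image .bank
  complete k := by cases k <;> simp

/-- The alphabet of a stack. -/
@[reducible] def Alph : Stack → Type
  | .inp => Γ'
  | .out => Γ'
  | .ans => Bool
  | .bank _ => Bool

instance (k : Stack) : Fintype (Alph k) := by
  cases k <;> infer_instance

/-- Programs of the machine. -/
abbrev Prog := Cmd Stack Alph

/-- The contents of the input and output stacks. -/
structure Ports where
  inp : List Γ'
  out : List Γ'
  ans : List Bool

/-- The contents of all stacks. -/
def store (e : Ports) (S : Bank → List Bool) : ∀ k, List (Alph k)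
  | .inp => e.inp
  | .out => e.out
  | .ans => e.ans
  | .bank i => S i

section Store

variable {e : Ports} {S S' : Bank → List Bool}

theorem update_store_bank (i : Bank) (l : List Bool) :
    Function.update (store e S) (.bank i) l = store e (Function.update S i l) := by
  funext k
  cases k with
  | bank j =>
    by_cases h : j = i
    · subst h; simp [store]
    · simp [store, h]
  | _ => simp [store]

theorem update_store_inp (l : List Γ') :
    Function.update (store e S) .inp l = store { e with inp := l } S := by
  funext k
  cases k <;> simp [store]

theorem update_store_out (l : List Γ') :
    Function.update (store e S) .out l = store { e with out := l } S := by
  funext k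
  cases k <;> simp [store]

theorem update_store_ans (l : List Bool) :
    Function.update (store e S) .ans l = store { e with ans := l } S := by
  funext k
  cases k <;> simp [store]

theorem store_congr (h : ∀ k, S k = S' k) : store e S = store e S' := by rw [funext h]

end Store

namespace Runs

variable {c : Prog} {s s' s'' : ∀ k, List (Alph k)} {t t' : ℕ}

theorem cast (h : Runs c s s' t) (hs : s' = s'') (ht : t ≤ t') : Runs c s s'' t' :=
  hs ▸ h.mono ht

theorem congr_left (h : Runs c s s' t) (hs : s'' = s) : Runs c s'' s' t := hs ▸ h

variable {e : Ports} {S : Bank → List Bool} {i : Bank} {a : Bool} {l : List Bool}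

theorem push_bank (e : Ports) (S : Bank → List Bool) (i : Bank) (a : Bool) :
    Runs (.push (.bank i) a) (store e S) (store e (Function.update S i (a :: S i))) 1 :=
  update_store_bank i (a :: S i) ▸ Runs.push

theorem pop_bank {f : Option Bool → Prog} (hi : S i = a :: l)
    (hbody : Runs (f (some a)) (store e (Function.update S i l)) s' t) :
    Runs (.pop (.bank i) f) (store e S) s' (1 + t) := by
  have hstore : store e S (.bank i) = a :: l := hi
  refine .pop ?_
  rw [hstore, update_store_bank]
  exact hbody

section Loop

variable {final : Option Bool → Bool} {f : Option Bool → Prog}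

theorem loop_step_bank (hi : S i = a :: l) (ha : final (some a) = false)
    (hbody : Runs (f (some a)) (store e (Function.update S i l)) s' t)
    (hrest : Runs (.loop (.bank i) final f) s' s'' t') :
    Runs (.loop (.bank i) final f) (store e S) s'' (1 + t + t') := by
  have hstore : store e S (.bank i) = a :: l := hi
  refine .loop_step (by rw [hstore]; exact ha) ?_ hrest
  rw [hstore, update_store_bank]
  exact hbody

theorem loop_exit_bank (hi : S i = a :: l) (ha : final (some a) = true) :
    Runs (.loop (.bank i) final f) (store e S) (store e (Function.update S i l)) 1 := by
  have hstore : store e S (.bank i) = a :: l := hi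
  have hexit := Runs.loop_exit (s := store e S) (k := .bank i) (final := final) (f := f)
    (by rw [hstore]; exact ha)
  rwa [hstore, List.tail_cons, update_store_bank] at hexit

end Loop

theorem each_nil_bank {f : Bool → Prog} (hi : S i = []) :
    Runs (each (.bank i) f) (store e S) (store e S) 1 :=
  .each_nil (s := store e S) hi

theorem each_cons_bank {f : Bool → Prog} (hi : S i = a :: l)
    (hbody : Runs (f a) (store e (Function.update S i l)) s' t)
    (hrest : Runs (each (.bank i) f) s' s'' t') :
    Runs (each (.bank i) f) (store e S) s'' (1 + t + t') :=
  .each_cons (s := store e S) hi (update_store_bank i l ▸ hbody) hrest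

end Runs

/-- Reverses stack `i` onto stack `j`. -/
def unload (i j : Bank) : Prog := each (.bank i) fun a => .push (.bank j) a

/-- Moves the tree on top of stack `i` to stack `j`, reversing its code. The length of the counter
stack is the number of trees that remain to be moved. -/
def moveTree (i j : Bank) : Prog :=
  .seq (.push (.bank .cnt) true) (each (.bank .cnt) fun _ => .pop (.bank i) fun
    | some true => .seq (.push (.bank j) true)
        (.seq (.push (.bank .cnt) true) (.push (.bank .cnt) true))
    | some false => .push (.bank j) false
    | none => .skip)

section Move

variable {i j : Bank}

theorem runs_unload (e : Ports) (hij : i ≠ j) (l : List Bool) (S : Bank → List Bool)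
    (hS : S i = l) :
    Runs (unload i j) (store e S)
      (store e (Function.update (Function.update S i []) j (l.reverse ++ S j)))
      (2 * l.length + 1) := by
  induction l generalizing S with
  | nil =>
    refine (Runs.each_nil_bank hS).cast (store_congr fun k => ?_) (by simp)
    simp [show Function.update S i [] = S from hS ▸ Function.update_eq_self ..]
  | cons a l ih =>
    refine (Runs.each_cons_bank hS (Runs.push_bank e _ j a) (ih _ (by simp [hij]))).cast
      (store_congr fun k => ?_) (by simp; omega)
    simp only [Function.update_apply]
    split_ifs <;> simp_all

theorem runs_moveTree_loop (e : Ports) (hij : i ≠ j) (hi : i ≠ .cnt) (hj : j ≠ .cnt)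
    {f : Bool → Prog} (hf : ∀ a, f a = .pop (.bank i) fun
      | some true => .seq (.push (.bank j) true)
          (.seq (.push (.bank .cnt) true) (.push (.bank .cnt) true))
      | some false => .push (.bank j) false
      | none => .skip) (t : BinaryTree Unit)
    (S : Bank → List Bool) (x cs : List Bool) (s' : ∀ k, List (Alph k)) (T : ℕ)
    (hS : S i = treeBits t ++ x) (hc : S .cnt = true :: cs)
    (hrest : Runs (each (.bank .cnt) f) (store e (Function.update (Function.update
        (Function.update S i x) j ((treeBits t).reverse ++ S j)) .cnt cs)) s' T) :
    Runs (each (.bank .cnt) f) (store e S) s' (5 * (treeBits t).length + T) := by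
  induction t generalizing S x cs T with
  | nil =>
    have hbody : Runs (f true) (store e (Function.update S .cnt cs)) (store e (Function.update
        (Function.update (Function.update S i x) j ([false].reverse ++ S j)) .cnt cs)) 2 := by
      rw [hf]
      refine (Runs.pop_bank (a := false) (l := x) ?_ (Runs.push_bank ..)).cast
        (store_congr fun k => ?_) (by omega)
      · simpa [hi, treeBits] using hS
      · simp only [Function.update_apply]
        split_ifs <;> simp_all
    exact (Runs.each_cons_bank hc hbody hrest).mono (by simp [treeBits])
  | node _ a b iha ihb =>
    have hbody : Runs (f true) (store e (Function.update S .cnt cs)) (store e (Function.update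
        (Function.update (Function.update S i (treeBits a ++ (treeBits b ++ x))) j (true :: S j))
          .cnt (true :: true :: cs))) 4 := by
      rw [hf]
      refine (Runs.pop_bank (a := true) (l := treeBits a ++ (treeBits b ++ x)) ?_
        (.seq (Runs.push_bank ..) (.seq (Runs.push_bank ..) (Runs.push_bank ..)))).cast
        (store_congr fun k => ?_) (by omega)
      · simpa [hi, treeBits] using hS
      · simp only [Function.update_apply]
        split_ifs <;> simp_all
    refine (Runs.each_cons_bank hc hbody (iha _ (treeBits b ++ x) (true :: cs)
      (5 * (treeBits b).length + T) ?_ ?_ (ihb _ x cs T ?_ ?_ (hrest.congr_left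
        (store_congr fun k => ?_))))).mono (by simp [treeBits]; omega)
    · simp [hij, hi]
    · simp
    · simp [hij, hi]
    · simp
    · simp only [Function.update_apply]
      split_ifs <;> simp_all [treeBits]

theorem runs_moveTree (e : Ports) (hij : i ≠ j) (hi : i ≠ .cnt) (hj : j ≠ .cnt)
    (t : BinaryTree Unit) (S : Bank → List Bool) (x : List Bool) (hS : S i = treeBits t ++ x)
    (hc : S .cnt = []) :
    Runs (moveTree i j) (store e S)
      (store e (Function.update (Function.update S i x) j ((treeBits t).reverse ++ S j)))
      (5 * (treeBits t).length + 2) := by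
  refine (Runs.seq (Runs.push_bank e S .cnt true)
    (runs_moveTree_loop e hij hi hj (fun _ => rfl) t _ x [] _ 1 ?_ ?_
      ((Runs.each_nil_bank ?_).cast (store_congr fun k => ?_) le_rfl))).mono (by omega)
  · simp [hi, hS]
  · simp [hc]
  · simp
  · simp only [Function.update_apply]
    split_ifs <;> simp_all

end Move

/-- The working stacks with given values and saved values. -/
def banks (x y : List Bool) : Bank → List Bool
  | .val => x
  | .ret => y
  | _ => []

/-- The contents of all stacks between two operations of the tree machine. -/
abbrev conf (e : Ports) (x y : List Bool) : ∀ k, List (Alph k) := store e (banks x y)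

/-- Moves the tree on top of the values to the saved values. -/
def save : Prog := .seq (moveTree .val .tmp) (unload .tmp .ret)

/-- Moves the tree on top of the saved values to the values. -/
def restore : Prog := .seq (moveTree .ret .tmp) (unload .tmp .val)

/-- Duplicates the tree on top of the values. -/
def dup : Prog :=
  .seq (moveTree .val .tmp)
    (.seq (each (.bank .tmp) fun a => .seq (.push (.bank .val) a) (.push (.bank .ret) a)) restore)

/-- Exchanges the two topmost trees of the values. -/
def swap : Prog := .seq save (.seq (moveTree .val .aux) (.seq restore (unload .aux .val)))

/-- Removes the tree on top of the values. -/
def drop : Prog := .seq (moveTree .val .tmp) (each (.bank .tmp) fun _ => .skip)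

section Operations

variable (e : Ports) (t u : BinaryTree Unit) (l x y : List Bool) (S : Bank → List Bool)

theorem runs_save :
    Runs save (conf e (treeBits t ++ x) y) (conf e x (treeBits t ++ y))
      (7 * (treeBits t).length + 3) := by
  have hmove := runs_moveTree e (i := .val) (j := .tmp) (by decide) (by decide) (by decide) t
    (banks (treeBits t ++ x) y) x rfl rfl
  refine (hmove.seq (runs_unload e (by decide) (treeBits t).reverse _ (by simp [banks]))).cast
    (store_congr fun k => ?_) (by simp; omega)
  cases k <;> simp [banks]

theorem runs_restore :
    Runs restore (conf e x (treeBits t ++ y)) (conf e (treeBits t ++ x) y)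
      (7 * (treeBits t).length + 3) := by
  have hmove := runs_moveTree e (i := .ret) (j := .tmp) (by decide) (by decide) (by decide) t
    (banks x (treeBits t ++ y)) y rfl rfl
  refine (hmove.seq (runs_unload e (by decide) (treeBits t).reverse _ (by simp [banks]))).cast
    (store_congr fun k => ?_) (by simp; omega)
  cases k <;> simp [banks]

theorem runs_copy (hS : S .tmp = l) :
    Runs (each (.bank .tmp) fun a => .seq (.push (.bank .val) a) (.push (.bank .ret) a))
      (store e S) (store e (Function.update (Function.update (Function.update S .tmp [])
        .val (l.reverse ++ S .val)) .ret (l.reverse ++ S .ret))) (3 * l.length + 1) := by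
  induction l generalizing S with
  | nil =>
    refine (Runs.each_nil_bank hS).cast (store_congr fun k => ?_) (by simp)
    simp [show Function.update S .tmp [] = S from hS ▸ Function.update_eq_self ..]
  | cons a l ih =>
    have hbody := (Runs.push_bank e (Function.update S .tmp l) .val a).seq
      (Runs.push_bank e _ .ret a)
    refine (Runs.each_cons_bank hS hbody (ih _ (by simp))).cast (store_congr fun k => ?_)
      (by simp; omega)
    cases k <;> simp

theorem runs_clear (hS : S .tmp = l) :
    Runs (each (.bank .tmp) fun _ => .skip) (store e S) (store e (Function.update S .tmp []))
      (2 * l.length + 1) := by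
  induction l generalizing S with
  | nil =>
    refine (Runs.each_nil_bank hS).cast (store_congr fun k => ?_) (by simp)
    simp [show Function.update S .tmp [] = S from hS ▸ Function.update_eq_self ..]
  | cons a l ih =>
    refine (Runs.each_cons_bank hS .skip (ih _ (by simp))).cast
      (store_congr fun k => ?_) (by simp; omega)
    simp

theorem runs_dup :
    Runs dup (conf e (treeBits t ++ x) y) (conf e (treeBits t ++ (treeBits t ++ x)) y)
      (15 * (treeBits t).length + 6) := by
  have hmove := runs_moveTree e (i := .val) (j := .tmp) (by decide) (by decide) (by decide) t
    (banks (treeBits t ++ x) y) x rfl rfl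
  refine (hmove.seq ((runs_copy e (treeBits t).reverse _ (by simp [banks])).seq
    ((runs_restore e t (treeBits t ++ x) y).congr_left (store_congr fun k => ?_)))).mono
    (by simp; omega)
  cases k <;> simp [banks]

theorem runs_drop :
    Runs drop (conf e (treeBits t ++ x) y) (conf e x y) (7 * (treeBits t).length + 3) := by
  have hmove := runs_moveTree e (i := .val) (j := .tmp) (by decide) (by decide) (by decide) t
    (banks (treeBits t ++ x) y) x rfl rfl
  refine (hmove.seq (runs_clear e (treeBits t).reverse _ (by simp [banks]))).cast
    (store_congr fun k => ?_) (by simp; omega)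
  cases k <;> simp [banks]

theorem runs_swap :
    Runs swap (conf e (treeBits t ++ (treeBits u ++ x)) y)
      (conf e (treeBits u ++ (treeBits t ++ x)) y)
      (14 * (treeBits t).length + 7 * (treeBits u).length + 10) := by
  have hmove := runs_moveTree e (i := .val) (j := .aux) (by decide) (by decide) (by decide) u
    (banks (treeBits u ++ x) (treeBits t ++ y)) x rfl rfl
  have hrestore := (runs_moveTree e (i := .ret) (j := .tmp) (by decide) (by decide) (by decide) t
    (Function.update (Function.update (banks (treeBits u ++ x) (treeBits t ++ y)) Bank.val x)
      Bank.aux ((treeBits u).reverse ++ [])) y (by simp [banks]) (by simp [banks])).seq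
    (runs_unload e (i := .tmp) (j := .val) (by decide) (treeBits t).reverse _ (by simp [banks]))
  have hunload := hrestore.seq (runs_unload e (i := .aux) (j := .val) (by decide)
    (treeBits u).reverse _ (by simp [banks]))
  refine ((runs_save e t (treeBits u ++ x) y).seq (hmove.seq hunload)).cast
    (store_congr fun k => ?_) (by simp; omega)
  cases k <;> simp [banks]

end Operations

end StackProg

/-! ### Functions computable in polynomial time -/

namespace StackProg

/-- Types whose elements are represented by trees. -/
class ToTree (α : Type) where
  toTree : α → BinaryTree Unit

open ToTree

/-- The code of `a` on a stack of the tree machine. -/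
def bits {α : Type} [ToTree α] (a : α) : List Bool := treeBits (toTree a)

/-- The length of the code of `a`: the measure of the input in all running times. -/
def size {α : Type} [ToTree α] (a : α) : ℕ := (bits a).length

instance : ToTree Unit := ⟨fun _ => .nil⟩

instance : ToTree Bool := ⟨fun b => if b then .node () .nil .nil else .nil⟩

instance {α β : Type} [ToTree α] [ToTree β] : ToTree (α × β) :=
  ⟨fun p => .node () (toTree p.1) (toTree p.2)⟩

instance {α : Type} [ToTree α] : ToTree (List α) :=
  ⟨fun l => l.foldr (fun a t => .node () (toTree a) t) .nil⟩

/-- Natural numbers are represented in unary. -/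
instance : ToTree ℕ := ⟨fun n => n.rec .nil fun _ t => .node () .nil t⟩

section Size

variable {α β : Type} [ToTree α] [ToTree β]

theorem bits_pair (a : α) (b : β) : bits (a, b) = true :: (bits a ++ bits b) := rfl

theorem bits_nil : bits ([] : List α) = [false] := rfl

theorem bits_cons (a : α) (l : List α) : bits (a :: l) = true :: (bits a ++ bits l) := rfl

theorem bits_succ (n : ℕ) : bits (n + 1) = true :: false :: bits n := rfl

@[simp] theorem size_pair (a : α) (b : β) : size (a, b) = size a + size b + 1 := by
  simp [size, bits_pair]

@[simp] theorem size_nil : size ([] : List α) = 1 := rfl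

@[simp] theorem size_cons (a : α) (l : List α) : size (a :: l) = size a + size l + 1 := by
  simp [size, bits_cons]

@[simp] theorem size_nat (n : ℕ) : size n = 2 * n + 1 := by
  induction n with
  | zero => rfl
  | succ n ih =>
    have hsucc : size (n + 1) = size n + 2 := by simp [size, bits_succ]
    omega

theorem size_bool (b : Bool) : size b ≤ 3 := by
  cases b <;> simp [size, bits, toTree, treeBits]

theorem size_pos (a : α) : 0 < size a := treeBits_length_pos _

theorem size_append (l l' : List α) : size (l ++ l') + 1 = size l + size l' := by
  induction l with
  | nil => simp [add_comm]
  | cons a l ih => simp only [List.cons_append, size_cons]; omega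

theorem length_lt_size (l : List α) : l.length < size l := by
  induction l with
  | nil => simp
  | cons a l ih => simp; omega

theorem size_lt_of_mem {a : α} {l : List α} (h : a ∈ l) : size a < size l := by
  induction l with
  | nil => simp at h
  | cons b l ih =>
    rcases List.mem_cons.1 h with rfl | h
    · simp only [size_cons]; omega
    · have := ih h
      simp; omega

end Size

/-- `T` is bounded by a polynomial in `B`. -/
def PolyBounded {α : Type} (B T : α → ℕ) : Prop := ∃ c, ∀ a, T a ≤ (B a + 2) ^ c

namespace PolyBounded

variable {α β : Type} {B T T' : α → ℕ}

theorem mono (h : PolyBounded B T) (hT : ∀ a, T' a ≤ T a) : PolyBounded B T' :=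
  h.imp fun _ hc a => (hT a).trans (hc a)

theorem self : PolyBounded B B := ⟨1, fun a => by simp⟩

theorem const (n : ℕ) : PolyBounded B (fun _ => n) :=
  ⟨n, fun _ => (Nat.lt_two_pow_self).le.trans (Nat.pow_le_pow_left (by omega) n)⟩

theorem mul (h : PolyBounded B T) (h' : PolyBounded B T') :
    PolyBounded B (fun a => T a * T' a) := by
  obtain ⟨c, hc⟩ := h
  obtain ⟨d, hd⟩ := h'
  exact ⟨c + d, fun a => by rw [pow_add]; exact Nat.mul_le_mul (hc a) (hd a)⟩

theorem add (h : PolyBounded B T) (h' : PolyBounded B T') :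
    PolyBounded B (fun a => T a + T' a) := by
  have hmul : PolyBounded B fun a => (T a + 1) * (T' a + 1) := by
    obtain ⟨c, hc⟩ := h
    obtain ⟨d, hd⟩ := h'
    have succ_le (T : α → ℕ) (c : ℕ) (hc : ∀ a, T a ≤ (B a + 2) ^ c) (a : α) :
        T a + 1 ≤ (B a + 2) ^ (c + 1) := by
      have := hc a
      have := Nat.one_le_pow c (B a + 2) (by omega)
      rw [pow_succ, Nat.mul_add]
      omega
    exact mul ⟨c + 1, succ_le T c hc⟩ ⟨d + 1, succ_le T' d hd⟩
  exact hmul.mono fun a => by rw [add_mul, mul_add]; omega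

theorem pow (h : PolyBounded B T) (n : ℕ) : PolyBounded B (fun a => T a ^ n) := by
  obtain ⟨c, hc⟩ := h
  exact ⟨c * n, fun a => by rw [pow_mul]; exact Nat.pow_le_pow_left (hc a) n⟩

theorem comp {S U : β → ℕ} (h : PolyBounded S U) {f : α → β}
    (hf : PolyBounded B (fun a => S (f a))) : PolyBounded B (fun a => U (f a)) := by
  obtain ⟨c, hc⟩ := h
  exact ((hf.add (const 2)).pow c).mono fun a => hc _

end PolyBounded

section Values

variable {e : Ports} {x y z : List Bool}

theorem banks_update_val : Function.update (banks x y) .val z = banks z y := by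
  funext k
  cases k <;> simp [banks]

theorem runs_push_val (e : Ports) (b : Bool) (x y : List Bool) :
    Runs (.push (.bank .val) b) (conf e x y) (conf e (b :: x) y) 1 := by
  have hpush := Runs.push_bank e (banks x y) .val b
  rwa [banks_update_val] at hpush

theorem runs_pop_val {f : Option Bool → Prog} {b : Bool} {s' : ∀ k, List (Alph k)} {t : ℕ}
    (h : Runs (f (some b)) (conf e x y) s' t) :
    Runs (.pop (.bank .val) f) (conf e (b :: x) y) s' (1 + t) := by
  refine Runs.pop_bank (a := b) (l := x) rfl ?_
  rwa [banks_update_val]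

/-- Removes the first symbol of the code of a pair. -/
def unpair : Prog := .pop (.bank .val) fun _ => .skip

theorem runs_unpair {α β : Type} [ToTree α] [ToTree β] (a : α) (b : β) :
    Runs unpair (conf e (bits (a, b) ++ x) y) (conf e (bits a ++ (bits b ++ x)) y) 2 := by
  rw [bits_pair, List.cons_append, List.append_assoc]
  exact runs_pop_val (f := fun _ => .skip) .skip

/-- Writes a word on top of the values. -/
def pushAll : List Bool → Prog
  | [] => .skip
  | b :: l => .seq (pushAll l) (.push (.bank .val) b)

theorem runs_pushAll (l : List Bool) :
    Runs (pushAll l) (conf e x y) (conf e (l ++ x) y) (l.length + 1) := by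
  induction l with
  | nil => exact .skip
  | cons b l ih => exact ih.seq (runs_push_val e b _ y)

end Values

section Computation

variable {α β γ σ : Type} [ToTree α] [ToTree β] [ToTree γ] [ToTree σ]

/-- The program `p` computes `f` in time `T` on top of the value stack. -/
def Computes (p : Prog) (f : α → β) (T : α → ℕ) : Prop :=
  ∀ a e x y, Runs p (conf e (bits a ++ x) y) (conf e (bits (f a) ++ x) y) (T a)

/-- `f` is computable in time polynomial in `B`, where `B` bounds the input polynomially. A bound
`B` other than `size` keeps track of the length of an original input along a composition. -/
structure PolyTimeIn (B : α → ℕ) (f : α → β) : Prop where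
  computes : ∃ p T, Computes p f T ∧ PolyBounded B T
  input : PolyBounded B size
  output : PolyBounded B fun a => size (f a)

/-- `f` is computable in polynomial time. -/
abbrev PolyTime (f : α → β) : Prop := PolyTimeIn size f

variable {B : α → ℕ}

theorem PolyTimeIn.comp_of_polyBounded {B' : β → ℕ} {f : α → β} {g : β → γ}
    (hg : PolyTimeIn B' g) (hf : PolyTimeIn B f) (hB : PolyBounded B fun a => B' (f a)) :
    PolyTimeIn B (fun x => g (f x)) := by
  obtain ⟨⟨p, T, hp, hT⟩, hin, -⟩ := hf
  obtain ⟨⟨q, U, hq, hU⟩, -, hout⟩ := hg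
  exact ⟨⟨.seq p q, fun a => T a + U (f a), fun a e x y => (hp a e x y).seq (hq _ e x y),
    hT.add (hU.comp hB)⟩, hin, hout.comp hB⟩

theorem PolyTimeIn.comp {f : α → β} {g : β → γ} (hg : PolyTime g) (hf : PolyTimeIn B f) :
    PolyTimeIn B (fun x => g (f x)) :=
  hg.comp_of_polyBounded hf hf.output

theorem PolyTime.of_bits_eq {f : α → β} (hf : ∀ a, bits (f a) = bits a) : PolyTime f :=
  ⟨⟨.skip, fun _ => 1, fun a e x y => by rw [hf]; exact .skip, .const 1⟩, .self,
    PolyBounded.self.mono fun a => by simp [size, hf]⟩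

theorem PolyTimeIn.of_polyTime {f : α → β} (hf : PolyTime f) (hB : PolyBounded B size) :
    PolyTimeIn B f := by
  obtain ⟨⟨p, T, hp, hT⟩, -, hout⟩ := hf
  exact ⟨⟨p, T, hp, hT.comp (f := fun a => a) hB⟩, hB, hout.comp (f := fun a => a) hB⟩

theorem PolyTimeIn.id (hB : PolyBounded B size) : PolyTimeIn B (fun x : α => x) :=
  .of_polyTime (PolyTime.of_bits_eq fun _ => rfl) hB

theorem PolyTime.id : PolyTime (fun x : α => x) := PolyTimeIn.id .self

theorem PolyTimeIn.recast {f : α → β} {f' : α → γ} (hf : PolyTimeIn B f)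
    (h : ∀ a, bits (f' a) = bits (f a)) : PolyTimeIn B f' := by
  obtain ⟨⟨p, T, hp, hT⟩, hin, hout⟩ := hf
  exact ⟨⟨p, T, fun a e x y => by rw [h]; exact hp a e x y, hT⟩, hin,
    hout.mono fun a => by simp [size, h]⟩

theorem PolyTimeIn.congr {f f' : α → β} (hf : PolyTimeIn B f) (h : ∀ a, f' a = f a) :
    PolyTimeIn B f' :=
  (funext h : f' = f) ▸ hf

theorem PolyTimeIn.pair {f : α → β} {g : α → γ} (hf : PolyTimeIn B f) (hg : PolyTimeIn B g) :
    PolyTimeIn B (fun x => (f x, g x)) := by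
  obtain ⟨⟨p, T, hp, hT⟩, hin, hout⟩ := hf
  obtain ⟨⟨q, U, hq, hU⟩, -, hout'⟩ := hg
  refine ⟨⟨.seq dup (.seq p (.seq swap (.seq q (.seq swap (.push (.bank .val) true))))),
    fun a => 15 * size a + 6 + (T a + ((14 * size (f a) + 7 * size a + 10) +
      (U a + ((14 * size (g a) + 7 * size (f a) + 10) + 1)))), fun a e x y => ?_, ?_⟩, hin, ?_⟩
  · exact (runs_dup e _ x y).seq ((hp a e _ y).seq ((runs_swap e _ _ x y).seq
      ((hq a e _ y).seq ((runs_swap e _ _ x y).seq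
        ((runs_push_val e true _ y).cast (by simp [bits, toTree, treeBits]) le_rfl)))))
  · exact (((PolyBounded.const 15).mul hin).add (.const 6)).add (hT.add
      (((((PolyBounded.const 14).mul hout).add ((PolyBounded.const 7).mul hin)).add
      (.const 10)).add (hU.add (((((PolyBounded.const 14).mul hout').add
        ((PolyBounded.const 7).mul hout)).add (.const 10)).add (.const 1)))))
  · exact ((hout.add hout').add (.const 1)).mono fun a => by simp

theorem PolyTime.left : PolyTime (fun p : α × β => p.1) := by
  refine ⟨⟨.seq unpair (.seq swap drop),
    fun p => 2 + ((14 * size p.1 + 7 * size p.2 + 10) + (7 * size p.2 + 3)),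
    fun a e x y => (runs_unpair a.1 a.2).seq ((runs_swap e _ _ x y).seq (runs_drop e _ _ y)),
    ?_⟩, .self, PolyBounded.self.mono fun ⟨a, b⟩ => by simp only [size_pair]; omega⟩
  exact ((PolyBounded.const 15).add ((PolyBounded.const 28).mul .self)).mono fun ⟨a, b⟩ => by
    simp only [size_pair]; omega

theorem PolyTime.right : PolyTime (fun p : α × β => p.2) := by
  refine ⟨⟨.seq unpair drop, fun p => 2 + (7 * size p.1 + 3),
    fun a e x y => (runs_unpair a.1 a.2).seq (runs_drop e _ _ y), ?_⟩, .self,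
    PolyBounded.self.mono fun ⟨a, b⟩ => by simp only [size_pair]; omega⟩
  exact ((PolyBounded.const 5).add ((PolyBounded.const 7).mul .self)).mono fun ⟨a, b⟩ => by
    simp only [size_pair]; omega

theorem PolyTimeIn.fst {f : α → β × γ} (hf : PolyTimeIn B f) : PolyTimeIn B (fun x => (f x).1) :=
  PolyTime.left.comp hf

theorem PolyTimeIn.snd {f : α → β × γ} (hf : PolyTimeIn B f) : PolyTimeIn B (fun x => (f x).2) :=
  PolyTime.right.comp hf

theorem PolyTime.const (b : β) : PolyTime (fun _ : α => b) := by
  refine ⟨⟨.seq drop (pushAll (bits b)), fun a => (7 * size a + 3) + (size b + 1),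
    fun a e x y => (runs_drop e _ x y).seq (runs_pushAll _), ?_⟩, .self, .const _⟩
  exact (((PolyBounded.const 7).mul .self).add (.const 3)).add (.const _)

end Computation

section ListCase

variable {α β γ : Type} [ToTree α] [ToTree γ]

/-- Case distinction on a list, with a parameter that is passed to both cases. -/
def listCase (f : γ → β) (g : (α × List α) × γ → β) : List α × γ → β
  | ([], c) => f c
  | (a :: l, c) => g ((a, l), c)

theorem PolyBounded.listCase {T : γ → ℕ} {U : (α × List α) × γ → ℕ} (hT : PolyBounded size T)
    (hU : PolyBounded size U) : PolyBounded size (listCase T U) := by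
  obtain ⟨c, hc⟩ := hT
  obtain ⟨d, hd⟩ := hU
  refine ((PolyBounded.self.add (.const 2)).pow c).add
    ((PolyBounded.self.add (.const 2)).pow d) |>.mono ?_
  rintro ⟨_ | ⟨a, l⟩, s⟩
  · refine (hc s).trans ((Nat.pow_le_pow_left ?_ c).trans (Nat.le_add_right ..))
    simp only [size_pair]; omega
  · refine (hd ((a, l), s)).trans ((Nat.pow_le_pow_left ?_ d).trans (Nat.le_add_left ..))
    simp

/-- Case distinction on whether the list in a pair is empty. -/
def caseProg (p q : Prog) : Prog :=
  .pop (.bank .val) fun _ => .pop (.bank .val) fun o =>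
    if o = some true then .seq (.push (.bank .val) true) (.seq (.push (.bank .val) true) q) else p

variable [ToTree β]

theorem Computes.listCase {p q : Prog} {f : γ → β} {g : (α × List α) × γ → β} {T : γ → ℕ}
    {U : (α × List α) × γ → ℕ} (hp : Computes p f T) (hq : Computes q g U) :
    Computes (caseProg p q) (listCase f g) fun x => listCase T U x + 4 := by
  rintro ⟨_ | ⟨a, l⟩, s⟩ e x y
  · rw [bits_pair, bits_nil]
    exact (runs_pop_val (runs_pop_val (b := false) (x := bits s ++ x) (hp s e x y))).mono
      (by simp only [StackProg.listCase]; omega)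
  · rw [bits_pair, bits_cons]
    have hcase : Runs q (conf e (true :: true :: (bits a ++ (bits l ++ (bits s ++ x)))) y)
        (conf e (bits (g ((a, l), s)) ++ x) y) (U ((a, l), s)) :=
      (hq ((a, l), s) e x y).congr_left (by simp [bits_pair])
    have hbranch := (runs_push_val e true (bits a ++ (bits l ++ (bits s ++ x))) y).seq
      ((runs_push_val e true _ y).seq hcase)
    refine (runs_pop_val (b := true) (runs_pop_val (b := true) hbranch)).mono ?_ |>.congr_left ?_
    · simp only [StackProg.listCase]; omega
    · simp

theorem PolyTime.listCase {f : γ → β} {g : (α × List α) × γ → β} (hf : PolyTime f)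
    (hg : PolyTime g) : PolyTime (listCase f g) := by
  obtain ⟨⟨p, T, hp, hT⟩, -, hout⟩ := hf
  obtain ⟨⟨q, U, hq, hU⟩, -, hout'⟩ := hg
  refine ⟨⟨caseProg p q, _, hp.listCase hq, (hT.listCase hU).add (.const 4)⟩, .self,
    (hout.listCase hout').mono ?_⟩
  rintro ⟨_ | ⟨a, l⟩, s⟩ <;> rfl

end ListCase

section Fold

variable {α γ σ : Type} [ToTree α] [ToTree γ] [ToTree σ]

/-- One step of `List.foldl`, where `q` computes the new state from the first element of the list
and the old state. -/
def foldStep (q : Prog) : Prog :=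
  .seq save (.seq swap (.seq restore (.seq (.push (.bank .val) true) (.seq q swap))))

/-- The loop of `List.foldl`. -/
def foldProg (q : Prog) : Prog := .loop (.bank .val) (fun o => o != some true) fun _ => foldStep q

variable {q : Prog} {g : α × σ → σ} {U : α × σ → ℕ}

theorem runs_foldStep (hq : Computes q g U) (e : Ports) (a : α) (l : List α) (s : σ)
    (x y : List Bool) :
    Runs (foldStep q) (conf e (bits a ++ (bits l ++ (bits s ++ x))) y)
      (conf e (bits l ++ (bits (g (a, s)) ++ x)) y)
      (14 * size a + 21 * size l + 7 * size s + 14 * size (g (a, s)) + U (a, s) + 27) := by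
  have hsave : Runs save _ (conf e (bits l ++ (bits s ++ x)) (bits a ++ y)) (7 * size a + 3) :=
    runs_save e ..
  have hswap : Runs swap _ (conf e (bits s ++ (bits l ++ x)) (bits a ++ y))
      (14 * size l + 7 * size s + 10) := runs_swap e ..
  have hrestore : Runs restore _ (conf e (bits a ++ (bits s ++ (bits l ++ x))) y)
      (7 * size a + 3) := runs_restore e ..
  have hstate : Runs q (conf e (true :: (bits a ++ (bits s ++ (bits l ++ x)))) y) _ (U (a, s)) :=
    (hq (a, s) e (bits l ++ x) y).congr_left (by simp [bits_pair])
  have hswap' : Runs swap _ (conf e (bits l ++ (bits (g (a, s)) ++ x)) y)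
      (14 * size (g (a, s)) + 7 * size l + 10) := runs_swap e ..
  exact (hsave.seq (hswap.seq (hrestore.seq ((runs_push_val ..).seq
    (hstate.seq hswap'))))).mono (by omega)

theorem runs_foldProg (hq : Computes q g U) (e : Ports) (x y : List Bool) (M W : ℕ)
    (l : List α) (s : σ) (hM : ∀ l₁, l₁ <+: l → size (l₁.foldl (fun s a => g (a, s)) s) ≤ M)
    (hU : ∀ a s, a ∈ l → size s ≤ M → U (a, s) ≤ W) :
    Runs (foldProg q) (conf e (bits l ++ (bits s ++ x)) y)
      (conf e (bits (l.foldl (fun s a => g (a, s)) s) ++ x) y)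
      (l.length * (50 * (size l + M + W + 1)) + 1) := by
  induction l generalizing s with
  | nil =>
    refine (Runs.loop_exit_bank (a := false) (l := bits s ++ x) rfl rfl).cast ?_ (by simp)
    rw [banks_update_val, List.foldl_nil]
  | cons a l ih =>
    have hs : size s ≤ M := hM [] List.nil_prefix
    have hs' : size (g (a, s)) ≤ M := hM [a] (by simp)
    have hUas := hU a s (by simp) hs
    have hrest := ih (g (a, s)) (fun l₁ hl₁ => hM (a :: l₁) (by simpa using hl₁))
      (fun b s hb => hU b s (List.mem_cons_of_mem _ hb))
    refine (Runs.loop_step_bank (a := true) (l := bits a ++ (bits l ++ (bits s ++ x)))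
      (by simp [banks, bits_cons]) rfl ((runs_foldStep hq e a l s x y).congr_left ?_)
      hrest).mono ?_
    · rw [banks_update_val]
    · have hmono : l.length * (50 * (size l + M + W + 1)) ≤
          l.length * (50 * (size a + size l + 1 + M + W + 1)) :=
        Nat.mul_le_mul_left _ (by omega)
      rw [size_cons, List.length_cons, Nat.add_mul, Nat.one_mul]
      omega

theorem PolyTimeIn.foldl_pair {B : γ → ℕ} {l : γ → List α} {i : γ → σ} (hl : PolyTimeIn B l)
    (hi : PolyTimeIn B i) (hg : PolyTime g) {M : γ → ℕ} (hM : PolyBounded B M)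
    (hsize : ∀ c l₁, l₁ <+: l c → size (l₁.foldl (fun s a => g (a, s)) (i c)) ≤ M c) :
    PolyTimeIn B (fun c => (l c).foldl (fun s a => g (a, s)) (i c)) := by
  obtain ⟨⟨p, T, hp, hT⟩, hin, -⟩ := hl.pair hi
  obtain ⟨⟨q, U, hq, c, hU⟩, -, -⟩ := hg
  let W : γ → ℕ := fun x => (size (l x) + M x + 3) ^ c
  have hW : PolyBounded B W := ((hl.output.add hM).add (.const 3)).pow c
  refine ⟨⟨.seq p (.seq unpair (foldProg q)),
    fun x => T x + (2 + (size (l x) * (50 * (size (l x) + M x + W x + 1)) + 1)),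
    fun a e x y => ?_, ?_⟩, hin, hM.mono fun a => hsize a (l a) List.prefix_rfl⟩
  · refine (hp a e x y).seq ((runs_unpair (l a) (i a)).seq
      ((runs_foldProg hq e x y (M a) (W a) (l a) (i a) (hsize a) fun b s hb hs => ?_).mono ?_))
    · refine (hU _).trans (Nat.pow_le_pow_left ?_ c)
      have := size_lt_of_mem hb
      rw [size_pair]; omega
    · gcongr
      exact (length_lt_size (l a)).le
  · exact hT.add ((PolyBounded.const 2).add ((hl.output.mul ((PolyBounded.const 50).mul
      (((hl.output.add hM).add hW).add (.const 1)))).add (.const 1)))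

end Fold

end StackProg

/-! ### Basic polynomial-time functions -/

namespace StackProg

theorem size_foldl_le {α σ : Type} [ToTree σ] {g : σ → α → σ} {l : List α} {G : ℕ} (s : σ)
    (h : ∀ s, ∀ a ∈ l, size (g s a) ≤ size s + G) :
    size (l.foldl g s) ≤ size s + l.length * G := by
  induction l generalizing s with
  | nil => simp
  | cons a l ih =>
    have hstep := h s a (by simp)
    have hrest := ih (g s a) fun s b hb => h s b (List.mem_cons_of_mem _ hb)
    rw [List.foldl_cons, List.length_cons, Nat.add_mul, Nat.one_mul]
    omega

section Functions

variable {α β γ δ σ : Type} [ToTree α] [ToTree β] [ToTree γ] [ToTree δ] [ToTree σ] {B : γ → ℕ}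

theorem PolyTimeIn.const {f : γ → α} (hf : PolyTimeIn B f) (b : β) : PolyTimeIn B (fun _ => b) :=
  (PolyTime.const b).comp hf

theorem PolyTimeIn.cons {f : γ → α} {g : γ → List α} (hf : PolyTimeIn B f)
    (hg : PolyTimeIn B g) : PolyTimeIn B (fun c => f c :: g c) :=
  (hf.pair hg).recast fun _ => rfl

theorem PolyTimeIn.comp₂ {f : γ → α} {g : γ → β} {h : α → β → δ}
    (hh : PolyTime fun p : α × β => h p.1 p.2) (hf : PolyTimeIn B f) (hg : PolyTimeIn B g) :
    PolyTimeIn B (fun c => h (f c) (g c)) :=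
  hh.comp (hf.pair hg)

theorem PolyTimeIn.cond {b : γ → Bool} {f g : γ → β} (hb : PolyTimeIn B b)
    (hf : PolyTimeIn B f) (hg : PolyTimeIn B g) :
    PolyTimeIn B (fun c => bif b c then f c else g c) := by
  have hlist : PolyTimeIn B fun c => ((if b c then [()] else [] : List Unit), (f c, g c)) := by
    refine (hb.recast fun c => ?_).pair (hf.pair hg)
    cases b c <;> rfl
  refine (PolyTimeIn.comp (PolyTime.listCase (α := Unit) (f := fun p : β × β => p.2)
    (g := fun q => q.2.1) PolyTime.right PolyTime.right.fst) hlist).congr fun c => ?_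
  cases b c <;> rfl

theorem PolyTimeIn.ite {p : γ → Prop} [DecidablePred p] {f g : γ → β}
    (hp : PolyTimeIn B (fun c => decide (p c))) (hf : PolyTimeIn B f) (hg : PolyTimeIn B g) :
    PolyTimeIn B (fun c => if p c then f c else g c) :=
  (hp.cond hf hg).congr fun c => by by_cases h : p c <;> simp [h]

theorem PolyTimeIn.and {b b' : γ → Bool} (hb : PolyTimeIn B b) (hb' : PolyTimeIn B b') :
    PolyTimeIn B (fun c => b c && b' c) :=
  (hb.cond hb' (hb.const false)).congr fun c => by cases b c <;> rfl

theorem PolyTimeIn.or {b b' : γ → Bool} (hb : PolyTimeIn B b) (hb' : PolyTimeIn B b') :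
    PolyTimeIn B (fun c => b c || b' c) :=
  (hb.cond (hb.const true) hb').congr fun c => by cases b c <;> rfl

theorem PolyTimeIn.not {b : γ → Bool} (hb : PolyTimeIn B b) : PolyTimeIn B (fun c => !b c) :=
  (hb.cond (hb.const false) (hb.const true)).congr fun c => by cases b c <;> rfl

theorem PolyTimeIn.xor {b b' : γ → Bool} (hb : PolyTimeIn B b) (hb' : PolyTimeIn B b') :
    PolyTimeIn B (fun c => Bool.xor (b c) (b' c)) :=
  (hb.cond hb'.not hb').congr fun c => by cases b c <;> simp

theorem PolyTimeIn.isEmpty {l : γ → List α} (hl : PolyTimeIn B l) :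
    PolyTimeIn B (fun c => (l c).isEmpty) :=
  (PolyTimeIn.comp (PolyTime.listCase (α := α) (f := fun _ : Unit => true) (g := fun _ => false)
    (PolyTime.const _) (PolyTime.const _)) (hl.pair (hl.const ()))).congr fun c => by
      cases l c <;> rfl

theorem PolyTimeIn.tail {l : γ → List α} (hl : PolyTimeIn B l) :
    PolyTimeIn B (fun c => (l c).tail) :=
  (PolyTimeIn.comp (PolyTime.listCase (α := α) (f := fun _ : Unit => ([] : List α))
    (g := fun p => p.1.2) (PolyTime.const _) PolyTime.left.snd)
    (hl.pair (hl.const ()))).congr fun c => by cases l c <;> rfl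

theorem PolyTimeIn.headD {l : γ → List α} (hl : PolyTimeIn B l) (d : α) :
    PolyTimeIn B (fun c => (l c).headD d) :=
  (PolyTimeIn.comp (PolyTime.listCase (α := α) (f := fun _ : Unit => d) (g := fun p => p.1.1)
    (PolyTime.const _) PolyTime.left.fst) (hl.pair (hl.const ()))).congr fun c => by
      cases l c <;> rfl

theorem PolyTimeIn.foldl_of_bound {l : γ → List α} {i : γ → σ} {g : γ → σ → α → σ}
    (hl : PolyTimeIn B l) (hi : PolyTimeIn B i)
    (hg : PolyTime (fun p : γ × σ × α => g p.1 p.2.1 p.2.2)) {M : γ → ℕ} (hM : PolyBounded B M)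
    (hsize : ∀ c l₁, l₁ <+: l c → size (l₁.foldl (g c) (i c)) ≤ M c) :
    PolyTimeIn B (fun c => (l c).foldl (g c) (i c)) := by
  have foldl_param (c : γ) (l : List α) (s : σ) :
      l.foldl (fun (s : γ × σ) a => (s.1, g s.1 s.2 a)) (c, s) = (c, l.foldl (g c) s) :=
    List.foldl_hom (f := fun s : σ => (c, s)) fun _ _ => rfl
  have hfold := PolyTimeIn.foldl_pair (g := fun q : α × γ × σ => (q.2.1, g q.2.1 q.2.2 q.1))
    hl ((PolyTimeIn.id hl.input).pair hi)
    (PolyTime.right.fst.pair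
      (hg.comp (PolyTime.right.fst.pair (PolyTime.right.snd.pair PolyTime.left))))
    (M := fun c => size c + M c + 1) ((hl.input.add hM).add (.const 1)) fun c l₁ hl₁ => by
      have := hsize c l₁ hl₁
      simp only [foldl_param, size_pair]
      omega
  exact hfold.snd.congr fun c => by simp only [foldl_param]

theorem PolyTimeIn.foldl_of_growth {l : γ → List α} {i : γ → σ} {g : γ → σ → α → σ}
    (hl : PolyTimeIn B l) (hi : PolyTimeIn B i)
    (hg : PolyTime (fun p : γ × σ × α => g p.1 p.2.1 p.2.2)) {G : γ → ℕ} (hG : PolyBounded B G)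
    (hgrowth : ∀ c s a, a ∈ l c → size (g c s a) ≤ size s + G c) :
    PolyTimeIn B (fun c => (l c).foldl (g c) (i c)) := by
  refine PolyTimeIn.foldl_of_bound hl hi hg (M := fun c => size (i c) + size (l c) * G c)
    (hi.output.add (hl.output.mul hG)) fun c l₁ hl₁ => ?_
  refine (size_foldl_le _ fun s a ha => hgrowth c s a (hl₁.subset ha)).trans ?_
  gcongr
  exact hl₁.length_le.trans (length_lt_size (l c)).le

theorem PolyTimeIn.exists_size_le_of_mem {l : γ → List α} (hl : PolyTimeIn B l) {g : γ → α → β}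
    (hg : PolyTime (fun p : γ × α => g p.1 p.2)) :
    ∃ G, PolyBounded B G ∧ ∀ c, ∀ a ∈ l c, size (g c a) ≤ G c := by
  obtain ⟨d, hd⟩ := hg.output
  refine ⟨fun c => (size c + size (l c) + 3) ^ d,
    ((hl.input.add hl.output).add (.const 3)).pow d, fun c a ha => (hd (c, a)).trans ?_⟩
  have := size_lt_of_mem ha
  exact Nat.pow_le_pow_left (by rw [size_pair]; omega) _

theorem PolyTimeIn.reverse {l : γ → List α} (hl : PolyTimeIn B l) :
    PolyTimeIn B (fun c => (l c).reverse) := by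
  refine (PolyTimeIn.foldl_of_growth (i := fun _ => ([] : List α)) (g := fun _ s a => a :: s) hl
    (hl.const _) (PolyTime.right.snd.cons PolyTime.right.fst) (G := fun c => size (l c)) hl.output
    fun c s a ha => ?_).congr fun c => by simp
  have := size_lt_of_mem ha
  simp; omega

theorem PolyTimeIn.append {l l' : γ → List α} (hl : PolyTimeIn B l) (hl' : PolyTimeIn B l') :
    PolyTimeIn B (fun c => l c ++ l' c) := by
  refine (PolyTimeIn.foldl_of_growth (g := fun _ s a => a :: s) hl.reverse hl'
    (PolyTime.right.snd.cons PolyTime.right.fst) (G := fun c => size (l c)) hl.output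
    fun c s a ha => ?_).congr fun c => by simp
  have := size_lt_of_mem (List.mem_reverse.1 ha)
  simp; omega

theorem PolyTimeIn.foldr_of_growth {l : γ → List α} {i : γ → σ} {g : γ → α → σ → σ}
    (hl : PolyTimeIn B l) (hi : PolyTimeIn B i)
    (hg : PolyTime (fun p : γ × σ × α => g p.1 p.2.2 p.2.1)) {G : γ → ℕ} (hG : PolyBounded B G)
    (hgrowth : ∀ c s a, a ∈ l c → size (g c a s) ≤ size s + G c) :
    PolyTimeIn B (fun c => (l c).foldr (g c) (i c)) :=
  (PolyTimeIn.foldl_of_growth (g := fun c s a => g c a s) hl.reverse hi hg hG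
    fun c s a ha => hgrowth c s a (List.mem_reverse.1 ha)).congr fun c => by simp

theorem PolyTimeIn.flatMap {l : γ → List α} {g : γ → α → List β} (hl : PolyTimeIn B l)
    (hg : PolyTime (fun p : γ × α => g p.1 p.2)) :
    PolyTimeIn B (fun c => (l c).flatMap (g c)) := by
  obtain ⟨G, hG, hsize⟩ := hl.exists_size_le_of_mem hg
  refine (PolyTimeIn.foldr_of_growth (i := fun _ => ([] : List β)) (g := fun c a s => g c a ++ s)
    hl (hl.const _) ((hg.comp (PolyTime.left.pair PolyTime.right.snd)).append PolyTime.right.fst) hG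
    fun c s a ha => ?_).congr fun c => by
      induction l c with
      | nil => rfl
      | cons a l ih => simp [ih]
  have := hsize c a ha
  have := size_append (g c a) s
  omega

theorem PolyTimeIn.map {l : γ → List α} {g : γ → α → β} (hl : PolyTimeIn B l)
    (hg : PolyTime (fun p : γ × α => g p.1 p.2)) : PolyTimeIn B (fun c => (l c).map (g c)) :=
  (hl.flatMap (g := fun c a => [g c a]) (hg.cons (PolyTime.const _))).congr fun _ =>
    List.map_eq_flatMap

theorem PolyTimeIn.filter {l : γ → List α} {p : γ → α → Bool} (hl : PolyTimeIn B l)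
    (hp : PolyTime (fun q : γ × α => p q.1 q.2)) : PolyTimeIn B (fun c => (l c).filter (p c)) :=
  (hl.flatMap (g := fun c a => bif p c a then [a] else [])
    (hp.cond (PolyTime.right.cons (PolyTime.const _)) (PolyTime.const _))).congr fun c => by
      induction l c with
      | nil => rfl
      | cons a l ih => cases h : p c a <;> simp [h, ih]

theorem PolyTimeIn.any {l : γ → List α} {p : γ → α → Bool} (hl : PolyTimeIn B l)
    (hp : PolyTime (fun q : γ × α => p q.1 q.2)) : PolyTimeIn B (fun c => (l c).any (p c)) :=
  (hl.filter hp).isEmpty.not.congr fun c => by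
    induction l c with
    | nil => rfl
    | cons a l ih => cases h : p c a <;> simp_all

theorem bits_nat (n : ℕ) : bits n = bits (List.replicate n ()) := by
  induction n with
  | zero => rfl
  | succ n ih => rw [bits_succ, List.replicate_succ, bits_cons, ih]; rfl

theorem PolyTimeIn.replicate_unit {f : γ → ℕ} (hf : PolyTimeIn B f) :
    PolyTimeIn B (fun c => List.replicate (f c) ()) := hf.recast fun _ => (bits_nat _).symm

theorem PolyTimeIn.length {l : γ → List α} (hl : PolyTimeIn B l) :
    PolyTimeIn B (fun c => (l c).length) :=
  (hl.map (g := fun _ _ => ()) (PolyTime.const _)).recast fun c => by rw [bits_nat, List.map_const']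

theorem PolyTimeIn.add {f g : γ → ℕ} (hf : PolyTimeIn B f) (hg : PolyTimeIn B g) :
    PolyTimeIn B (fun c => f c + g c) :=
  (hf.replicate_unit.append hg.replicate_unit).length.congr fun c => by simp

theorem PolyTimeIn.mul {f g : γ → ℕ} (hf : PolyTimeIn B f) (hg : PolyTimeIn B g) :
    PolyTimeIn B (fun c => f c * g c) :=
  (PolyTimeIn.comp (g := fun p : List Unit × List Unit => (p.1.flatMap fun _ => p.2).length)
    (PolyTime.left.flatMap PolyTime.left.snd).length
    (hf.replicate_unit.pair hg.replicate_unit)).congr fun c => by simp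

theorem size_tail_le (l : List α) : size l.tail ≤ size l := by
  cases l
  · simp
  · simp only [List.tail_cons, size_cons]; omega

theorem PolyTimeIn.sub {f g : γ → ℕ} (hf : PolyTimeIn B f) (hg : PolyTimeIn B g) :
    PolyTimeIn B (fun c => f c - g c) :=
  (PolyTimeIn.foldl_of_growth (g := fun _ s _ => s.tail) hg.replicate_unit hf.replicate_unit
    PolyTime.right.fst.tail (.const 0) fun _ s _ _ => size_tail_le s).length.congr fun c => by
      generalize f c = m
      generalize g c = n
      induction n generalizing m with
      | zero => simp
      | succ n ih =>
        rw [List.replicate_succ, List.foldl_cons, List.tail_replicate, ← ih]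
        omega

theorem PolyTimeIn.decide_eq_zero {f : γ → ℕ} (hf : PolyTimeIn B f) :
    PolyTimeIn B (fun c => decide (f c = 0)) :=
  hf.replicate_unit.isEmpty.congr fun c => by cases f c <;> simp

theorem PolyTimeIn.decide_le {f g : γ → ℕ} (hf : PolyTimeIn B f) (hg : PolyTimeIn B g) :
    PolyTimeIn B (fun c => decide (f c ≤ g c)) :=
  (hf.sub hg).decide_eq_zero.congr fun c => by simp [Nat.sub_eq_zero_iff_le]

theorem PolyTimeIn.decide_lt {f g : γ → ℕ} (hf : PolyTimeIn B f) (hg : PolyTimeIn B g) :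
    PolyTimeIn B (fun c => decide (f c < g c)) :=
  (hg.decide_le hf).not.congr fun c => by
    rw [Bool.eq_iff_iff]; simp

theorem PolyTimeIn.min {f g : γ → ℕ} (hf : PolyTimeIn B f) (hg : PolyTimeIn B g) :
    PolyTimeIn B (fun c => min (f c) (g c)) :=
  (hf.sub (hf.sub hg)).congr fun c => by omega

theorem PolyTimeIn.sum {l : γ → List ℕ} (hl : PolyTimeIn B l) :
    PolyTimeIn B (fun c => (l c).sum) :=
  (hl.flatMap (g := fun _ n => List.replicate n ()) PolyTime.right.replicate_unit).length.congr
    fun c => by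
      induction l c with
      | nil => rfl
      | cons a l _ => simp

/-- Equality on `α` is decidable in polynomial time. -/
def PolyTimeEq (α : Type) [ToTree α] : Prop :=
  ∃ e : α × α → Bool, PolyTime e ∧ ∀ p, e p = true ↔ p.1 = p.2

theorem PolyTimeEq.decide_eq (h : PolyTimeEq α) {f g : γ → α} [∀ c, Decidable (f c = g c)]
    (hf : PolyTimeIn B f) (hg : PolyTimeIn B g) : PolyTimeIn B (fun c => decide (f c = g c)) := by
  obtain ⟨e, he, he_iff⟩ := h
  exact (PolyTimeIn.comp he (hf.pair hg)).congr fun c => by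
    rw [Bool.eq_iff_iff, he_iff]; simp

theorem PolyTimeEq.bool : PolyTimeEq Bool :=
  ⟨_, (PolyTime.left.xor PolyTime.right).not, fun p => by rcases p with ⟨_ | _, _ | _⟩ <;> simp⟩

theorem PolyTimeEq.prod (h : PolyTimeEq α) (h' : PolyTimeEq β) : PolyTimeEq (α × β) := by
  classical
  exact ⟨_, (h.decide_eq PolyTime.left.fst PolyTime.right.fst).and
    (h'.decide_eq PolyTime.left.snd PolyTime.right.snd), fun p => by simp [Prod.ext_iff]⟩

/-- One step of the comparison of two lists: the state records whether the lists agree so far, and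
what is left of the second list. -/
def compareStep {α : Type} [DecidableEq α] [Inhabited α] (s : Bool × List α) (a : α) :
    Bool × List α :=
  (s.1 && !s.2.isEmpty && decide (s.2.headD default = a), s.2.tail)

theorem foldl_compareStep_iff {α : Type} [DecidableEq α] [Inhabited α] (l l' : List α)
    (b : Bool) :
    (l.foldl compareStep (b, l')).1 = true ∧ (l.foldl compareStep (b, l')).2 = [] ↔
      b = true ∧ l = l' := by
  induction l generalizing l' b with
  | nil => simp [eq_comm]
  | cons a l ih =>
    rw [List.foldl_cons, compareStep, ih]
    cases l' <;> simp [and_assoc, eq_comm (a := a)]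

theorem PolyTimeEq.list [Inhabited α] (h : PolyTimeEq α) : PolyTimeEq (List α) := by
  classical
  have hfold : PolyTime fun p : List α × List α => p.1.foldl compareStep (true, p.2) := by
    refine PolyTimeIn.foldl_of_growth (g := fun _ => compareStep) PolyTime.left
      ((PolyTime.const _).pair PolyTime.right) ?_ (.const 3) ?_
    · exact ((PolyTime.right.fst.fst.and PolyTime.right.fst.snd.isEmpty.not).and
        (h.decide_eq (PolyTime.right.fst.snd.headD _) PolyTime.right.snd)).pair
        PolyTime.right.fst.snd.tail
    · rintro - ⟨b, s⟩ a -
      have := size_bool (b && !s.isEmpty && decide (s.headD default = a))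
      have := size_tail_le s
      simp only [compareStep, size_pair]
      omega
  exact ⟨_, hfold.fst.and hfold.snd.isEmpty, fun p => by
    simp [foldl_compareStep_iff]⟩

theorem PolyTimeIn.decide_mem (h : PolyTimeEq α) {f : γ → α} {l : γ → List α}
    [∀ c, Decidable (f c ∈ l c)] (hf : PolyTimeIn B f) (hl : PolyTimeIn B l) :
    PolyTimeIn B (fun c => decide (f c ∈ l c)) := by
  classical
  exact (PolyTimeIn.comp (g := fun p : α × List α => p.2.any fun b => decide (p.1 = b))
    (PolyTime.right.any (h.decide_eq PolyTime.left.fst PolyTime.right))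
    (hf.pair hl)).congr fun c => by
      rw [Bool.eq_iff_iff]; simp

theorem PolyTimeIn.dedup [DecidableEq α] (h : PolyTimeEq α) {l : γ → List α}
    (hl : PolyTimeIn B l) : PolyTimeIn B (fun c => (l c).dedup) := by
  refine (PolyTimeIn.foldr_of_growth (i := fun _ => ([] : List α))
    (g := fun _ a s => if a ∈ s then s else a :: s) hl (hl.const _)
    (.ite (.decide_mem h PolyTime.right.snd PolyTime.right.fst) PolyTime.right.fst
      (PolyTime.right.snd.cons PolyTime.right.fst)) (G := fun c => size (l c)) hl.output
    fun c s a ha => ?_).congr fun c => ?_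
  · have := size_lt_of_mem ha
    split_ifs
    · omega
    · simp; omega
  · induction l c with
    | nil => rfl
    | cons a l ih =>
      rw [List.foldr_cons, ← ih]
      by_cases h : a ∈ l <;> simp [h]

theorem PolyTimeIn.count [BEq α] [LawfulBEq α] (h : PolyTimeEq α) {f : γ → α} {l : γ → List α}
    (hf : PolyTimeIn B f) (hl : PolyTimeIn B l) : PolyTimeIn B (fun c => (l c).count (f c)) := by
  classical
  exact (PolyTimeIn.comp (g := fun p : α × List α => (p.2.filter fun b => decide (b = p.1)).length)
    (PolyTime.right.filter (h.decide_eq PolyTime.right PolyTime.left.fst)).length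
    (hf.pair hl)).congr fun c => by
      rw [List.count_eq_length_filter]
      congr 2
      funext b
      rw [Bool.eq_iff_iff]
      simp

end Functions

end StackProg

/-! ### Binary numbers -/

namespace StackProg

/-- The successor of a binary number, least significant bit first. -/
def inc : List Bool → List Bool
  | [] => [true]
  | false :: l => true :: l
  | true :: l => false :: inc l

/-- The value of a binary number, least significant bit first. Unlike `Computability.decodeNat`, it
is meaningful for words with leading zeros. -/
def bitsVal (l : List Bool) : ℕ := Nat.ofDigits 2 (l.map Bool.toNat)

theorem bitsVal_cons (b : Bool) (l : List Bool) : bitsVal (b :: l) = b.toNat + 2 * bitsVal l := by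
  simp [bitsVal, Nat.ofDigits_cons]

theorem bitsVal_inc (l : List Bool) : bitsVal (inc l) = bitsVal l + 1 := by
  induction l with
  | nil => rfl
  | cons b l ih => cases b <;> simp only [inc, bitsVal_cons, ih, Bool.toNat] <;> grind

theorem encodePosNum_succ (p : PosNum) : encodePosNum p.succ = inc (encodePosNum p) := by
  induction p with
  | one => rfl
  | bit1 p ih => simp [PosNum.succ, encodePosNum, inc, ih]
  | bit0 p => simp [PosNum.succ, encodePosNum, inc]

theorem encodeNat_succ (n : ℕ) : encodeNat (n + 1) = inc (encodeNat n) := by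
  have hcast : ((n + 1 : ℕ) : Num) = Num.succ (n : Num) := by rw [Nat.cast_succ, Num.add_one]
  rw [encodeNat, encodeNat, hcast]
  cases (n : Num) with
  | zero => rfl
  | pos p => exact encodePosNum_succ p

theorem bitsVal_encodeNat (n : ℕ) : bitsVal (encodeNat n) = n := by
  induction n with
  | zero => rfl
  | succ n ih => rw [encodeNat_succ, bitsVal_inc, ih]

theorem length_encodePosNum (p : PosNum) : (encodePosNum p).length = (p : ℕ).size := by
  rw [← PosNum.natSize_to_nat]
  induction p with
  | one => rfl
  | bit1 p ih | bit0 p ih => simp [encodePosNum, PosNum.natSize, ih]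

theorem length_encodeNat (n : ℕ) : (encodeNat n).length = n.size := by
  have hn : ((n : Num) : ℕ) = n := Num.to_of_nat n
  rw [encodeNat]
  conv_rhs => rw [← hn]
  cases (n : Num) with
  | zero => rfl
  | pos p => exact length_encodePosNum p

theorem encodeNat_injective : Function.Injective encodeNat :=
  Function.LeftInverse.injective decode_encodeNat

@[simp] theorem size_true : size true = 3 := rfl

@[simp] theorem size_false : size false = 1 := rfl

theorem size_inc_le (l : List Bool) : size (inc l) ≤ size l + 4 := by
  induction l with
  | nil => simp [inc]
  | cons b l ih => cases b <;> simp [inc] <;> omega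

/-- One step of the computation of `inc`: the state consists of the carry and the digits of the
result found so far, in reverse order. -/
def incStep (s : Bool × List Bool) (b : Bool) : Bool × List Bool :=
  (s.1 && b, Bool.xor s.1 b :: s.2)

theorem foldl_incStep (l : List Bool) (c : Bool) (o : List Bool) :
    (bif (l.foldl incStep (c, o)).1 then true :: (l.foldl incStep (c, o)).2
      else (l.foldl incStep (c, o)).2).reverse = o.reverse ++ bif c then inc l else l := by
  induction l generalizing c o with
  | nil => cases c <;> simp [inc]
  | cons b l ih =>
    rw [List.foldl_cons, incStep, ih]
    cases c <;> cases b <;> simp [inc]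

theorem PolyTime.inc : PolyTime inc := by
  have hfold : PolyTime fun l : List Bool => l.foldl incStep (true, []) := by
    refine PolyTimeIn.foldl_of_growth (l := fun l => l) (i := fun _ => (true, []))
      (g := fun _ => incStep) PolyTime.id (PolyTime.const _) ?_ (.const 6) ?_
    · exact (PolyTime.right.fst.fst.and PolyTime.right.snd).pair
        ((PolyTime.right.fst.fst.xor PolyTime.right.snd).cons PolyTime.right.fst.snd)
    · rintro - ⟨c, s⟩ b -
      cases c <;> cases b <;> simp [incStep] <;> omega
  exact ((hfold.fst.cond ((PolyTime.const true).cons hfold.snd) hfold.snd).reverse).congr fun l =>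
    (foldl_incStep l true []).symm

section

variable {γ : Type} [ToTree γ] {B : γ → ℕ}

theorem PolyTimeIn.encodeNat {f : γ → ℕ} (hf : PolyTimeIn B f) :
    PolyTimeIn B (fun c => encodeNat (f c)) := by
  refine PolyTimeIn.comp (g := Computability.encodeNat) ?_ hf
  refine (PolyTimeIn.foldl_of_growth (l := fun n : ℕ => List.replicate n ())
    (i := fun _ => ([] : List Bool)) (g := fun _ s _ => StackProg.inc s)
    PolyTime.id.replicate_unit (PolyTime.const _) (PolyTime.inc.comp PolyTime.right.fst) (.const 4)
    fun _ s _ _ => size_inc_le s).congr fun n => ?_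
  induction n with
  | zero => rfl
  | succ n ih => rw [List.replicate_succ', List.foldl_append, ← ih, encodeNat_succ]; rfl

theorem min_bitsVal_cons (b : Bool) (l : List Bool) (m : ℕ) :
    min (bitsVal (b :: l)) m = min (2 * min (bitsVal l) m + b.toNat) m := by
  rw [bitsVal_cons]
  omega

theorem PolyTimeIn.min_bitsVal {f : γ → ℕ} {l : γ → List Bool} (hf : PolyTimeIn B f)
    (hl : PolyTimeIn B l) : PolyTimeIn B (fun c => Nat.min (bitsVal (l c)) (f c)) := by
  refine PolyTimeIn.comp (g := fun p : List Bool × ℕ => Nat.min (bitsVal p.1) p.2) ?_ (hl.pair hf)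
  have htoNat : PolyTime Bool.toNat :=
    (PolyTime.id.cond (PolyTime.const 1) (PolyTime.const 0)).congr (by decide)
  refine (PolyTimeIn.foldl_of_bound (l := fun p : List Bool × ℕ => p.1.reverse) (i := fun _ => 0)
    (g := fun p n b => Min.min (2 * n + b.toNat) p.2) PolyTime.left.reverse (PolyTime.const _)
    ((((PolyTimeIn.const PolyTime.id 2).mul PolyTime.right.fst).add
      (htoNat.comp PolyTime.right.snd)).min PolyTime.left.snd)
    (M := fun p => size p.2) PolyTime.right.output fun p l₁ _ => ?_).congr ?_
  · rcases List.eq_nil_or_concat l₁ with rfl | ⟨l, b, rfl⟩ <;> simp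
  · rintro ⟨l, m⟩
    rw [List.foldl_reverse]
    induction l with
    | nil => simp [bitsVal]
    | cons b l ih =>
      rw [List.foldr_cons, ← ih]
      exact min_bitsVal_cons b l m

end

end StackProg

/-! ### Reading and writing words -/

namespace StackProg

open ToTree

/-- The symbols, in the order in which they are numbered by their codes. -/
def symbols : List Γ' := [.bit false, .bit true, .bra, .ket, .comma, .blank]

instance : ToTree Γ' := ⟨fun a => toTree (symbols.idxOf a)⟩

/-- Pops a number `n` from the value stack and writes the `n`-th symbol of a list. -/
def emitSymbol : List Γ' → Prog
  | [] => .skip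
  | a :: l => .pop (.bank .val) fun o =>
      if o = some true then .seq (.pop (.bank .val) fun _ => .skip) (emitSymbol l)
      else .push .out a

/-- Pops a list of symbols from the value stack and writes it in reverse order. -/
def emit : Prog := .loop (.bank .val) (fun o => o != some true) fun _ => emitSymbol symbols

/-- Pops a Boolean from the value stack and writes it. -/
def emitBool : Prog := .pop (.bank .val) fun o =>
  if o = some true then .seq (.pop (.bank .val) fun _ => .skip)
    (.seq (.pop (.bank .val) fun _ => .skip) (.push .ans true))
  else .push .ans false

/-- Reverses the input onto the output stack. -/
def flipInput : Prog := each .inp fun a => .push .out a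

section Writing

variable {e : Ports} {x y : List Bool}

theorem runs_push_out (e : Ports) (S : Bank → List Bool) (a : Γ') :
    Runs (.push .out a) (store e S) (store { e with out := a :: e.out } S) 1 :=
  update_store_out (a :: e.out) ▸ Runs.push

theorem runs_push_ans (e : Ports) (S : Bank → List Bool) (b : Bool) :
    Runs (.push .ans b) (store e S) (store { e with ans := b :: e.ans } S) 1 :=
  update_store_ans (b :: e.ans) ▸ Runs.push

theorem runs_emitSymbol {a : Γ'} {l : List Γ'} {n : ℕ} (h : l[n]? = some a) :
    Runs (emitSymbol l) (conf e (bits n ++ x) y) (conf { e with out := a :: e.out } x y)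
      (3 * n + 2) := by
  induction l generalizing n with
  | nil => simp at h
  | cons a' l ih =>
    cases n with
    | zero =>
      obtain rfl : a' = a := by simpa using h
      exact (runs_pop_val (b := false) (runs_push_out e _ a')).mono (by omega)
    | succ n =>
      have hrest := ih (n := n) (by simpa using h)
      rw [bits_succ]
      exact (runs_pop_val (b := true) ((runs_pop_val .skip).seq hrest)).mono (by omega)

theorem runs_emitSymbol_symbols (a : Γ') :
    Runs (emitSymbol symbols) (conf e (bits a ++ x) y) (conf { e with out := a :: e.out } x y)
      17 := by
  have hmem : a ∈ symbols := by rcases a with _ | (_ | _) | _ | _ | _ <;> decide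
  have hlt : symbols.idxOf a < 6 := List.idxOf_lt_length_of_mem hmem
  exact (runs_emitSymbol (List.getElem?_idxOf hmem)).mono (by omega)

theorem runs_emit (l : List Γ') :
    Runs emit (conf e (bits l ++ x) y) (conf { e with out := l.reverse ++ e.out } x y)
      (18 * l.length + 1) := by
  induction l generalizing e with
  | nil =>
    refine (Runs.loop_exit_bank (a := false) (l := x) rfl rfl).cast ?_ (by simp)
    rw [banks_update_val]
    rfl
  | cons a l ih =>
    refine (Runs.loop_step_bank (a := true) (l := bits a ++ (bits l ++ x))
      (by simp [banks, bits_cons]) rfl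
      ((runs_emitSymbol_symbols (e := e) a).congr_left ?_) ih).cast ?_
      (by rw [List.length_cons]; omega)
    · rw [banks_update_val]
    · simp

theorem runs_emitBool (b : Bool) :
    Runs emitBool (conf e (bits b ++ x) y) (conf { e with ans := b :: e.ans } x y) 6 := by
  cases b
  · exact (runs_pop_val (b := false) (runs_push_ans e _ false)).mono (by omega)
  · have hwrite : Runs (.seq (.pop (.bank .val) fun _ => .skip)
        (.seq (.pop (.bank .val) fun _ => .skip) (.push .ans true)))
        (conf e (false :: false :: x) y) (conf { e with ans := true :: e.ans } x y)
        ((1 + 1) + ((1 + 1) + 1)) :=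
      (runs_pop_val .skip).seq ((runs_pop_val .skip).seq (runs_push_ans e _ true))
    exact (runs_pop_val (b := true) hwrite).mono (by omega)

theorem runs_flipInput (S : Bank → List Bool) (w v : List Γ') :
    Runs flipInput (store ⟨w, v, []⟩ S) (store ⟨[], w.reverse ++ v, []⟩ S)
      (2 * w.length + 1) := by
  induction w generalizing v with
  | nil => exact .each_nil rfl
  | cons a w ih =>
    have hpush : Runs (.push .out a) (store ⟨w, v, []⟩ S) (store ⟨w, a :: v, []⟩ S) 1 :=
      runs_push_out ⟨w, v, []⟩ S a
    rw [← update_store_inp (e := ⟨a :: w, v, []⟩)] at hpush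
    refine (Runs.each_cons (l := w) rfl hpush (ih (a :: v))).cast (by simp) ?_
    rw [List.length_cons]
    omega

end Writing

theorem conf_empty : conf ⟨[], [], []⟩ [] [] = fun _ => [] := by
  funext k
  rcases k with _ | _ | _ | i
  · rfl
  · rfl
  · rfl
  · cases i <;> rfl

theorem conf_inp (w : List Γ') : conf ⟨w, [], []⟩ [] [] = single .inp w := by
  rw [single, ← conf_empty, update_store_inp]

theorem conf_out (w : List Γ') : conf ⟨[], w, []⟩ [] [] = single .out w := by
  rw [single, ← conf_empty, update_store_out]

theorem conf_ans (w : List Bool) : conf ⟨[], [], w⟩ [] [] = single .ans w := by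
  rw [single, ← conf_empty, update_store_ans]

section Reading

variable {σ : Type} [ToTree σ] {g : Γ' → σ → σ} {C : ℕ}

theorem polyBounded_size_foldr (hC : ∀ a s, size (g a s) ≤ size s + C) (s₀ : σ) :
    PolyBounded List.length fun w => size (w.foldr g s₀) := by
  refine ((PolyBounded.const (size s₀)).add (PolyBounded.self.mul (.const C))).mono fun w => ?_
  rw [← List.foldl_reverse, ← List.length_reverse (as := w)]
  exact size_foldl_le s₀ fun s a _ => hC a s

theorem runs_each_out {p : Γ' → Prog} {c : ℕ}
    (hp : ∀ a, Computes (p a) (g a) fun s => (size s + 2) ^ c)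
    (hC : ∀ a s, size (g a s) ≤ size s + C) (w : List Γ') (s : σ) :
    Runs (each .out p) (conf ⟨[], w, []⟩ (bits s) [])
      (conf ⟨[], [], []⟩ (bits (w.foldl (fun s a => g a s) s)) [])
      (w.length * (1 + (size s + w.length * C + 2) ^ c) + 1) := by
  induction w generalizing s with
  | nil => exact Runs.each_nil rfl |>.mono (by simp)
  | cons a w ih =>
    have hstep : Runs (p a) (conf ⟨[], w, []⟩ (bits s) []) (conf ⟨[], w, []⟩ (bits (g a s)) [])
        ((size s + 2) ^ c) := by
      simpa only [List.append_nil] using hp a s ⟨[], w, []⟩ [] []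
    have hpop : Function.update (conf ⟨[], a :: w, []⟩ (bits s) []) .out w =
        conf ⟨[], w, []⟩ (bits s) [] := update_store_out w
    rw [← hpop] at hstep
    refine (Runs.each_cons (l := w) rfl hstep (ih (g a s))).mono ?_
    have hsize := hC a s
    have hhead : (size s + 2) ^ c ≤ (size s + (w.length + 1) * C + 2) ^ c :=
      Nat.pow_le_pow_left (by omega) c
    have htail : (size (g a s) + w.length * C + 2) ^ c ≤
        (size s + (w.length + 1) * C + 2) ^ c :=
      Nat.pow_le_pow_left (by rw [Nat.add_mul]; omega) c
    have hmul := Nat.mul_le_mul_left w.length (Nat.add_le_add_left htail 1)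
    rw [List.length_cons, Nat.add_mul w.length 1, Nat.one_mul]
    omega

theorem exists_uniform_computes (hg : ∀ a, PolyTime (g a)) :
    ∃ (p : Γ' → Prog) (c : ℕ), ∀ a, Computes (p a) (g a) fun s => (size s + 2) ^ c := by
  choose p T hp hT using fun a => (hg a).computes
  choose c hc using hT
  exact ⟨p, ∑ a, c a, fun a s e x y => (hp a s e x y).mono ((hc a s).trans
    (Nat.pow_le_pow_right (by omega) (Finset.single_le_sum (fun _ _ => Nat.zero_le _)
      (Finset.mem_univ a))))⟩

theorem exists_runs_foldr (hg : ∀ a, PolyTime (g a)) (hC : ∀ a s, size (g a s) ≤ size s + C)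
    (s₀ : σ) :
    ∃ p c, ∀ w, Runs p (single .inp w) (conf ⟨[], [], []⟩ (bits (w.foldr g s₀)) [])
      ((w.length + 2) ^ c) := by
  obtain ⟨p, d, hp⟩ := exists_uniform_computes hg
  have htime : PolyBounded List.length fun w : List Γ' => (2 * w.length + 1) + ((size s₀ + 1) +
      (w.length * (1 + (size s₀ + w.length * C + 2) ^ d) + 1)) :=
    (((PolyBounded.const 2).mul .self).add (.const 1)).add ((PolyBounded.const _).add
      ((PolyBounded.self.mul ((PolyBounded.const 1).add ((((PolyBounded.const _).add
        (PolyBounded.self.mul (.const C))).add (.const 2)).pow d))).add (.const 1)))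
  obtain ⟨c, hc⟩ := htime
  refine ⟨.seq flipInput (.seq (pushAll (bits s₀)) (each .out p)), c, fun w => ?_⟩
  have hpush : Runs (pushAll (bits s₀)) (conf ⟨[], w.reverse, []⟩ [] [])
      (conf ⟨[], w.reverse, []⟩ (bits s₀) []) (size s₀ + 1) := by
    simpa only [List.append_nil, size] using runs_pushAll (x := []) (bits s₀)
  have hflip := runs_flipInput (banks [] []) w []
  rw [List.append_nil] at hflip
  refine ((hflip.seq (hpush.seq (runs_each_out hp hC w.reverse s₀))).congr_left
    (conf_inp w).symm).cast (by simp) ?_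
  rw [List.length_reverse]
  exact hc w

theorem outputs_cast {tm : FinTM2} {l l' : List (tm.Γ tm.k₀)} {o o' : List (tm.Γ tm.k₁)}
    {T T' : ℕ} (h : Nonempty (TM2OutputsInTime tm l (some o) T)) (hl : l' = l) (ho : o' = o)
    (hT : T ≤ T') : Nonempty (TM2OutputsInTime tm l' (some o') T') := by
  subst hl ho
  exact h.map fun h => ⟨h.toEvalsTo, h.steps_le_m.trans hT⟩

/-- A word is read from right to left, so the program that reads it computes a right fold. -/
theorem exists_machine_word (hg : ∀ a, PolyTime (g a)) (hC : ∀ a s, size (g a s) ≤ size s + C)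
    (s₀ : σ) {f : σ → List Γ'} (hf : PolyTime f) :
    ∃ (M : TM2ComputableAux Γ' Γ') (c : ℕ), ∀ w : List Γ',
      Nonempty (TM2OutputsInTime M.tm (w.map M.inputAlphabet.invFun)
        (some ((f (w.foldr g s₀)).map M.outputAlphabet.invFun)) ((w.length + 2) ^ c)) := by
  obtain ⟨p, c, hp⟩ := exists_runs_foldr hg hC s₀
  obtain ⟨⟨q, T, hq, hT⟩, -, hout⟩ := hf.reverse
  have hstate := polyBounded_size_foldr hC s₀
  have htime : PolyBounded List.length fun w : List Γ' => (w.length + 2) ^ c +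
      (T (w.foldr g s₀) + (18 * size (f (w.foldr g s₀)).reverse + 1)) + 1 :=
    (((PolyBounded.self.add (.const 2)).pow c).add ((hT.comp hstate).add
      (((PolyBounded.const 18).mul (hout.comp hstate)).add (.const 1)))).add (.const 1)
  obtain ⟨d, hd⟩ := htime
  refine ⟨⟨machine Stack.inp Stack.out (.seq p (.seq q emit)), .refl Γ', .refl Γ'⟩, d, fun w => ?_⟩
  have hfun := hq (w.foldr g s₀) ⟨[], [], []⟩ [] []
  rw [List.append_nil] at hfun
  have hrun := (hp w).seq (hfun.seq (runs_emit (f (w.foldr g s₀)).reverse))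
  rw [List.append_nil, List.reverse_reverse, conf_out] at hrun
  refine outputs_cast hrun.outputs (List.map_id w) (List.map_id _) ((hd w).trans' ?_)
  beta_reduce
  gcongr
  exact (length_lt_size _).le

theorem exists_machine_bool (hg : ∀ a, PolyTime (g a)) (hC : ∀ a s, size (g a s) ≤ size s + C)
    (s₀ : σ) {B : σ → ℕ} {f : σ → Bool} (hf : PolyTimeIn B f) :
    ∃ (M : TM2ComputableAux Γ' Bool) (c : ℕ), ∀ w : List Γ',
      Nonempty (TM2OutputsInTime M.tm (w.map M.inputAlphabet.invFun)
        (some ((encodeBool (f (w.foldr g s₀))).map M.outputAlphabet.invFun))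
          ((w.length + B (w.foldr g s₀) + 2) ^ c)) := by
  obtain ⟨p, c, hp⟩ := exists_runs_foldr hg hC s₀
  obtain ⟨⟨q, T, hq, hT⟩, -, -⟩ := hf
  have hlength : PolyBounded (fun w : List Γ' => w.length + B (w.foldr g s₀)) List.length :=
    PolyBounded.self.mono fun w => Nat.le_add_right ..
  have hB : PolyBounded (fun w : List Γ' => w.length + B (w.foldr g s₀))
      fun w => B (w.foldr g s₀) :=
    PolyBounded.self.mono fun w => Nat.le_add_left ..
  obtain ⟨d, hd⟩ := (((hlength.add (.const 2)).pow c).add ((hT.comp hB).add (.const 6))).add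
    (.const 1)
  refine ⟨⟨machine Stack.inp Stack.ans (.seq p (.seq q emitBool)), .refl Γ', .refl Bool⟩, d,
    fun w => ?_⟩
  have hfun := hq (w.foldr g s₀) ⟨[], [], []⟩ [] []
  rw [List.append_nil] at hfun
  have hrun := (hp w).seq (hfun.seq (runs_emitBool (f (w.foldr g s₀))))
  rw [conf_ans] at hrun
  exact outputs_cast hrun.outputs (List.map_id w) (List.map_id _) (hd w)

end Reading

end StackProg

/-! ### The maximum excess of a system of linear equations -/

namespace LinExcess

/-- The sign `(-1) ^ a`: an equation `u ⬝ᵥ z = c` of weight `w` contributes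
`w * sgn (u ⬝ᵥ z + c)` to the excess of `z`. -/
def sgn (a : ZMod 2) : ℤ := if a = 0 then 1 else -1

@[simp] theorem sgn_zero : sgn 0 = 1 := rfl

theorem sgn_add (a b : ZMod 2) : sgn (a + b) = sgn a * sgn b := by decide +revert

theorem sgn_add_one (a : ZMod 2) : sgn (a + 1) = -sgn a := by decide +revert

theorem neg_one_le_sgn (a : ZMod 2) : -1 ≤ sgn a := by decide +revert

theorem sgn_sum {ι : Type*} (s : Finset ι) (f : ι → ZMod 2) :
    sgn (∑ i ∈ s, f i) = ∏ i ∈ s, sgn (f i) := by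
  classical
  induction s using Finset.induction_on with
  | empty => rfl
  | insert a s ha ih => rw [Finset.sum_insert ha, Finset.prod_insert ha, sgn_add, ih]

section SubsetSums

variable {A : Type*} [AddCommMonoid A]

theorem exists_finset_sum_mem (M : Finset A) (j : ℕ) :
    ∃ S : Finset A, S.card ≤ (M.card + 1) ^ j ∧ ∀ T ⊆ M, T.card ≤ j → ∑ b ∈ T, b ∈ S := by
  classical
  induction j with
  | zero => exact ⟨{0}, by simp, fun T _ hT => by simp [Finset.card_eq_zero.1 (Nat.le_zero.1 hT)]⟩
  | succ j ih =>
    obtain ⟨S, hcard, hS⟩ := ih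
    refine ⟨Finset.image₂ (· + ·) S (insert 0 M), ?_, fun T hTM hT => ?_⟩
    · rw [pow_succ]
      exact (Finset.card_image₂_le _ _ _).trans
        (Nat.mul_le_mul hcard (Finset.card_insert_le _ _))
    · rcases T.eq_empty_or_nonempty with rfl | ⟨a, ha⟩
      · have hzero := hS ∅ (Finset.empty_subset M) (Nat.zero_le j)
        exact Finset.mem_image₂.2 ⟨_, hzero, 0, Finset.mem_insert_self 0 M, add_zero _⟩
      · have herase := hS (T.erase a) ((Finset.erase_subset a T).trans hTM)
          (by rw [Finset.card_erase_of_mem ha]; omega)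
        exact Finset.mem_image₂.2 ⟨_, herase, a, Finset.mem_insert_of_mem (hTM ha),
          Finset.sum_erase_add _ _ ha⟩

/-- The set `K ⊆ M` is linearly independent and `M`-sum-free: among its subsets, only the empty
one sums to zero, and only singletons sum to an element of `M`. -/
structure IsSumFree (M K : Finset A) : Prop where
  subset : K ⊆ M
  eq_empty : ∀ T ⊆ K, ∑ b ∈ T, b = 0 → T = ∅
  exists_eq_singleton : ∀ T ⊆ K, ∑ b ∈ T, b ∈ M → ∃ b, T = {b}

theorem isSumFree_singleton {M : Finset A} (hM : 0 ∉ M) {b : A} (hb : b ∈ M) :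
    IsSumFree M {b} where
  subset := Finset.singleton_subset_iff.2 hb
  eq_empty T hT hsum := by
    rcases Finset.subset_singleton_iff.1 hT with rfl | rfl
    · rfl
    · rw [Finset.sum_singleton] at hsum
      exact absurd (hsum ▸ hb) hM
  exists_eq_singleton T hT hsum := by
    rcases Finset.subset_singleton_iff.1 hT with rfl | rfl
    · exact absurd hsum hM
    · exact ⟨b, rfl⟩

variable {W : Type*} [AddCommGroup W] [Module (ZMod 2) W]

theorem exists_sum_eq_of_mem_span {M : Finset W} {x : W}
    (hx : x ∈ Submodule.span (ZMod 2) (M : Set W)) : ∃ T ⊆ M, ∑ b ∈ T, b = x := by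
  obtain ⟨f, -, hf⟩ := Submodule.mem_span_finset.1 hx
  refine ⟨M.filter fun a => f a ≠ 0, Finset.filter_subset _ _, ?_⟩
  rw [Finset.sum_filter, ← hf]
  refine Finset.sum_congr rfl fun a _ => ?_
  rcases (by decide : ∀ c : ZMod 2, c = 0 ∨ c = 1) (f a) with h | h <;> simp [h]

/-- A sub-sum of `T` that vanishes or lies in `M` could be exchanged for fewer elements of `M`. -/
theorem isSumFree_of_minimal {M T : Finset W} (hM : 0 ∉ M) (hTM : T ⊆ M)
    (hmin : ∀ U ⊆ M, ∑ b ∈ U, b = ∑ b ∈ T, b → T.card ≤ U.card) : IsSumFree M T where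
  subset := hTM
  eq_empty U hU hsum := by
    classical
    have hdiff := Finset.sum_sdiff (f := fun b : W => b) hU
    rw [hsum, add_zero] at hdiff
    have hle := hmin (T \ U) (Finset.sdiff_subset.trans hTM) hdiff
    rw [Finset.card_sdiff_of_subset hU] at hle
    have hUT := Finset.card_le_card hU
    exact Finset.card_eq_zero.1 (by omega)
  exists_eq_singleton U hU hsum := by
    classical
    have hdiff := Finset.sum_sdiff (f := fun b : W => b) hU
    have hUT := Finset.card_le_card hU
    have hpos : 0 < U.card := by
      refine Finset.card_pos.2 (Finset.nonempty_iff_ne_empty.2 ?_)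
      rintro rfl
      exact hM hsum
    set u := ∑ b ∈ U, b
    by_cases hu : u ∈ T \ U
    · have hle := hmin ((T \ U).erase u)
        ((Finset.erase_subset _ _).trans (Finset.sdiff_subset.trans hTM)) (by
          rw [← hdiff, ← Finset.sum_erase_add _ (fun b : W => b) hu, add_assoc,
            ZModModule.add_self, add_zero])
      rw [Finset.card_erase_of_mem hu, Finset.card_sdiff_of_subset hU] at hle
      omega
    · have hle := hmin (insert u (T \ U))
        (Finset.insert_subset hsum (Finset.sdiff_subset.trans hTM)) (by
          rw [Finset.sum_insert hu, add_comm, hdiff])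
      rw [Finset.card_insert_of_notMem hu, Finset.card_sdiff_of_subset hU] at hle
      exact Finset.card_eq_one.1 (by omega)

theorem exists_isSumFree_of_rank {M : Finset W} (hM : 0 ∉ M) {k : ℕ}
    (hk : (M.card + 1) ^ (k - 1) <
      2 ^ Module.finrank (ZMod 2) (Submodule.span (ZMod 2) (M : Set W))) :
    ∃ K, IsSumFree M K ∧ k ≤ K.card := by
  classical
  obtain ⟨S, hcard, hS⟩ := exists_finset_sum_mem M (k - 1)
  obtain ⟨x, hx, hxS⟩ : ∃ x ∈ Submodule.span (ZMod 2) (M : Set W), x ∉ S := by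
    by_contra! hsub
    have hle : Nat.card (Submodule.span (ZMod 2) (M : Set W)) ≤ S.card :=
      Set.ncard_coe_finset S ▸ Set.ncard_le_ncard hsub S.finite_toSet
    rw [Module.natCard_eq_pow_finrank (K := ZMod 2), Nat.card_zmod] at hle
    omega
  obtain ⟨T, hTM, hTx⟩ := exists_sum_eq_of_mem_span hx
  obtain ⟨K, hK, hmin⟩ := Finset.exists_min_image (M.powerset.filter fun T => ∑ b ∈ T, b = x)
    Finset.card ⟨T, Finset.mem_filter.2 ⟨Finset.mem_powerset.2 hTM, hTx⟩⟩
  simp only [Finset.mem_filter, Finset.mem_powerset] at hK hmin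
  refine ⟨K, isSumFree_of_minimal hM hK.1 fun U hU hsum => hmin U ⟨hU, hsum.trans hK.2⟩, ?_⟩
  by_contra! hlt
  exact hxS (hK.2 ▸ hS K hK.1 (by omega))

end SubsetSums

section Excess

variable {V : Type*} [Fintype V]

theorem card_le_mul_finrank_span {F : Type*} [Field F] [DecidableEq F] {M : Finset (V → F)} {r : ℕ}
    (hr : ∀ u ∈ M, (Finset.univ.filter fun i => u i ≠ 0).card ≤ r)
    (hV : ∀ i, ∃ u ∈ M, u i ≠ 0) :
    Fintype.card V ≤ r * Module.finrank F (Submodule.span F (M : Set (V → F))) := by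
  classical
  obtain ⟨b, hbM, hspan, hli⟩ := exists_linearIndependent F (M : Set (V → F))
  lift b to Finset (V → F) using M.finite_toSet.subset hbM
  have hcover : (Finset.univ : Finset V) ⊆
      b.biUnion fun u => Finset.univ.filter fun i => u i ≠ 0 := by
    intro i _
    by_contra hi
    simp only [Finset.mem_biUnion, Finset.mem_filter, Finset.mem_univ, true_and, not_exists,
      not_and, not_not] at hi
    obtain ⟨u, hu, hui⟩ := hV i
    have hle : Submodule.span F (b : Set (V → F)) ≤
        LinearMap.ker (LinearMap.proj (R := F) (φ := fun _ : V => F) i) :=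
      Submodule.span_le.2 fun a ha => hi a ha
    exact hui (hle (hspan ▸ Submodule.subset_span hu))
  calc Fintype.card V
    _ ≤ _ := Finset.card_le_card hcover
    _ ≤ ∑ u ∈ b, (Finset.univ.filter fun i => u i ≠ 0).card := Finset.card_biUnion_le
    _ ≤ ∑ _u ∈ b, r := Finset.sum_le_sum fun u hu => hr u (hbM hu)
    _ = r * b.card := by rw [Finset.sum_const, smul_eq_mul, mul_comm]
    _ = _ := by rw [← hspan, finrank_span_finset_eq_card hli]

variable {M K : Finset (V → ZMod 2)} (ε : (V → ZMod 2) → ZMod 2)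

/-- The density, up to a constant factor, of the uniform distribution on the common solutions of
the equations `b ⬝ᵥ z = ε b` with `b ∈ K`. -/
def solutionDensity (K : Finset (V → ZMod 2)) (ε : (V → ZMod 2) → ZMod 2) (z : V → ZMod 2) : ℤ :=
  ∏ b ∈ K, (1 + sgn (b ⬝ᵥ z + ε b))

theorem solutionDensity_nonneg (z : V → ZMod 2) : 0 ≤ solutionDensity K ε z :=
  Finset.prod_nonneg fun b _ => by
    have := neg_one_le_sgn (b ⬝ᵥ z + ε b)
    omega

theorem solutionDensity_eq_sum (z : V → ZMod 2) :
    solutionDensity K ε z = ∑ T ∈ K.powerset, sgn ((∑ b ∈ T, b) ⬝ᵥ z + ∑ b ∈ T, ε b) := by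
  rw [solutionDensity, Finset.prod_one_add]
  refine Finset.sum_congr rfl fun T _ => ?_
  rw [← sgn_sum, sum_dotProduct, Finset.sum_add_distrib]

section Averages

variable [DecidableEq V]

theorem sum_sgn_dotProduct_add (u : V → ZMod 2) (c : ZMod 2) :
    ∑ z : V → ZMod 2, sgn (u ⬝ᵥ z + c) =
      if u = 0 then Fintype.card (V → ZMod 2) * sgn c else 0 := by
  split_ifs with hu
  · subst hu
    simp
  · obtain ⟨i, hi⟩ := Function.ne_iff.1 hu
    have hui : u i = 1 := (by decide : ∀ a : ZMod 2, a ≠ 0 → a = 1) _ hi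
    have hneg : ∑ z : V → ZMod 2, sgn (u ⬝ᵥ z + c) = ∑ z : V → ZMod 2, -sgn (u ⬝ᵥ z + c) := by
      refine Fintype.sum_equiv (Equiv.addRight (Pi.single i (1 : ZMod 2))) _ _ fun z => ?_
      rw [Equiv.coe_addRight, dotProduct_add, dotProduct_single, hui, mul_one,
        add_right_comm, sgn_add_one, neg_neg]
    rw [Finset.sum_neg_distrib] at hneg
    linarith

theorem sum_solutionDensity (hK : ∀ T ⊆ K, ∑ b ∈ T, b = 0 → T = ∅) :
    ∑ z, solutionDensity K ε z = Fintype.card (V → ZMod 2) := by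
  simp only [solutionDensity_eq_sum]
  rw [Finset.sum_comm, Finset.sum_eq_single ∅]
  · simp
  · intro T hT hne
    rw [sum_sgn_dotProduct_add, if_neg fun h => hne (hK T (Finset.mem_powerset.1 hT) h)]
  · exact fun h => absurd (Finset.empty_mem_powerset K) h

theorem sum_solutionDensity_mul_sgn (hK : IsSumFree M K) {u : V → ZMod 2} (hu : u ∈ M) :
    ∑ z, solutionDensity K ε z * sgn (u ⬝ᵥ z + ε u) =
      if u ∈ K then (Fintype.card (V → ZMod 2) : ℤ) else 0 := by
  have hterm : ∀ T, ∑ z : V → ZMod 2,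
      sgn ((∑ b ∈ T, b) ⬝ᵥ z + ∑ b ∈ T, ε b) * sgn (u ⬝ᵥ z + ε u) =
        if ∑ b ∈ T, b = u then Fintype.card (V → ZMod 2) * sgn (∑ b ∈ T, ε b + ε u) else 0 := by
    intro T
    have hsum : ∑ b ∈ T, b + u = 0 ↔ ∑ b ∈ T, b = u := by
      rw [add_eq_zero_iff_eq_neg, ZModModule.neg_eq_self]
    simp only [← sgn_add, add_add_add_comm, ← add_dotProduct, sum_sgn_dotProduct_add, hsum]
  have hsingleton : ∀ T ∈ K.powerset, ∑ b ∈ T, b = u → T = {u} := by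
    rintro T hT rfl
    obtain ⟨b, rfl⟩ := hK.exists_eq_singleton T (Finset.mem_powerset.1 hT) hu
    rw [Finset.sum_singleton]
  simp only [solutionDensity_eq_sum, Finset.sum_mul]
  rw [Finset.sum_comm, Finset.sum_congr rfl fun T _ => hterm T]
  split_ifs with huK
  · rw [Finset.sum_eq_single {u} (fun T hT hne => if_neg fun h => hne (hsingleton T hT h))
      fun h => absurd (Finset.mem_powerset.2 (Finset.singleton_subset_iff.2 huK)) h]
    simp [ZModModule.add_self]
  · refine Finset.sum_eq_zero fun T hT => if_neg fun h => huK ?_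
    rw [hsingleton T hT h] at hT
    exact Finset.singleton_subset_iff.1 (Finset.mem_powerset.1 hT)

end Averages

/-- The excess averages to `∑ b ∈ K, w b` over the solutions of the equations in `K`. -/
theorem exists_sum_le_excess (hK : IsSumFree M K) (w : (V → ZMod 2) → ℤ) :
    ∃ z : V → ZMod 2, ∑ b ∈ K, w b ≤ ∑ u ∈ M, w u * sgn (u ⬝ᵥ z + ε u) := by
  classical
  have hpos : (0 : ℤ) < Fintype.card (V → ZMod 2) := by exact_mod_cast Fintype.card_pos
  have hmean : ∑ z, solutionDensity K ε z * ∑ u ∈ M, w u * sgn (u ⬝ᵥ z + ε u) =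
      Fintype.card (V → ZMod 2) * ∑ b ∈ K, w b := by
    simp only [Finset.mul_sum, mul_left_comm _ (w _)]
    rw [Finset.sum_comm]
    simp only [← Finset.mul_sum]
    rw [Finset.sum_congr rfl fun u hu => by rw [sum_solutionDensity_mul_sgn ε hK hu]]
    simp only [mul_ite, mul_zero]
    rw [← Finset.sum_filter, Finset.filter_mem_eq_inter, Finset.inter_eq_right.2 hK.subset,
      ← Finset.sum_mul, mul_comm]
  by_contra! hlt
  have hle : ∑ z, solutionDensity K ε z * ∑ u ∈ M, w u * sgn (u ⬝ᵥ z + ε u) ≤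
      ∑ z, solutionDensity K ε z * (∑ b ∈ K, w b - 1) :=
    Finset.sum_le_sum fun z _ =>
      mul_le_mul_of_nonneg_left (Int.le_sub_one_of_lt (hlt z)) (solutionDensity_nonneg ε z)
  rw [hmean, ← Finset.sum_mul, sum_solutionDensity ε hK.eq_empty] at hle
  nlinarith

theorem exists_weight_le_excess (hM : 0 ∉ M) (w : (V → ZMod 2) → ℤ) {b : V → ZMod 2}
    (hb : b ∈ M) : ∃ z : V → ZMod 2, w b ≤ ∑ u ∈ M, w u * sgn (u ⬝ᵥ z + ε u) := by
  simpa only [Finset.sum_singleton] using exists_sum_le_excess ε (isSumFree_singleton hM hb) w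

theorem exists_le_excess_of_rank (hM : 0 ∉ M) {w : (V → ZMod 2) → ℤ} (hw : ∀ u ∈ M, 1 ≤ w u)
    {k : ℕ} (hk : (M.card + 1) ^ (k - 1) <
      2 ^ Module.finrank (ZMod 2) (Submodule.span (ZMod 2) (M : Set (V → ZMod 2)))) :
    ∃ z : V → ZMod 2, (k : ℤ) ≤ ∑ u ∈ M, w u * sgn (u ⬝ᵥ z + ε u) := by
  obtain ⟨K, hK, hcard⟩ := exists_isSumFree_of_rank hM hk
  obtain ⟨z, hz⟩ := exists_sum_le_excess ε hK w
  refine ⟨z, le_trans ?_ hz⟩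
  calc (k : ℤ) ≤ K.card := by exact_mod_cast hcard
    _ = ∑ _b ∈ K, (1 : ℤ) := by simp
    _ ≤ _ := Finset.sum_le_sum fun b hb => hw b (hK.subset hb)

theorem exists_le_excess_of_card (hM : 0 ∉ M) {w : (V → ZMod 2) → ℤ} (hw : ∀ u ∈ M, 1 ≤ w u)
    {r k L : ℕ} (hr : ∀ u ∈ M, (Finset.univ.filter fun i => u i ≠ 0).card ≤ r)
    (hV : ∀ i, ∃ u ∈ M, u i ≠ 0) (hL : M.card < 2 ^ L) (hk : r * k * L < Fintype.card V) :
    ∃ z : V → ZMod 2, (k : ℤ) ≤ ∑ u ∈ M, w u * sgn (u ⬝ᵥ z + ε u) := by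
  refine exists_le_excess_of_rank ε hM hw ?_
  have hcard := card_le_mul_finrank_span hr hV
  set ρ := Module.finrank (ZMod 2) (Submodule.span (ZMod 2) (M : Set (V → ZMod 2)))
  have hrank : L * k < ρ := by
    rw [mul_assoc, mul_comm k] at hk
    exact lt_of_mul_lt_mul_left (hk.trans_le hcard) (Nat.zero_le r)
  calc (M.card + 1) ^ (k - 1) ≤ (2 ^ L) ^ (k - 1) := Nat.pow_le_pow_left hL _
    _ = 2 ^ (L * (k - 1)) := (pow_mul _ _ _).symm
    _ < 2 ^ ρ := Nat.pow_lt_pow_right one_lt_two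
      ((Nat.mul_le_mul_left L (Nat.sub_le k 1)).trans_lt hrank)

end Excess

end LinExcess

/-! ### The algorithm -/

namespace MaxExactSat

open StackProg

/-- The name of a variable: its number in binary. A literal is written as its sign followed by the
name of its variable. -/
abbrev Word := List Bool

/-- A linear equation between variables named by words: the variables, the right-hand side and the
weight. -/
abbrev NamedEquation := List Word × Bool × ℕ

/-- An instance of Max `r`-Lin AA with named variables: the equations, the variables and the
parameter. -/
abbrev NamedSystem := List NamedEquation × List Word × ℕ

/-- Reads one symbol of an instance, from right to left. The state consists of the words of the
bracket that is being read and of the list of the brackets that are complete: words are closed by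
commas, clauses stand in brackets, and the words in front of all brackets are the parameter and the
number of variables. -/
def readStep : Γ' → List Word × List (List Word) → List Word × List (List Word)
  | .bit b, s => ((b :: s.1.headD []) :: s.1.tail, s.2)
  | .comma, s => ([] :: s.1, s.2)
  | .ket, s => ([], s.2)
  | .bra, s => ([], s.1 :: s.2)
  | .blank, s => s

/-- The sublists of `l.take r`: a polynomial number of lists for every fixed `r`. -/
def sublistsTake {α : Type} : ℕ → List α → List (List α)
  | 0, _ => [[]]
  | _ + 1, [] => [[]]
  | r + 1, a :: l => sublistsTake r l ++ (sublistsTake r l).map fun U => a :: U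

/-- The ways to give a sign to every element of `l.take r`. -/
def signings {α : Type} : ℕ → List α → List (List (α × Bool))
  | 0, _ => [[]]
  | _ + 1, [] => [[]]
  | r + 1, a :: l => (signings r l).map (fun c => (a, false) :: c) ++
      (signings r l).map fun c => (a, true) :: c

/-- The right-hand side of the equation that belongs to a nonempty set of literals of a clause. -/
def termRhs (U : List Word) : Bool := U.foldr (fun l b => Bool.xor b (!l.headD false)) true

/-- The names of the variables that occur in a list of clauses. -/
def allVars (cs : List (List Word)) : List Word := (cs.flatMap fun C => C.map List.tail).dedup

/-- The elements of `S` in the order of `D`. Equations with the same variables thereby get the same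
left-hand side. -/
def canon (D S : List Word) : List Word := D.filter fun v => decide (v ∈ S)

/-- The equations of weight one that belong to the nonempty sets of literals of the clauses. -/
def terms (r : ℕ) (cs : List (List Word)) : List (List Word × Bool) :=
  cs.flatMap fun C => ((sublistsTake r C).filter fun U => !U.isEmpty).map fun U =>
    (canon (allVars cs) (U.map List.tail), termRhs U)

/-- The equation equivalent to all the equations in `T` with left-hand side `S`. Its weight is the
distance between the numbers of equations with either right-hand side, written as the sum of the two
truncated differences. -/
def combine (T : List (List Word × Bool)) (S : List Word) : NamedEquation :=
  (S, decide (T.count (S, false) < T.count (S, true)),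
    (T.count (S, true) - T.count (S, false)) + (T.count (S, false) - T.count (S, true)))

/-- Combines equations with the same left-hand side and drops those that cancel. -/
def collect (T : List (List Word × Bool)) : List NamedEquation :=
  ((T.map Prod.fst).dedup.map fun S => combine T S).filter fun e => !decide (e.2.2 = 0)

/-- The variables from `D` that occur in an equation. -/
def occurring (D : List Word) (M : List NamedEquation) : List Word :=
  D.filter fun v => M.any fun e => decide (v ∈ e.1)

/-- A sufficient condition for the excess to reach `k`: a heavy equation or many variables. -/
def isEasy (r : ℕ) (M : List NamedEquation) (D : List Word) (k : ℕ) : Bool :=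
  (M.any fun e => decide (k ≤ e.2.2)) ||
    decide (r * k * (encodeNat M.length).length < D.length)

/-- Replaces an easy system by the empty one with parameter zero. -/
def trim (r : ℕ) (R : NamedSystem) : NamedSystem :=
  if isEasy r R.1 R.2.1 R.2.2 then ([], [], 0) else R

/-- The reduced system of a formula that has been read by `readStep`. The parameter is cut off just
above the largest conceivable excess, because its value could be exponential in its length. -/
def reduce (r : ℕ) (s : List Word × List (List Word)) : NamedSystem :=
  trim r (collect (terms r s.2), occurring (allVars s.2) (collect (terms r s.2)),
    Nat.min (bitsVal (s.1.headD [])) ((terms r s.2).length + 1))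

/-- The word that encodes a named system as an instance of Max `r`-Lin AA. -/
def linWord (R : NamedSystem) : List Γ' :=
  encNat R.2.2 ++ (encNat R.2.1.length ++ R.1.flatMap fun e =>
    Γ'.bra :: Γ'.bit e.2.1 :: (encNat e.2.2 ++
      (e.1.flatMap (fun v => encNat (R.2.1.idxOf v)) ++ [Γ'.ket])))

/-- The numbers of the variables `S`, padded to `r` variables by new ones. -/
def padded (r : ℕ) (D : List Word) (S : List Word) : List ℕ :=
  S.map (fun v => D.idxOf v) ++
    ((List.range r).filter fun j => decide (j < r - S.length)).map fun j => j + D.length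

/-- Whether the assignment that falsifies the clause `c` falsifies the equation with right-hand
side `b` in the variables of `c` below `n`. -/
def keeps (n : ℕ) (b : Bool) (c : List (ℕ × Bool)) : Bool :=
  c.foldr (fun l b => Bool.xor b (decide (l.1 < n) && !l.2)) b

/-- The clauses that replace an equation `e`: an assignment falsifies `e.weight` of them if it
falsifies `e`, and none otherwise. -/
def gadget (r : ℕ) (D : List Word) (e : NamedEquation) : List (List (ℕ × Bool)) :=
  (List.replicate e.2.2 ()).flatMap fun _ =>
    (signings r (padded r D e.1)).filter fun c => keeps D.length e.2.1 c

/-- The word that encodes the formula made of the gadgets of a named system, with its parameter. -/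
def satWord (r : ℕ) (R : NamedSystem) : List Γ' :=
  encNat (2 ^ (r - 1) * R.2.2) ++ (encNat (R.2.1.length + r) ++ R.1.flatMap fun e =>
    (gadget r R.2.1 e).flatMap fun c =>
      Γ'.bra :: (c.flatMap (fun l => Γ'.bit l.2 :: encNat l.1) ++ [Γ'.ket]))

/-- Whether the assignment with the set `A` of true variables satisfies the equation `e`. -/
def holds (A : List Word) (e : NamedEquation) : Bool :=
  e.1.foldr (fun v b => Bool.xor b (decide (v ∈ A))) (!e.2.1)

/-- Whether the assignment with the set `A` of true variables has excess at least `k`. -/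
def reaches (M : List NamedEquation) (k : ℕ) (A : List Word) : Bool :=
  decide (k + ((M.filter fun e => !holds A e).map fun e => e.2.2).sum ≤
    ((M.filter fun e => holds A e).map fun e => e.2.2).sum)

/-- All sublists of `D`, listed by a fold to which `StackProg.PolyTimeIn.foldl_of_bound` applies. -/
def sublistsOf (D : List Word) : List (List Word) :=
  D.foldr (fun v acc => acc ++ acc.map fun A => v :: A) [[]]

/-- Decides by exhaustive search whether a named system has excess at least its parameter. -/
def solve (R : NamedSystem) : Bool := (sublistsOf R.2.1).any fun A => reaches R.1 R.2.2 A

end MaxExactSat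

/-! ### Running time of the algorithm -/

namespace StackProg

variable {γ α : Type} [ToTree γ] [ToTree α] {B : γ → ℕ}

theorem PolyTimeIn.foldr_bool {l : γ → List α} {i : γ → Bool} {g : γ → α → Bool → Bool}
    (hl : PolyTimeIn B l) (hi : PolyTimeIn B i)
    (hg : PolyTime (fun p : γ × Bool × α => g p.1 p.2.2 p.2.1)) :
    PolyTimeIn B (fun c => (l c).foldr (g c) (i c)) :=
  PolyTimeIn.foldr_of_growth hl hi hg (PolyBounded.const 3) fun _ _ _ _ =>
    (size_bool _).trans (Nat.le_add_left _ _)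

theorem PolyTimeIn.idxOf [BEq α] [LawfulBEq α] (h : PolyTimeEq α) {D : γ → List α} {v : γ → α}
    (hD : PolyTimeIn B D) (hv : PolyTimeIn B v) :
    PolyTimeIn B (fun c => (D c).idxOf (v c)) := by
  classical
  refine PolyTimeIn.comp₂ (h := fun (D : List α) v => D.idxOf v) ?_ hD hv
  refine (PolyTimeIn.foldr_of_growth (l := fun p : List α × α => p.1) (i := fun _ => 0)
    (g := fun p a n => if a = p.2 then 0 else n + 1) PolyTime.left (PolyTime.const _)
    (PolyTimeIn.ite (h.decide_eq PolyTime.right.snd PolyTime.left.snd) (PolyTime.const _)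
      (PolyTime.right.fst.add (PolyTime.const 1))) (PolyBounded.const 2) ?_).congr fun p => ?_
  · intro c s a _
    simp only [size_nat]
    split_ifs <;> omega
  · induction p.1 with
    | nil => rfl
    | cons a l ih =>
      rw [List.foldr_cons, ← ih, List.idxOf_cons]
      rcases eq_or_ne a p.2 with h | h
      · simp [h]
      · rw [if_neg h, beq_eq_false_iff_ne.2 h, cond_false]

theorem PolyTimeIn.bit {b : γ → Bool} (hb : PolyTimeIn B b) :
    PolyTimeIn B (fun c => Γ'.bit (b c)) :=
  (hb.cond (hb.const (Γ'.bit true)) (hb.const (Γ'.bit false))).congr fun c => by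
    cases b c <;> rfl

theorem PolyTimeIn.encNat {f : γ → ℕ} (hf : PolyTimeIn B f) :
    PolyTimeIn B (fun c => MaxExactSat.encNat (f c)) :=
  (hf.encodeNat.map PolyTime.right.bit).append (hf.const _)

theorem size_le_of_forall (l : List α) {m : ℕ} (h : ∀ a ∈ l, size a ≤ m) :
    size l ≤ l.length * (m + 1) + 1 := by
  induction l with
  | nil => simp
  | cons a l ih =>
    have htail := ih fun a ha => h a (List.mem_cons_of_mem _ ha)
    have hhead := h a List.mem_cons_self
    rw [size_cons, List.length_cons, Nat.add_mul, Nat.one_mul]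
    omega

end StackProg

namespace MaxExactSat

open StackProg

section

variable {α : Type} [ToTree α]

theorem polyTime_readStep (a : Γ') : PolyTime (readStep a) := by
  rcases a with _ | b | _ | _ | _
  · exact PolyTime.id
  · exact (((PolyTime.const b).cons (PolyTime.left.headD [])).cons PolyTime.left.tail).pair
      PolyTime.right
  · exact (PolyTime.const _).pair (PolyTime.left.cons PolyTime.right)
  · exact (PolyTime.const _).pair PolyTime.right
  · exact ((PolyTime.const _).cons PolyTime.left).pair PolyTime.right

theorem size_readStep_le (a : Γ') (s : List Word × List (List Word)) :
    size (readStep a s) ≤ size s + 7 := by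
  obtain ⟨ws, cs⟩ := s
  have hpos := size_pos ws
  rcases a with _ | b | _ | _ | _
  · simp [readStep]
  · have hb := size_bool b
    cases ws <;> simp [readStep] <;> omega
  all_goals simp [readStep]; omega

theorem polyTime_sublistsTake (r : ℕ) : PolyTime (sublistsTake (α := α) r) := by
  induction r with
  | zero => exact (PolyTime.const [[]]).congr fun l => by rw [sublistsTake]
  | succ r ih =>
    refine (PolyTimeIn.comp (PolyTime.listCase (α := α) (γ := Unit)
      (f := fun _ => ([[]] : List (List α)))
      (g := fun p => sublistsTake r p.1.2 ++ (sublistsTake r p.1.2).map fun U => p.1.1 :: U)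
      (PolyTime.const _) ?_) (PolyTime.id.pair (PolyTime.const ()))).congr fun l => ?_
    · exact (ih.comp PolyTime.left.snd).append
        ((ih.comp PolyTime.left.snd).map (PolyTime.left.fst.fst.cons PolyTime.right))
    · cases l <;> rfl

theorem polyTime_signings (r : ℕ) : PolyTime (signings (α := α) r) := by
  induction r with
  | zero => exact (PolyTime.const [[]]).congr fun l => by rw [signings]
  | succ r ih =>
    have hmap (b : Bool) : PolyTime fun p : (α × List α) × Unit =>
        (signings r p.1.2).map fun c => (p.1.1, b) :: c :=
      (ih.comp PolyTime.left.snd).map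
        ((PolyTime.left.fst.fst.pair (PolyTime.const _)).cons PolyTime.right)
    refine (PolyTimeIn.comp (PolyTime.listCase
      (f := fun _ : Unit => ([[]] : List (List (α × Bool)))) (PolyTime.const _)
      ((hmap false).append (hmap true)))
      (PolyTime.id.pair (PolyTime.const ()))).congr fun l => ?_
    cases l <;> rfl

end

theorem polyTimeEq_word : PolyTimeEq Word := PolyTimeEq.list PolyTimeEq.bool

theorem polyTime_termRhs : PolyTime termRhs :=
  PolyTimeIn.foldr_bool (l := fun U : List Word => U) (i := fun _ => true)
    (g := fun _ l b => Bool.xor b (!l.headD false)) PolyTime.id (PolyTime.const true)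
    (PolyTimeIn.xor PolyTime.right.fst (PolyTimeIn.not (PolyTimeIn.headD PolyTime.right.snd false)))

theorem polyTime_allVars : PolyTime allVars :=
  PolyTimeIn.dedup polyTimeEq_word
    (PolyTime.id.flatMap (PolyTime.right.map PolyTime.right.tail))

theorem polyTime_canon : PolyTime fun p : List Word × List Word => canon p.1 p.2 :=
  PolyTime.left.filter (PolyTimeIn.decide_mem polyTimeEq_word PolyTime.right PolyTime.left.snd)

theorem polyTime_terms (r : ℕ) : PolyTime (terms r) :=
  PolyTime.id.flatMap
    ((((polyTime_sublistsTake r).comp PolyTime.right).filter PolyTime.right.isEmpty.not).map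
      ((polyTime_canon.comp ((polyTime_allVars.comp PolyTime.left.fst).pair
        (PolyTime.right.map PolyTime.right.tail))).pair (polyTime_termRhs.comp PolyTime.right)))

theorem polyTime_combine :
    PolyTime fun p : List (List Word × Bool) × List Word => combine p.1 p.2 := by
  have hcount (b : Bool) : PolyTime fun p : List (List Word × Bool) × List Word =>
      p.1.count (p.2, b) :=
    PolyTimeIn.count (.prod (.list polyTimeEq_word) .bool)
      (PolyTime.right.pair (PolyTime.const b)) PolyTime.left
  exact PolyTime.right.pair (((hcount false).decide_lt (hcount true)).pair
    (((hcount true).sub (hcount false)).add ((hcount false).sub (hcount true))))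

theorem polyTime_collect : PolyTime collect :=
  ((PolyTimeIn.dedup (.list polyTimeEq_word) (PolyTime.id.map PolyTime.right.fst)).map
    polyTime_combine).filter PolyTime.right.snd.snd.decide_eq_zero.not

theorem polyTime_occurring :
    PolyTime fun p : List Word × List NamedEquation => occurring p.1 p.2 :=
  PolyTime.left.filter (PolyTime.left.snd.any
    (PolyTimeIn.decide_mem polyTimeEq_word PolyTime.left.snd PolyTime.right.fst))

theorem polyTime_isEasy (r : ℕ) : PolyTime fun R : NamedSystem => isEasy r R.1 R.2.1 R.2.2 :=
  (PolyTime.left.any (PolyTime.left.snd.snd.decide_le PolyTime.right.snd.snd)).or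
    ((((PolyTime.const r).mul PolyTime.right.snd).mul
      PolyTime.left.length.encodeNat.length).decide_lt PolyTime.right.fst.length)

theorem polyTime_trim (r : ℕ) : PolyTime (trim r) :=
  PolyTimeIn.ite ((polyTime_isEasy r).congr fun p => by simp) (PolyTime.const _) PolyTime.id

theorem polyTime_reduce (r : ℕ) : PolyTime (reduce r) := by
  have hterms : PolyTime fun s : List Word × List (List Word) => terms r s.2 :=
    (polyTime_terms r).comp PolyTime.right
  have hcollect := polyTime_collect.comp hterms
  exact (polyTime_trim r).comp (hcollect.pair ((polyTime_occurring.comp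
    ((polyTime_allVars.comp PolyTime.right).pair hcollect)).pair
    (PolyTimeIn.min_bitsVal (hterms.length.add (PolyTime.const 1)) (PolyTime.left.headD []))))

theorem polyTime_linWord : PolyTime linWord :=
  PolyTime.right.snd.encNat.append (PolyTime.right.fst.length.encNat.append
    (PolyTime.left.flatMap ((PolyTime.const _).cons (PolyTime.right.snd.fst.bit.cons
      (PolyTime.right.snd.snd.encNat.append ((PolyTime.right.fst.flatMap
        (PolyTimeIn.idxOf polyTimeEq_word PolyTime.left.fst.snd.fst PolyTime.right).encNat).append
          (PolyTime.const _)))))))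

theorem polyTime_padded (r : ℕ) :
    PolyTime fun p : List Word × List Word => padded r p.1 p.2 :=
  (PolyTime.right.map (PolyTimeIn.idxOf polyTimeEq_word PolyTime.left.fst PolyTime.right)).append
    (((PolyTime.const (List.range r)).filter (PolyTime.right.decide_lt
      ((PolyTime.const r).sub PolyTime.left.snd.length))).map
        (PolyTime.right.add PolyTime.left.fst.length))

theorem polyTime_keeps :
    PolyTime fun p : ℕ × Bool × List (ℕ × Bool) => keeps p.1 p.2.1 p.2.2 :=
  PolyTimeIn.foldr_bool (l := fun p : ℕ × Bool × List (ℕ × Bool) => p.2.2) (i := fun p => p.2.1)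
    (g := fun p l b => Bool.xor b (decide (l.1 < p.1) && !l.2)) PolyTime.right.snd
    PolyTime.right.fst (PolyTimeIn.xor PolyTime.right.fst
      (PolyTimeIn.and (PolyTimeIn.decide_lt PolyTime.right.snd.fst PolyTime.left.fst)
        (PolyTimeIn.not PolyTime.right.snd.snd)))

theorem polyTime_gadget (r : ℕ) :
    PolyTime fun p : List Word × NamedEquation => gadget r p.1 p.2 := by
  have hkeeps : PolyTime fun q : (List Word × NamedEquation) × List (ℕ × Bool) =>
      keeps q.1.1.length q.1.2.2.1 q.2 :=
    PolyTimeIn.comp (f := fun q : (List Word × NamedEquation) × List (ℕ × Bool) =>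
      (q.1.1.length, q.1.2.2.1, q.2)) polyTime_keeps
      (PolyTime.left.fst.length.pair (PolyTime.left.snd.snd.fst.pair PolyTime.right))
  have hsignings : PolyTime fun p : List Word × NamedEquation =>
      signings r (padded r p.1 p.2.1) :=
    (polyTime_signings r).comp ((polyTime_padded r).comp (PolyTime.left.pair PolyTime.right.fst))
  have hclauses : PolyTime fun p : List Word × NamedEquation =>
      (signings r (padded r p.1 p.2.1)).filter fun c => keeps p.1.length p.2.2.1 c :=
    hsignings.filter hkeeps
  exact PolyTimeIn.flatMap PolyTime.right.snd.snd.replicate_unit (hclauses.comp PolyTime.left)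

theorem polyTime_satWord (r : ℕ) : PolyTime (satWord r) :=
  ((PolyTime.const _).mul PolyTime.right.snd).encNat.append
    ((PolyTime.right.fst.length.add (PolyTime.const r)).encNat.append
      (PolyTime.left.flatMap
        (((polyTime_gadget r).comp (PolyTime.left.snd.fst.pair PolyTime.right)).flatMap
          ((PolyTime.const _).cons ((PolyTime.right.flatMap
            (PolyTime.right.snd.bit.cons PolyTime.right.fst.encNat)).append
              (PolyTime.const _))))))

theorem polyTime_holds : PolyTime fun p : List Word × NamedEquation => holds p.1 p.2 :=
  PolyTimeIn.foldr_bool (l := fun p : List Word × NamedEquation => p.2.1)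
    (i := fun p => !p.2.2.1) (g := fun p v b => Bool.xor b (decide (v ∈ p.1)))
    PolyTime.right.fst PolyTime.right.snd.fst.not (PolyTimeIn.xor PolyTime.right.fst
      (PolyTimeIn.decide_mem polyTimeEq_word PolyTime.right.snd PolyTime.left.fst))

theorem polyTime_reaches :
    PolyTime fun p : (List NamedEquation × ℕ) × List Word => reaches p.1.1 p.1.2 p.2 := by
  have hholds : PolyTime fun q : ((List NamedEquation × ℕ) × List Word) × NamedEquation =>
      holds q.1.2 q.2 :=
    polyTime_holds.comp (PolyTime.left.snd.pair PolyTime.right)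
  have hweight : PolyTime fun q : ((List NamedEquation × ℕ) × List Word) × NamedEquation =>
      q.2.2.2 := PolyTime.right.snd.snd
  exact PolyTimeIn.decide_le
    (PolyTime.left.snd.add ((PolyTime.left.fst.filter hholds.not).map hweight).sum)
    ((PolyTime.left.fst.filter hholds).map hweight).sum

theorem sublistsOf_cons (v : Word) (D : List Word) :
    sublistsOf (v :: D) = sublistsOf D ++ (sublistsOf D).map fun A => v :: A := rfl

theorem length_sublistsOf (D : List Word) : (sublistsOf D).length = 2 ^ D.length := by
  induction D with
  | nil => rfl
  | cons v D ih =>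
    rw [sublistsOf_cons, List.length_append, List.length_map, ih, List.length_cons, pow_succ,
      mul_two]

theorem size_sublistsOf_le (D : List Word) :
    size (sublistsOf D) ≤ 2 ^ D.length * (size D + 1) + 1 := by
  rw [← length_sublistsOf]
  refine size_le_of_forall _ ?_
  induction D with
  | nil => simp [sublistsOf]
  | cons v D ih =>
    intro A hA
    rw [sublistsOf_cons, List.mem_append, List.mem_map] at hA
    rw [size_cons]
    rcases hA with hA | ⟨A, hA, rfl⟩
    · have := ih A hA
      omega
    · have := ih A hA
      rw [size_cons]
      omega

theorem size_sublistsOf_le_of_suffix {D D' : List Word} (h : D' <:+ D) :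
    size (sublistsOf D') ≤ 2 ^ D.length * (size D + 1) + 1 := by
  have hsize : size D' ≤ size D := by
    obtain ⟨l, rfl⟩ := h
    have := size_append l D'
    have := size_pos l
    omega
  exact (size_sublistsOf_le D').trans (Nat.add_le_add_right (Nat.mul_le_mul
    (Nat.pow_le_pow_right two_pos h.length_le) (Nat.add_le_add_right hsize 1)) 1)

theorem polyTimeIn_sublistsOf :
    PolyTimeIn (fun R : NamedSystem => size R + 2 ^ R.2.1.length) fun R => sublistsOf R.2.1 := by
  have hsize : PolyBounded (fun R : NamedSystem => size R + 2 ^ R.2.1.length) size :=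
    PolyBounded.self.mono fun R => Nat.le_add_right _ _
  have hpow : PolyBounded (fun R : NamedSystem => size R + 2 ^ R.2.1.length)
      fun R => 2 ^ R.2.1.length := PolyBounded.self.mono fun R => Nat.le_add_left _ _
  have hvars := PolyTimeIn.of_polyTime PolyTime.right.fst hsize
  refine (PolyTimeIn.foldl_of_bound (l := fun R : NamedSystem => R.2.1.reverse)
    (i := fun _ => [[]])
    (g := fun _ (acc : List (List Word)) v => acc ++ acc.map fun A => v :: A) hvars.reverse
    (hvars.const _) (PolyTime.right.fst.append
      (PolyTime.right.fst.map (PolyTime.left.snd.snd.cons PolyTime.right)))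
    (M := fun R => 2 ^ R.2.1.length * (size R.2.1 + 1) + 1)
    ((hpow.mul (hvars.output.add (.const 1))).add (.const 1)) fun R l hl => ?_).congr fun R => ?_
  · have hfold : l.foldl (fun (acc : List (List Word)) v => acc ++ acc.map fun A => v :: A) [[]]
        = sublistsOf l.reverse := by
      rw [sublistsOf, List.foldr_reverse]
    rw [hfold]
    exact size_sublistsOf_le_of_suffix (List.reverse_prefix.1 (by simpa using hl))
  · rw [List.foldl_reverse, sublistsOf]

theorem polyTimeIn_solve :
    PolyTimeIn (fun R : NamedSystem => size R + 2 ^ R.2.1.length) solve := by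
  have hany : PolyTime fun p : (List NamedEquation × ℕ) × List (List Word) =>
      p.2.any fun A => reaches p.1.1 p.1.2 A :=
    PolyTime.right.any (polyTime_reaches.comp (PolyTime.left.fst.pair PolyTime.right))
  have hinput := PolyTimeIn.of_polyTime
    (PolyTime.left.pair PolyTime.right.snd : PolyTime fun R : NamedSystem => (R.1, R.2.2))
    (PolyBounded.self.mono fun R => Nat.le_add_right (size R) (2 ^ R.2.1.length))
  exact hany.comp (hinput.pair polyTimeIn_sublistsOf)

end MaxExactSat

/-! ### The value of a system -/

namespace MaxExactSat

open StackProg LinExcess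

theorem sum_map_flatMap {α β A : Type*} [AddMonoid A] (l : List α) (g : α → List β) (f : β → A) :
    ((l.flatMap g).map f).sum = (l.map fun a => ((g a).map f).sum).sum := by
  induction l with
  | nil => rfl
  | cons a l ih => simp [ih]

theorem sum_map_filter_of_forall_eq_zero {α A : Type*} [AddMonoid A] (l : List α) (p : α → Bool)
    (f : α → A) (h : ∀ a ∈ l, p a = false → f a = 0) :
    ((l.filter p).map f).sum = (l.map f).sum := by
  induction l with
  | nil => rfl
  | cons a l ih =>
    have ih := ih fun b hb => h b (List.mem_cons_of_mem _ hb)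
    cases hp : p a
    · simp [hp, ih, h a (by simp) hp]
    · simp [hp, ih]

/-- The element `0` or `1` of the two-element field that a bit stands for. -/
def toZMod (b : Bool) : ZMod 2 := if b then 1 else 0

theorem toZMod_xor (b b' : Bool) : toZMod (Bool.xor b b') = toZMod b + toZMod b' := by
  decide +revert

theorem toZMod_not (b : Bool) : toZMod (!b) = toZMod b + 1 := by decide +revert

theorem toZMod_decide (a : ZMod 2) : toZMod (decide (a = 1)) = a := by decide +revert

theorem sgn_toZMod_add (b b' : Bool) : sgn (toZMod b + toZMod b') = if b = b' then 1 else -1 := by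
  decide +revert

/-- The contribution of an equation of weight one with variables `S` and right-hand side `b` to the
excess of the assignment `z`: `1` if `z` satisfies the equation and `-1` otherwise. -/
def equationSign (z : Word → ZMod 2) (S : List Word) (b : Bool) : ℤ :=
  sgn ((S.map z).sum + toZMod b)

theorem equationSign_le_one (z : Word → ZMod 2) (S : List Word) (b : Bool) :
    equationSign z S b ≤ 1 :=
  (by decide : ∀ a : ZMod 2, sgn a ≤ 1) _

theorem equationSign_true (z : Word → ZMod 2) (S : List Word) :
    equationSign z S true = -equationSign z S false := by
  simp [equationSign, toZMod, sgn_add_one]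

theorem equationSign_perm (z : Word → ZMod 2) {S S' : List Word} (h : S.Perm S') (b : Bool) :
    equationSign z S b = equationSign z S' b := by
  rw [equationSign, (h.map z).sum_eq, ← equationSign]

/-- The excess of an assignment over a list of equations of weight one. -/
def termSum (z : Word → ZMod 2) (T : List (List Word × Bool)) : ℤ :=
  (T.map fun t => equationSign z t.1 t.2).sum

/-- The excess of an assignment over a list of weighted equations. -/
def excess (z : Word → ZMod 2) (M : List NamedEquation) : ℤ :=
  (M.map fun e => (e.2.2 : ℤ) * equationSign z e.1 e.2.1).sum

/-- The maximum excess of the system is at least its parameter. -/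
def NamedSystem.Yes (R : NamedSystem) : Prop := ∃ z, (R.2.2 : ℤ) ≤ excess z R.1

theorem excess_congr {z z' : Word → ZMod 2} {M : List NamedEquation}
    (h : ∀ e ∈ M, ∀ v ∈ e.1, z v = z' v) : excess z M = excess z' M := by
  refine congrArg List.sum (List.map_congr_left fun e he => ?_)
  rw [equationSign, List.map_congr_left (h e he), ← equationSign]

theorem termSum_le_length (z : Word → ZMod 2) (T : List (List Word × Bool)) :
    termSum z T ≤ T.length := by
  have := List.sum_le_card_nsmul (T.map fun t => equationSign z t.1 t.2) 1 fun x hx => by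
    obtain ⟨t, -, rfl⟩ := List.mem_map.1 hx
    exact equationSign_le_one z t.1 t.2
  simpa [termSum] using this

theorem excess_collect_eq_sum (z : Word → ZMod 2) (T : List (List Word × Bool)) :
    excess z (collect T) = ∑ S ∈ (T.map Prod.fst).toFinset,
      ((combine T S).2.2 : ℤ) * equationSign z S (combine T S).2.1 := by
  unfold excess collect
  rw [sum_map_filter_of_forall_eq_zero _ _ _ fun e _ he => by simp_all, List.map_map,
    ← List.sum_toFinset _ (List.nodup_dedup _)]
  exact Finset.sum_congr (by ext; simp) fun _ _ => rfl

theorem termSum_eq_sum_count (z : Word → ZMod 2) (T : List (List Word × Bool)) :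
    termSum z T = ∑ S ∈ (T.map Prod.fst).toFinset,
      ∑ b : Bool, T.count (S, b) • equationSign z S b := by
  rw [← Finset.sum_product (T.map Prod.fst).toFinset Finset.univ
    fun t => T.count t • equationSign z t.1 t.2]
  unfold termSum
  rw [Finset.sum_list_map_count, lawful_beq_subsingleton instBEqOfDecidableEq instBEqProd]
  refine Finset.sum_subset (fun t ht => ?_) fun t _ ht => ?_
  · rw [Finset.mem_product]
    exact ⟨List.mem_toFinset.2 (List.mem_map_of_mem (List.mem_toFinset.1 ht)), Finset.mem_univ _⟩
  · rw [List.count_eq_zero_of_not_mem (by simpa using ht), zero_smul]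

theorem weight_combine_mul_equationSign (z : Word → ZMod 2) (T : List (List Word × Bool))
    (S : List Word) : ((combine T S).2.2 : ℤ) * equationSign z S (combine T S).2.1 =
      ∑ b : Bool, T.count (S, b) • equationSign z S b := by
  rw [Fintype.sum_bool, equationSign_true]
  simp only [combine, nsmul_eq_mul]
  rcases lt_or_ge (T.count (S, false)) (T.count (S, true)) with h | h
  · rw [decide_eq_true h, equationSign_true, Nat.sub_eq_zero_of_le h.le, add_zero,
      Nat.cast_sub h.le]
    ring
  · rw [decide_eq_false h.not_gt, Nat.sub_eq_zero_of_le h, zero_add, Nat.cast_sub h]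
    ring

theorem excess_collect (z : Word → ZMod 2) (T : List (List Word × Bool)) :
    excess z (collect T) = termSum z T := by
  rw [excess_collect_eq_sum, termSum_eq_sum_count]
  exact Finset.sum_congr rfl fun S _ => weight_combine_mul_equationSign z T S

/-! ### The terms of a clause -/

section

variable {α : Type}

theorem sum_map_sublistsTake {A : Type*} [AddMonoid A] (r : ℕ) (C : List α) (g : List α → A) :
    ((sublistsTake r C).map g).sum =
      g [] + (((sublistsTake r C).filter fun U => !U.isEmpty).map g).sum := by
  induction r generalizing C g with
  | zero => simp [sublistsTake]
  | succ r ih =>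
    cases C with
    | nil => simp [sublistsTake]
    | cons a C =>
      have hcons : ((sublistsTake r C).map fun U => a :: U).filter (fun U => !U.isEmpty)
          = (sublistsTake r C).map fun U => a :: U := by simp
      simp only [sublistsTake, List.map_append, List.filter_append, List.sum_append]
      rw [hcons, ih C g, add_assoc]

theorem sum_prod_sublistsTake_length {R : Type*} [Semiring R] (C : List α) (f : α → R) :
    ((sublistsTake C.length C).map fun U => (U.map f).prod).sum =
      (C.map fun a => 1 + f a).prod := by
  induction C with
  | nil => simp [sublistsTake]
  | cons a C ih =>
    have hcons : ((fun U : List α => (U.map f).prod) ∘ fun U => a :: U)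
        = fun U => f a * (U.map f).prod := by
      funext U; simp
    simp only [List.length_cons, sublistsTake, List.map_append, List.map_map, List.sum_append,
      List.map_cons, List.prod_cons]
    rw [hcons, List.sum_map_mul_left, ih, add_mul, one_mul]

theorem sum_neg_prod_nonempty_sublists {R : Type*} [Ring R] (C : List α) (f : α → R) :
    (((sublistsTake C.length C).filter fun U => !U.isEmpty).map fun U => -(U.map f).prod).sum =
      1 - (C.map fun a => 1 + f a).prod := by
  have hneg (l : List (List α)) : (l.map fun U => -(U.map f).prod).sum =
      -(l.map fun U => (U.map f).prod).sum := by
    rw [List.sum_neg, List.map_map, Function.comp_def]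
  have hempty := sum_map_sublistsTake C.length C fun U => (U.map f).prod
  rw [sum_prod_sublistsTake_length] at hempty
  rw [hneg, hempty]
  simp

theorem sublist_of_mem_sublistsTake {r : ℕ} {C U : List α} (h : U ∈ sublistsTake r C) :
    U.Sublist C ∧ U.length ≤ r := by
  induction r generalizing C U with
  | zero => simp_all [sublistsTake]
  | succ r ih =>
    cases C with
    | nil => simp_all [sublistsTake]
    | cons a C =>
      rw [sublistsTake, List.mem_append, List.mem_map] at h
      rcases h with h | ⟨U, h, rfl⟩
      · exact ⟨(ih h).1.cons a, (ih h).2.trans (Nat.le_succ r)⟩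
      · exact ⟨(ih h).1.cons_cons a, by simpa using (ih h).2⟩

end

/-- The sign of a literal: `1` if the assignment makes it true and `-1` otherwise. -/
def litSign (z : Word → ZMod 2) (l : Word) : ℤ := sgn (z l.tail + toZMod (l.headD false))

theorem equationSign_termRhs (z : Word → ZMod 2) (U : List Word) :
    equationSign z (U.map List.tail) (termRhs U) = -(U.map fun l => -litSign z l).prod := by
  induction U with
  | nil => rfl
  | cons l U ih =>
    have hrhs : termRhs (l :: U) = Bool.xor (termRhs U) (!l.headD false) := rfl
    rw [equationSign, sgn_add] at ih ⊢
    rw [hrhs, toZMod_xor, toZMod_not, List.map_cons, List.map_cons, List.sum_cons, List.map_cons,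
      List.prod_cons, litSign, sgn_add (toZMod (termRhs U)), sgn_add_one]
    simp only [sgn_add]
    linear_combination -sgn (z l.tail) * sgn (toZMod (l.headD false)) * ih

theorem nodup_allVars (cs : List (List Word)) : (allVars cs).Nodup := List.nodup_dedup _

theorem map_tail_subset_allVars {cs : List (List Word)} {C : List Word} (hC : C ∈ cs) :
    C.map List.tail ⊆ allVars cs :=
  fun _ hv => List.mem_dedup.2 (List.mem_flatMap.2 ⟨C, hC, hv⟩)

theorem canon_perm {D S : List Word} (hD : D.Nodup) (hS : S.Nodup) (h : S ⊆ D) :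
    (canon D S).Perm S :=
  (List.perm_ext_iff_of_nodup (hD.filter _) hS).2 fun v => by
    simp only [List.mem_filter, decide_eq_true_eq]
    exact ⟨fun hv => hv.2, fun hv => ⟨h hv, hv⟩⟩

theorem termSum_terms {r : ℕ} {cs : List (List Word)} (hlen : ∀ C ∈ cs, C.length = r)
    (hnd : ∀ C ∈ cs, (C.map List.tail).Nodup) (z : Word → ZMod 2) :
    termSum z (terms r cs) = (cs.map fun C => 1 - (C.map fun l => 1 - litSign z l).prod).sum := by
  unfold termSum terms
  rw [sum_map_flatMap]
  refine congrArg List.sum (List.map_congr_left fun C hC => ?_)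
  simp only [sub_eq_add_neg (1 : ℤ) (litSign z _)]
  rw [← sum_neg_prod_nonempty_sublists C fun l => -litSign z l, hlen C hC, List.map_map]
  refine congrArg List.sum (List.map_congr_left fun U hU => ?_)
  have hsub := ((sublist_of_mem_sublistsTake (List.mem_filter.1 hU).1).1).map List.tail
  rw [← equationSign_termRhs]
  exact equationSign_perm z (canon_perm (nodup_allVars cs) (hsub.nodup (hnd C hC))
    fun v hv => map_tail_subset_allVars hC (hsub.subset hv)) _

/-! ### Reading a formula -/

theorem foldr_readStep_bits (l : List Bool) (ws : List Word) (cs : List (List Word)) :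
    (l.map Γ'.bit).foldr readStep ([] :: ws, cs) = (l :: ws, cs) := by
  induction l with
  | nil => rfl
  | cons b l ih => rw [List.map_cons, List.foldr_cons, ih]; rfl

theorem foldr_readStep_encNat (a : ℕ) (ws : List Word) (cs : List (List Word)) :
    (encNat a).foldr readStep (ws, cs) = (encodeNat a :: ws, cs) := by
  rw [encNat, List.foldr_append]
  exact foldr_readStep_bits _ _ _

/-- A literal in the form in which the algorithm keeps it. -/
def litWord {n : ℕ} (l : Literal n) : Word := l.2 :: encodeNat l.1

theorem foldr_readStep_encLit {n : ℕ} (l : Literal n) (ws : List Word) (cs : List (List Word)) :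
    (encLit l).foldr readStep (ws, cs) = (litWord l :: ws, cs) := by
  rw [encLit, List.foldr_cons, foldr_readStep_encNat]
  rfl

/-- A clause in the form in which the algorithm keeps it. -/
def clauseWords {r n : ℕ} (C : Clause r n) : List Word := C.lits.map litWord

theorem foldr_readStep_flatMap_encLit {n : ℕ} (L : List (Literal n)) (cs : List (List Word)) :
    (L.flatMap encLit).foldr readStep ([], cs) = (L.map litWord, cs) := by
  induction L with
  | nil => rfl
  | cons l L ih =>
    rw [List.flatMap_cons, List.foldr_append, ih, foldr_readStep_encLit, List.map_cons]

theorem foldr_readStep_encClause {r n : ℕ} (C : Clause r n) (ws : List Word)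
    (cs : List (List Word)) :
    (encClause C).foldr readStep (ws, cs) = ([], clauseWords C :: cs) := by
  have hket : [Γ'.ket].foldr readStep (ws, cs) = ([], cs) := rfl
  rw [encClause, List.foldr_cons, List.foldr_append, hket, foldr_readStep_flatMap_encLit]
  rfl

theorem foldr_readStep_flatMap_encClause {r n : ℕ} (cs : List (Clause r n)) :
    (cs.flatMap encClause).foldr readStep ([], []) = ([], cs.map clauseWords) := by
  induction cs with
  | nil => rfl
  | cons C cs ih =>
    rw [List.flatMap_cons, List.foldr_append, ih, foldr_readStep_encClause, List.map_cons]

/-- What `readStep` makes of the word that encodes a formula and a parameter. -/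
def parsed {r : ℕ} (p : Formula r × ℕ) : List Word × List (List Word) :=
  ([encodeNat p.2, encodeNat p.1.n], p.1.clauses.map clauseWords)

theorem foldr_readStep_encPair {r : ℕ} (p : Formula r × ℕ) :
    ((maxExactSatAA r).encPair p).foldr readStep ([], []) = parsed p := by
  change (encNat p.2 ++ (encNat p.1.n ++ p.1.clauses.flatMap encClause)).foldr _ _ = _
  rw [List.foldr_append, List.foldr_append, foldr_readStep_flatMap_encClause,
    foldr_readStep_encNat, foldr_readStep_encNat]
  rfl

/-! ### Formulas as systems -/

/-- The excess of the assignment `a` over a list of `r` literals: `2 ^ r` times the difference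
between the truth value of their disjunction, as a number, and the average `1 - 1 / 2 ^ r`. -/
def literalsExcess {α : Type} (a : α → Bool) (c : List (α × Bool)) : ℤ :=
  1 - (c.map fun l => if a l.1 = l.2 then 0 else 2).prod

/-- The excess of an assignment over a clause, see `clauseExcess_eq`. -/
def clauseExcess {r n : ℕ} (a : Fin n → Bool) (C : Clause r n) : ℤ := literalsExcess a C.lits

theorem clauseExcess_eq {r n : ℕ} (a : Fin n → Bool) (C : Clause r n) :
    clauseExcess a C = if C.Sat a then 1 else 1 - 2 ^ r := by
  unfold clauseExcess literalsExcess
  split_ifs with hC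
  · obtain ⟨l, hl, hal⟩ := hC
    rw [List.prod_eq_zero (List.mem_map.2 ⟨l, hl, by simp [hal]⟩), sub_zero]
  · have hfalse : ∀ l ∈ C.lits, (if a l.1 = l.2 then (0 : ℤ) else 2) = 2 := fun l hl =>
      if_neg fun hal => hC ⟨l, hl, hal⟩
    rw [List.map_congr_left hfalse, List.map_const', List.prod_replicate, C.length_eq]

theorem sum_clauseExcess {r : ℕ} (F : Formula r) (a : Fin F.n → Bool) :
    (F.clauses.map (clauseExcess a)).sum = F.m - 2 ^ r * (F.m - F.numSat a) := by
  unfold Formula.m Formula.numSat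
  induction F.clauses with
  | nil => simp
  | cons C cs ih =>
    rw [List.map_cons, List.sum_cons, ih, clauseExcess_eq, List.countP_cons, List.length_cons]
    by_cases hC : C.Sat a
    · simp [hC]
      ring
    · simp [hC]
      ring

theorem Formula.yes_iff {r : ℕ} (F : Formula r) (k : ℕ) :
    F.Yes k ↔ ∃ a : Fin F.n → Bool, (k : ℤ) ≤ (F.clauses.map (clauseExcess a)).sum := by
  refine exists_congr fun a => ?_
  have hscale : (2 ^ r : ℝ) * ((1 - 1 / 2 ^ r : ℝ) * F.m + k * (1 / 2 ^ r))
      = 2 ^ r * F.m - F.m + k := by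
    field_simp
  rw [sum_clauseExcess, ← mul_le_mul_iff_right₀ (by positivity : (0 : ℝ) < 2 ^ r), hscale,
    ← Int.cast_le (R := ℝ)]
  push_cast
  constructor <;> intro h <;> linarith

theorem one_sub_litSign_litWord {n : ℕ} {a : Fin n → Bool} {z : Word → ZMod 2}
    (hz : ∀ i : Fin n, z (encodeNat i) = toZMod (a i)) (l : Literal n) :
    1 - litSign z (litWord l) = if a l.1 = l.2 then 0 else 2 := by
  have hsign : litSign z (litWord l) = sgn (toZMod (a l.1) + toZMod l.2) := by
    rw [← hz]
    rfl
  rw [hsign, sgn_toZMod_add]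
  split_ifs <;> rfl

theorem nodup_map_tail_clauseWords {r n : ℕ} (C : Clause r n) :
    ((clauseWords C).map List.tail).Nodup := by
  have hvars : (clauseWords C).map List.tail =
      (C.lits.map Prod.fst).map fun i : Fin n => encodeNat i := by
    simp [clauseWords, litWord, Function.comp_def]
  rw [hvars]
  exact C.nodup.map fun i j h => Fin.ext (encodeNat_injective h)

theorem termSum_parsed {r : ℕ} (F : Formula r) (k : ℕ) {a : Fin F.n → Bool} {z : Word → ZMod 2}
    (hz : ∀ i : Fin F.n, z (encodeNat i) = toZMod (a i)) :
    termSum z (terms r (parsed (F, k)).2) = (F.clauses.map (clauseExcess a)).sum := by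
  have hclause (C : Clause r F.n) :
      1 - ((clauseWords C).map fun l => 1 - litSign z l).prod = clauseExcess a C := by
    rw [clauseWords, List.map_map, clauseExcess, literalsExcess]
    exact congrArg (fun l : List ℤ => 1 - l.prod)
      (List.map_congr_left fun l _ => one_sub_litSign_litWord hz l)
  rw [termSum_terms]
  · simp only [parsed, List.map_map, Function.comp_def, hclause]
  · simp [parsed, clauseWords, Clause.length_eq]
  · simpa [parsed] using fun C _ => nodup_map_tail_clauseWords C

theorem Formula.yes_iff_termSum {r : ℕ} (F : Formula r) (k : ℕ) :
    F.Yes k ↔ ∃ z, (k : ℤ) ≤ termSum z (terms r (parsed (F, k)).2) := by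
  rw [F.yes_iff]
  constructor
  · rintro ⟨a, ha⟩
    refine ⟨fun w => if h : bitsVal w < F.n then toZMod (a ⟨bitsVal w, h⟩) else 0, ?_⟩
    rwa [termSum_parsed F k (a := a) fun i => by simp [bitsVal_encodeNat]]
  · rintro ⟨z, hz⟩
    refine ⟨fun i => decide (z (encodeNat i) = 1), ?_⟩
    rwa [← termSum_parsed F k (z := z) fun i => (toZMod_decide _).symm]

/-- The reduced system of a formula before trimming. -/
def collected {r : ℕ} (p : Formula r × ℕ) : NamedSystem :=
  (collect (terms r (parsed p).2), occurring (allVars (parsed p).2)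
    (collect (terms r (parsed p).2)), Nat.min p.2 ((terms r (parsed p).2).length + 1))

/-- The system to which a formula is reduced. -/
def reduced {r : ℕ} (p : Formula r × ℕ) : NamedSystem := trim r (collected p)

theorem reduce_parsed {r : ℕ} (p : Formula r × ℕ) : reduce r (parsed p) = reduced p := by
  have hparam : bitsVal ((parsed p).1.headD []) = p.2 := bitsVal_encodeNat _
  rw [reduce, hparam]
  rfl

theorem yes_collected {r : ℕ} (p : Formula r × ℕ) : (collected p).Yes ↔ p.1.Yes p.2 := by
  rw [Formula.yes_iff_termSum]
  refine exists_congr fun z => ?_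
  have hle := termSum_le_length z (terms r (parsed p).2)
  simp only [collected, excess_collect, Prod.mk.eta]
  change ((min p.2 ((terms r (parsed p).2).length + 1) : ℕ) : ℤ) ≤ _ ↔ _
  omega

end MaxExactSat

/-! ### Well-formed systems -/

namespace MaxExactSat

open StackProg LinExcess

/-- The system encodes an instance of Max `r`-Lin AA in which no two equations have the same
left-hand side and every variable occurs. -/
structure WellFormed (r : ℕ) (R : NamedSystem) : Prop where
  nodup_vars : R.2.1.Nodup
  nodup_eqns : R.1.Nodup
  nodup : ∀ e ∈ R.1, e.1.Nodup
  ne_nil : ∀ e ∈ R.1, e.1 ≠ []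
  length_le : ∀ e ∈ R.1, e.1.length ≤ r
  subset : ∀ e ∈ R.1, e.1 ⊆ R.2.1
  occurs : ∀ v ∈ R.2.1, ∃ e ∈ R.1, v ∈ e.1
  pos : ∀ e ∈ R.1, 0 < e.2.2
  ext : ∀ e ∈ R.1, ∀ e' ∈ R.1, (∀ v, v ∈ e.1 ↔ v ∈ e'.1) → e = e'

theorem wellFormed_empty (r : ℕ) : WellFormed r ([], [], 0) := by
  constructor <;> simp

theorem exists_eq_canon_of_mem_terms {r : ℕ} {cs : List (List Word)}
    (hnd : ∀ C ∈ cs, (C.map List.tail).Nodup) {t : List Word × Bool} (ht : t ∈ terms r cs) :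
    ∃ S : List Word, S.Nodup ∧ S ≠ [] ∧ S.length ≤ r ∧ S ⊆ allVars cs ∧
      t.1 = canon (allVars cs) S := by
  simp only [terms, List.mem_flatMap, List.mem_map, List.mem_filter] at ht
  obtain ⟨C, hC, U, ⟨hU, hne⟩, rfl⟩ := ht
  obtain ⟨hsub, hlen⟩ := sublist_of_mem_sublistsTake hU
  refine ⟨U.map List.tail, (hsub.map _).nodup (hnd C hC), ?_, by simpa using hlen,
    fun v hv => map_tail_subset_allVars hC ((hsub.map _).subset hv), rfl⟩
  simpa [List.map_eq_nil_iff] using hne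

theorem mem_collect {T : List (List Word × Bool)} {e : NamedEquation} (he : e ∈ collect T) :
    e = combine T e.1 ∧ 0 < e.2.2 ∧ ∃ t ∈ T, t.1 = e.1 := by
  simp only [collect, List.mem_filter, List.mem_map, List.mem_dedup] at he
  obtain ⟨⟨S, ⟨t, ht, rfl⟩, rfl⟩, hweight⟩ := he
  refine ⟨rfl, ?_, t, ht, rfl⟩
  simpa [Nat.pos_iff_ne_zero] using hweight

theorem nodup_collect (T : List (List Word × Bool)) : (collect T).Nodup :=
  (List.Nodup.map (fun _ _ h => congrArg Prod.fst h) (List.nodup_dedup _)).filter _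

section

variable {r : ℕ} {cs : List (List Word)} (hnd : ∀ C ∈ cs, (C.map List.tail).Nodup)
include hnd

theorem exists_eq_canon_of_mem_collect {e : NamedEquation} (he : e ∈ collect (terms r cs)) :
    ∃ S : List Word, S.Nodup ∧ S ≠ [] ∧ S.length ≤ r ∧ S ⊆ allVars cs ∧
      e.1 = canon (allVars cs) S ∧ e.1.Perm S := by
  obtain ⟨-, -, t, ht, hte⟩ := mem_collect he
  obtain ⟨S, hS, hne, hlen, hsub, hcanon⟩ := exists_eq_canon_of_mem_terms hnd ht
  rw [hte] at hcanon
  exact ⟨S, hS, hne, hlen, hsub, hcanon, hcanon ▸ canon_perm (nodup_allVars cs) hS hsub⟩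

theorem eq_of_mem_collect_of_forall_mem_iff {e e' : NamedEquation}
    (he : e ∈ collect (terms r cs)) (he' : e' ∈ collect (terms r cs))
    (h : ∀ v, v ∈ e.1 ↔ v ∈ e'.1) : e = e' := by
  obtain ⟨S, -, -, -, -, hcanon, hperm⟩ := exists_eq_canon_of_mem_collect hnd he
  obtain ⟨S', -, -, -, -, hcanon', hperm'⟩ := exists_eq_canon_of_mem_collect hnd he'
  have hvars : e.1 = e'.1 := by
    rw [hcanon, hcanon']
    refine List.filter_congr fun v _ => ?_
    rw [decide_eq_decide, ← hperm.mem_iff, ← hperm'.mem_iff, h]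
  rw [(mem_collect he).1, (mem_collect he').1, hvars]

theorem wellFormed_collect (k : ℕ) :
    WellFormed r (collect (terms r cs), occurring (allVars cs) (collect (terms r cs)), k) where
  nodup_vars := (nodup_allVars cs).filter _
  nodup_eqns := nodup_collect _
  nodup e he := by
    obtain ⟨S, hS, -, -, -, -, hperm⟩ := exists_eq_canon_of_mem_collect hnd he
    exact hperm.nodup_iff.2 hS
  ne_nil e he hnil := by
    obtain ⟨S, -, hne, -, -, -, hperm⟩ := exists_eq_canon_of_mem_collect hnd he
    exact hne (hnil ▸ hperm).nil_eq.symm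
  length_le e he := by
    obtain ⟨S, -, -, hlen, -, -, hperm⟩ := exists_eq_canon_of_mem_collect hnd he
    exact hperm.length_eq.trans_le hlen
  subset e he v hv := by
    obtain ⟨S, -, -, -, hsub, -, hperm⟩ := exists_eq_canon_of_mem_collect hnd he
    rw [occurring, List.mem_filter]
    exact ⟨hsub (hperm.subset hv), List.any_eq_true.2 ⟨e, he, by simpa using hv⟩⟩
  occurs v hv := by
    rw [occurring, List.mem_filter, List.any_eq_true] at hv
    obtain ⟨-, e, he, hve⟩ := hv
    exact ⟨e, he, by simpa using hve⟩
  pos e he := (mem_collect he).2.1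
  ext _ he _ he' h := eq_of_mem_collect_of_forall_mem_iff hnd he he' h

end

theorem wellFormed_collected {r : ℕ} (p : Formula r × ℕ) : WellFormed r (collected p) := by
  refine wellFormed_collect (fun C hC => ?_) _
  obtain ⟨C, -, rfl⟩ := List.mem_map.1 hC
  exact nodup_map_tail_clauseWords C

/-! ### Large systems are yes-instances -/

/-- The coefficient vector of an equation between variables from `D`. -/
def coeffVec (D : List Word) (e : NamedEquation) : {v // v ∈ D} → ZMod 2 :=
  fun v => if v.1 ∈ e.1 then 1 else 0

/-- The coefficient vectors of the equations of a system. -/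
def coeffVecs (R : NamedSystem) : Finset ({v // v ∈ R.2.1} → ZMod 2) :=
  R.1.toFinset.image (coeffVec R.2.1)

/-- The extension by zero of an assignment to the variables from `D`. -/
def extend (D : List Word) (z : {v // v ∈ D} → ZMod 2) (w : Word) : ZMod 2 :=
  if h : w ∈ D then z ⟨w, h⟩ else 0

section

variable {r : ℕ} {R : NamedSystem}

theorem coeffVec_mem {e : NamedEquation} (he : e ∈ R.1) : coeffVec R.2.1 e ∈ coeffVecs R :=
  Finset.mem_image_of_mem _ (List.mem_toFinset.2 he)

theorem forall_mem_coeffVecs {p : ({v // v ∈ R.2.1} → ZMod 2) → Prop} :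
    (∀ u ∈ coeffVecs R, p u) ↔ ∀ e ∈ R.1, p (coeffVec R.2.1 e) := by
  simp only [coeffVecs, Finset.forall_mem_image, List.mem_toFinset]

theorem card_coeffVecs_le : (coeffVecs R).card ≤ R.1.length :=
  Finset.card_image_le.trans (List.toFinset_card_le _)

theorem coeffVec_ne_zero_iff (D : List Word) (e : NamedEquation) (v : {v // v ∈ D}) :
    coeffVec D e v ≠ 0 ↔ v.1 ∈ e.1 := by
  simp [coeffVec]

theorem WellFormed.zero_notMem_coeffVecs (hR : WellFormed r R) : 0 ∉ coeffVecs R := by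
  intro hzero
  refine (forall_mem_coeffVecs (p := (· ≠ 0))).2 (fun e he h => ?_) 0 hzero rfl
  obtain ⟨v, hv⟩ := List.exists_mem_of_ne_nil _ (hR.ne_nil e he)
  exact (coeffVec_ne_zero_iff _ e ⟨v, hR.subset e he hv⟩).2 hv (congrFun h _)

theorem WellFormed.coeffVec_injOn (hR : WellFormed r R) :
    Set.InjOn (coeffVec R.2.1) {e | e ∈ R.1} := by
  intro e he e' he' h
  refine hR.ext e he e' he' fun v => ?_
  by_cases hv : v ∈ R.2.1
  · rw [← coeffVec_ne_zero_iff _ e ⟨v, hv⟩, h, coeffVec_ne_zero_iff]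
  · exact iff_of_false (fun hve => hv (hR.subset e he hve)) fun hve => hv (hR.subset e' he' hve)

theorem WellFormed.card_support_coeffVec_le (hR : WellFormed r R) {e : NamedEquation}
    (he : e ∈ R.1) : (Finset.univ.filter fun v => coeffVec R.2.1 e v ≠ 0).card ≤ r := by
  refine le_trans ?_ (hR.length_le e he)
  rw [← List.toFinset_card_of_nodup (hR.nodup e he)]
  refine Finset.card_le_card_of_injOn (fun v => v.1) (fun v hv => ?_) Subtype.val_injective.injOn
  simpa [coeffVec_ne_zero_iff] using hv

theorem WellFormed.coeffVec_dotProduct (hR : WellFormed r R) {e : NamedEquation} (he : e ∈ R.1)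
    (z : {v // v ∈ R.2.1} → ZMod 2) :
    coeffVec R.2.1 e ⬝ᵥ z = (e.1.map (extend R.2.1 z)).sum := by
  have hterm (v : {v // v ∈ R.2.1}) : coeffVec R.2.1 e v * z v =
      if v.1 ∈ e.1.toFinset then extend R.2.1 z v.1 else 0 := by
    by_cases h : v.1 ∈ e.1 <;> simp [coeffVec, h, extend, v.2]
  rw [← List.sum_toFinset _ (hR.nodup e he), dotProduct,
    Finset.sum_congr rfl fun v _ => hterm v, ← Finset.sum_filter]
  refine Finset.sum_bij (fun v _ => v.1) (fun v hv => by simpa using hv)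
    (fun _ _ _ _ h => Subtype.ext h) (fun v hv => ?_) fun _ _ => rfl
  exact ⟨⟨v, hR.subset e he (List.mem_toFinset.1 hv)⟩, by simpa using hv, rfl⟩

theorem WellFormed.excess_extend (hR : WellFormed r R)
    {f : ({v // v ∈ R.2.1} → ZMod 2) → NamedEquation}
    (hf : ∀ e ∈ R.1, f (coeffVec R.2.1 e) = e) (z : {v // v ∈ R.2.1} → ZMod 2) :
    excess (extend R.2.1 z) R.1 =
      ∑ u ∈ coeffVecs R, ((f u).2.2 : ℤ) * sgn (u ⬝ᵥ z + toZMod (f u).2.1) := by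
  rw [coeffVecs, Finset.sum_image fun e he e' he' h => hR.coeffVec_injOn (by simpa using he)
    (by simpa using he') h, excess, ← List.sum_toFinset _ hR.nodup_eqns]
  refine Finset.sum_congr rfl fun e he => ?_
  have he := List.mem_toFinset.1 he
  rw [hf e he, hR.coeffVec_dotProduct he, equationSign]

theorem WellFormed.yes_of_isEasy (hR : WellFormed r R)
    (heasy : isEasy r R.1 R.2.1 R.2.2 = true) : R.Yes := by
  obtain ⟨f, hf⟩ : ∃ f : ({v // v ∈ R.2.1} → ZMod 2) → NamedEquation,
      ∀ e ∈ R.1, f (coeffVec R.2.1 e) = e :=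
    ⟨_, fun e he => hR.coeffVec_injOn.leftInvOn_invFunOn he⟩
  suffices hexcess : ∃ z : {v // v ∈ R.2.1} → ZMod 2, (R.2.2 : ℤ) ≤
      ∑ u ∈ coeffVecs R, ((f u).2.2 : ℤ) * sgn (u ⬝ᵥ z + toZMod (f u).2.1) from
    hexcess.imp' (extend R.2.1) fun z hz => hz.trans_eq (hR.excess_extend hf z).symm
  rw [isEasy, Bool.or_eq_true, List.any_eq_true] at heasy
  rcases heasy with ⟨e, he, hheavy⟩ | hmany
  · obtain ⟨z, hz⟩ := exists_weight_le_excess (fun u => toZMod (f u).2.1)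
      hR.zero_notMem_coeffVecs (fun u => ((f u).2.2 : ℤ)) (coeffVec_mem he)
    refine ⟨z, le_trans ?_ hz⟩
    rw [hf e he]
    exact_mod_cast of_decide_eq_true hheavy
  · refine exists_le_excess_of_card (r := r) (L := (encodeNat R.1.length).length) _
      hR.zero_notMem_coeffVecs (forall_mem_coeffVecs.2 fun e he => ?_)
      (forall_mem_coeffVecs.2 fun e he => hR.card_support_coeffVec_le he) ?_ ?_ ?_
    · rw [hf e he]
      exact_mod_cast hR.pos e he
    · intro v
      obtain ⟨e, he, hve⟩ := hR.occurs v.1 v.2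
      exact ⟨_, coeffVec_mem he, (coeffVec_ne_zero_iff _ e v).2 hve⟩
    · rw [length_encodeNat]
      exact card_coeffVecs_le.trans_lt (Nat.lt_size_self _)
    · rw [Fintype.card_of_subtype R.2.1.toFinset (by simp),
        List.toFinset_card_of_nodup hR.nodup_vars]
      exact of_decide_eq_true hmany

theorem WellFormed.trim (hR : WellFormed r R) : WellFormed r (trim r R) := by
  unfold MaxExactSat.trim
  split_ifs
  · exact wellFormed_empty r
  · exact hR

theorem WellFormed.yes_trim (hR : WellFormed r R) : (MaxExactSat.trim r R).Yes ↔ R.Yes := by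
  unfold MaxExactSat.trim
  split_ifs with heasy
  · exact iff_of_true ⟨0, by simp [excess]⟩ (hR.yes_of_isEasy heasy)
  · rfl

/-! ### The size of the reduced system -/

theorem WellFormed.length_eqns_le (hR : WellFormed r R) :
    R.1.length ≤ (R.2.1.length + 1) ^ r := by
  have hcard : R.1.toFinset.card ≤
      (Fintype.piFinset fun _ : Fin r => Finset.insertNone R.2.1.toFinset).card := by
    refine Finset.card_le_card_of_injOn (fun e i => e.1[i.1]?) (fun e he => ?_) ?_
    · simp only [Finset.mem_coe, Fintype.mem_piFinset, Finset.mem_insertNone]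
      exact fun i v hv => List.mem_toFinset.2
        (hR.subset e (List.mem_toFinset.1 he) (List.mem_of_getElem? hv))
    · intro e he e' he' h
      have he := List.mem_toFinset.1 he
      have he' := List.mem_toFinset.1 he'
      have hvars : e.1 = e'.1 := List.ext_getElem? fun i => by
        rcases lt_or_ge i r with hi | hi
        · exact congrFun h ⟨i, hi⟩
        · rw [List.getElem?_eq_none ((hR.length_le e he).trans hi),
            List.getElem?_eq_none ((hR.length_le e' he').trans hi)]
      exact hR.ext e he e' he' fun v => by rw [hvars]
  simpa only [List.toFinset_card_of_nodup hR.nodup_eqns, Fintype.card_piFinset,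
    Finset.prod_const, Finset.card_insertNone, List.toFinset_card_of_nodup hR.nodup_vars,
    Finset.card_univ, Fintype.card_fin] using hcard

end

theorem param_trim_le (r : ℕ) (R : NamedSystem) : (trim r R).2.2 ≤ R.2.2 := by
  unfold trim
  split_ifs
  · exact Nat.zero_le _
  · exact le_rfl

theorem weight_le_param_trim {r : ℕ} {R : NamedSystem} {e : NamedEquation}
    (he : e ∈ (trim r R).1) : e.2.2 ≤ (trim r R).2.2 := by
  unfold trim at he ⊢
  split_ifs at he ⊢ with heasy
  · simp at he
  · rw [Bool.not_eq_true, isEasy, Bool.or_eq_false_iff, List.any_eq_false] at heasy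
    simpa using (not_le.1 fun h => heasy.1 e he (decide_eq_true h)).le

theorem length_vars_trim_le (r : ℕ) (R : NamedSystem) : (trim r R).2.1.length ≤
    r * (trim r R).2.2 * (encodeNat (trim r R).1.length).length := by
  unfold trim
  split_ifs with heasy
  · exact Nat.zero_le _
  · rw [Bool.not_eq_true, isEasy, Bool.or_eq_false_iff] at heasy
    exact not_lt.1 (of_decide_eq_false heasy.2)

/-- The bound on the number of variables of the reduced system. -/
def varBound (r k : ℕ) : ℕ :=
  r * k * (2 + 2 * r + (2 * r).factorial + 2 * r * (Nat.log 2 (r * k + 1) + 1))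

theorem add_one_pow_le_factorial_mul (L d : ℕ) :
    (L + 1) ^ d ≤ d.factorial * 2 ^ (L + d) := by
  refine (Nat.pow_succ_le_ascFactorial (L + 1) d).trans ?_
  rw [Nat.ascFactorial_eq_factorial_mul_choose]
  exact Nat.mul_le_mul_left _ (Nat.choose_le_two_pow _ _)

theorem two_pow_size_le {M : ℕ} (hM : M ≠ 0) : 2 ^ M.size ≤ 2 * M := by
  have hsize : 0 < M.size := Nat.size_pos.2 (Nat.pos_of_ne_zero hM)
  rw [← Nat.sub_add_cancel hsize, pow_succ', Nat.mul_le_mul_left_iff two_pos]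
  exact Nat.lt_size.1 (Nat.sub_lt hsize one_pos)

/-- `2 ^ L` is polynomial in `L` for `L = M.size`; comparing it with `2 ^ (L / 2)` bounds `L`. -/
theorem size_le_of_le_pow {M n r c : ℕ} (hM : M ≤ (n + 1) ^ r) (hn : n ≤ c * M.size) :
    M.size ≤ 2 + 2 * r + (2 * r).factorial + 2 * r * (Nat.log 2 (c + 1) + 1) := by
  rcases eq_or_ne M 0 with rfl | hne
  · simp
  set L := M.size
  set s := Nat.log 2 (c + 1) + 1
  have hvars : n + 1 ≤ 2 ^ s * (L + 1) :=
    calc n + 1 ≤ (c + 1) * (L + 1) := by nlinarith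
      _ ≤ _ := Nat.mul_le_mul_right _ (Nat.lt_pow_succ_log_self one_lt_two _).le
  have hpow : 2 ^ L ≤ 2 * (2 ^ s * (L + 1)) ^ r :=
    (two_pow_size_le hne).trans (Nat.mul_le_mul_left _ (hM.trans (Nat.pow_le_pow_left hvars r)))
  have hsq : 2 ^ L * 2 ^ L ≤ 2 ^ L * 2 ^ (2 + 2 * r + (2 * r).factorial + 2 * r * s) :=
    calc 2 ^ L * 2 ^ L ≤ (2 * (2 ^ s * (L + 1)) ^ r) * (2 * (2 ^ s * (L + 1)) ^ r) :=
          Nat.mul_le_mul hpow hpow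
      _ = 2 ^ (2 + 2 * r * s) * (L + 1) ^ (2 * r) := by rw [mul_pow]; ring
      _ ≤ 2 ^ (2 + 2 * r * s) * ((2 * r).factorial * 2 ^ (L + 2 * r)) :=
          Nat.mul_le_mul_left _ (add_one_pow_le_factorial_mul L (2 * r))
      _ ≤ 2 ^ (2 + 2 * r * s) * (2 ^ (2 * r).factorial * 2 ^ (L + 2 * r)) :=
          Nat.mul_le_mul_left _ (Nat.mul_le_mul_right _ Nat.lt_two_pow_self.le)
      _ = _ := by ring
  exact (Nat.pow_le_pow_iff_right one_lt_two).1 (Nat.le_of_mul_le_mul_left hsq (by positivity))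

theorem le_varBound {r k n M : ℕ} (hM : M ≤ (n + 1) ^ r)
    (hn : n ≤ r * k * (encodeNat M).length) : n ≤ varBound r k := by
  rw [length_encodeNat] at hn
  exact hn.trans (Nat.mul_le_mul_left _ (size_le_of_le_pow hM hn))

theorem isBigO_one_log : (fun _ : ℕ => (1 : ℝ)) =O[atTop] fun k : ℕ => Real.log k :=
  ((isLittleO_const_left.2 <| Or.inr <| tendsto_norm_atTop_atTop.comp
    (Real.tendsto_log_atTop.comp tendsto_natCast_atTop_atTop))).isBigO

theorem isBigO_natLog_mul_add_one (r : ℕ) :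
    (fun k : ℕ => (Nat.log 2 (r * k + 1) : ℝ)) =O[atTop] fun k : ℕ => Real.log k := by
  have hle : ∀ᶠ k : ℕ in atTop, ‖(Nat.log 2 (r * k + 1) : ℝ)‖ ≤
      (Real.log 2)⁻¹ * (Real.log (r + 1) * 1 + Real.log k) := by
    filter_upwards [eventually_ge_atTop 1] with k hk
    have hk : (1 : ℝ) ≤ k := by exact_mod_cast hk
    rw [Real.norm_of_nonneg (by positivity), mul_one,
      ← Real.log_mul (by positivity) (by positivity), mul_comm (Real.log 2)⁻¹, ← div_eq_mul_inv]
    refine (Real.natLog_le_logb _ _).trans (div_le_div_of_nonneg_right ?_ (by positivity))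
    refine Real.log_le_log (by positivity) ?_
    push_cast
    linarith
  exact (IsBigO.of_norm_eventuallyLE hle).trans
    (((isBigO_one_log.const_mul_left _).add (isBigO_refl _ _)).const_mul_left _)

theorem IsBigOKLogK.add {g h : ℕ → ℕ} (hg : IsBigOKLogK g) (hh : IsBigOKLogK h) :
    IsBigOKLogK fun k => g k + h k :=
  (IsBigO.add hg hh).congr_left fun _ => by push_cast; rfl

theorem IsBigOKLogK.const_mul {h : ℕ → ℕ} (hh : IsBigOKLogK h) (c : ℕ) :
    IsBigOKLogK fun k => c * h k :=
  (IsBigO.const_mul_left hh c).congr_left fun _ => by push_cast; rfl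

theorem isBigOKLogK_id : IsBigOKLogK fun k => k :=
  ((isBigO_refl _ _).mul isBigO_one_log).congr_left fun _ => mul_one _

theorem isBigOKLogK_const (c : ℕ) : IsBigOKLogK fun _ => c := by
  refine IsBigO.trans (IsBigO.of_norm_eventuallyLE (g := fun k : ℕ => ((c * k : ℕ) : ℝ)) ?_)
    (isBigOKLogK_id.const_mul c)
  filter_upwards [eventually_ge_atTop 1] with k hk
  rw [Real.norm_of_nonneg (Nat.cast_nonneg c)]
  exact_mod_cast Nat.le_mul_of_pos_right c hk

theorem isBigOKLogK_varBound (r : ℕ) : IsBigOKLogK (varBound r) := by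
  have hbracket := (isBigO_one_log.const_mul_left ((2 + 2 * r + (2 * r).factorial : ℕ) : ℝ)).add
    (((isBigO_natLog_mul_add_one r).add isBigO_one_log).const_mul_left (2 * r : ℕ))
  refine ((((isBigO_refl (fun k : ℕ => (k : ℝ)) atTop).const_mul_left r).mul hbracket).congr_left
    fun k => ?_)
  simp only [varBound]
  push_cast
  ring

end MaxExactSat

/-! ### The bikernel -/

namespace MaxExactSat

open StackProg LinExcess

section

variable {r : ℕ} (p : Formula r × ℕ)

theorem wellFormed_reduced : WellFormed r (reduced p) := (wellFormed_collected p).trim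

theorem yes_reduced : (reduced p).Yes ↔ p.1.Yes p.2 :=
  (wellFormed_collected p).yes_trim.trans (yes_collected p)

theorem param_reduced_le : (reduced p).2.2 ≤ p.2 :=
  (param_trim_le r _).trans (Nat.min_le_left _ _)

theorem weight_reduced_le {e : NamedEquation} (he : e ∈ (reduced p).1) : e.2.2 ≤ p.2 :=
  (weight_le_param_trim he).trans (param_reduced_le p)

theorem length_vars_reduced_le : (reduced p).2.1.length ≤ varBound r p.2 :=
  le_varBound (wellFormed_reduced p).length_eqns_le <| (length_vars_trim_le r _).trans <|
    Nat.mul_le_mul_right _ (Nat.mul_le_mul_left _ (param_reduced_le p))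

theorem length_eqns_reduced_le : (reduced p).1.length ≤ (varBound r p.2 + 1) ^ r :=
  (wellFormed_reduced p).length_eqns_le.trans
    (Nat.pow_le_pow_left (Nat.succ_le_succ (length_vars_reduced_le p)) r)

end

theorem nonempty_tm2ComputableInPolyTime {r : ℕ} {L : ParamProblem}
    {φ : Formula r × ℕ → L.Inst × ℕ} {f : NamedSystem → List Γ'} (hf : PolyTime f)
    (hφ : ∀ p, f (reduced p) = L.encPair (φ p)) :
    Nonempty (TM2ComputableInPolyTime (maxExactSatAA r).encPair L.encPair φ) := by
  obtain ⟨M, c, hM⟩ := exists_machine_word polyTime_readStep size_readStep_le ([], [])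
    (PolyTimeIn.comp hf (polyTime_reduce r))
  refine ⟨⟨M, (Polynomial.X + 2) ^ c, fun p : Formula r × ℕ => ?_⟩⟩
  have houtput := hM ((maxExactSatAA r).encPair p)
  rw [foldr_readStep_encPair p, reduce_parsed, hφ] at houtput
  have heval : ((Polynomial.X + 2 : Polynomial ℕ) ^ c).eval
      ((maxExactSatAA r).encPair p).length = (((maxExactSatAA r).encPair p).length + 2) ^ c := by
    simp
  rw [heval]
  exact houtput.some

theorem length_flatMap_le {α β : Type*} (l : List α) (f : α → List β) {m : ℕ}
    (h : ∀ a ∈ l, (f a).length ≤ m) : (l.flatMap f).length ≤ l.length * m := by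
  rw [List.length_flatMap]
  simpa using List.sum_le_card_nsmul (l.map fun a => (f a).length) m (by simpa using h)

theorem length_encNat_le (a : ℕ) : (encNat a).length ≤ a + 1 := by
  simpa [encNat, length_encodeNat] using Nat.size_le.2 (Nat.lt_two_pow_self (n := a))

theorem length_encEquation_le {r n : ℕ} (e : Equation r n) :
    (encEquation e).length ≤ e.weight + 4 + r * (n + 1) := by
  have hvars : (e.vars.flatMap fun i : Fin n => encNat i).length ≤ r * (n + 1) :=
    (length_flatMap_le _ _ fun (i : Fin n) _ =>
      (length_encNat_le i).trans (Nat.succ_le_succ i.2.le)).trans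
        (Nat.mul_le_mul_right _ e.length_le)
  have hweight := length_encNat_le e.weight
  simp only [encEquation, List.length_cons, List.length_append, List.length_nil]
  omega

theorem length_encLinSystem_le {r : ℕ} (A : LinSystem r) {w : ℕ} (hw : ∀ e ∈ A.eqs, e.weight ≤ w) :
    (encLinSystem A).length ≤ A.n + 1 + A.eqs.length * (w + 4 + r * (A.n + 1)) := by
  rw [encLinSystem, List.length_append]
  refine Nat.add_le_add (length_encNat_le _) (length_flatMap_le _ _ fun e he => ?_)
  have hlength := length_encEquation_le e
  have hweight := hw e he
  omega

theorem flatMap_attach {α β : Type*} (l : List α) (f : α → List β) :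
    (l.attach.flatMap fun a => f a.1) = l.flatMap f := by
  rw [List.flatMap_def, List.attach_map_val, List.flatMap_def]

section

variable {r : ℕ} {R : NamedSystem}

/-- An equation of a well-formed system, with every variable replaced by its position in the list
of variables. -/
def toEquation (hR : WellFormed r R) (e : {e // e ∈ R.1}) : Equation r R.2.1.length where
  vars := e.1.1.pmap (fun v h => ⟨R.2.1.idxOf v, List.idxOf_lt_length_iff.2 h⟩)
    fun _ hv => hR.subset e.1 e.2 hv
  rhs := e.1.2.1
  weight := e.1.2.2
  nodup := (hR.nodup e.1 e.2).pmap fun _ hv _ _ h =>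
    (List.idxOf_inj hv).1 (congrArg Fin.val h)
  length_le := by simpa using hR.length_le e.1 e.2
  weight_pos := hR.pos e.1 e.2

/-- The instance of Max `r`-Lin AA that a well-formed system stands for. -/
def toLin (hR : WellFormed r R) : LinSystem r := ⟨R.2.1.length, R.1.attach.map (toEquation hR)⟩

section

variable (hR : WellFormed r R) {z : Word → ZMod 2} {z' : Fin R.2.1.length → ZMod 2}
  (hz : ∀ v (hv : v ∈ R.2.1), z' ⟨R.2.1.idxOf v, List.idxOf_lt_length_iff.2 hv⟩ = z v)
include hz

theorem sum_vars_toEquation (e : {e // e ∈ R.1}) :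
    ((toEquation hR e).vars.map z').sum = (e.1.1.map z).sum := by
  rw [toEquation, List.map_pmap, ← List.pmap_eq_map fun v hv => hR.subset e.1 e.2 hv]
  exact congrArg List.sum (List.pmap_congr_left _ fun v _ hv _ => hz v hv)

theorem ite_sat_toEquation (e : {e // e ∈ R.1}) :
    (if (toEquation hR e).Sat z' then ((toEquation hR e).weight : ℤ)
      else -((toEquation hR e).weight : ℤ)) = e.1.2.2 * equationSign z e.1.1 e.1.2.1 := by
  have hsgn : ∀ a b : ZMod 2, sgn (a + b) = if a = b then 1 else -1 := by decide
  have hsat : (toEquation hR e).Sat z' ↔ (e.1.1.map z).sum = toZMod e.1.2.1 := by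
    rw [Equation.Sat, sum_vars_toEquation hR hz]
    rfl
  simp only [hsat, equationSign, hsgn, mul_ite, mul_one, mul_neg_one]
  rfl

theorem excess_toLin : (toLin hR).excess z' = excess z R.1 := by
  change ((R.1.attach.map (toEquation hR)).map fun e =>
    if e.Sat z' then (e.weight : ℤ) else -(e.weight : ℤ)).sum = _
  rw [List.map_map, excess, ← List.attach_map_val (l := R.1)]
  exact congrArg List.sum (List.map_congr_left fun e _ => ite_sat_toEquation hR hz e)

end

theorem yes_toLin (hR : WellFormed r R) : (toLin hR).Yes R.2.2 ↔ R.Yes := by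
  constructor
  · rintro ⟨z', hz⟩
    refine ⟨fun v => if h : R.2.1.idxOf v < R.2.1.length then z' ⟨_, h⟩ else 0,
      hz.trans_eq (excess_toLin hR fun v hv => ?_)⟩
    rw [dif_pos (List.idxOf_lt_length_iff.2 hv)]
    rfl
  · rintro ⟨z, hz⟩
    refine ⟨fun i : Fin R.2.1.length => z R.2.1[i],
      hz.trans_eq (excess_toLin hR fun v hv => ?_).symm⟩
    simp

theorem encEquation_toEquation (hR : WellFormed r R) (e : {e // e ∈ R.1}) :
    encEquation (toEquation hR e) = Γ'.bra :: Γ'.bit e.1.2.1 :: (encNat e.1.2.2 ++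
      (e.1.1.flatMap (fun v => encNat (R.2.1.idxOf v)) ++ [Γ'.ket])) := by
  have hvars : (toEquation hR e).vars.flatMap (fun i : Fin _ => encNat i) =
      e.1.1.flatMap fun v => encNat (R.2.1.idxOf v) := by
    rw [List.flatMap_def, List.flatMap_def, toEquation, List.map_pmap]
    exact congrArg List.flatten (List.pmap_eq_map (f := fun v => encNat (R.2.1.idxOf v)) _)
  rw [encEquation, hvars]
  rfl

theorem encPair_toLin (hR : WellFormed r R) :
    (maxLinAA r).encPair (toLin hR, R.2.2) = linWord R := by
  change encNat R.2.2 ++ (encNat R.2.1.length ++ (R.1.attach.map (toEquation hR)).flatMap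
    encEquation) = _
  rw [linWord, List.flatMap_map, ← flatMap_attach R.1]
  simp only [encEquation_toEquation]

end

theorem length_encLinSystem_toLin_le {r : ℕ} (p : Formula r × ℕ) :
    (encLinSystem (toLin (wellFormed_reduced p))).length ≤ varBound r p.2 + 1 +
      (varBound r p.2 + 1) ^ r * (p.2 + 4 + r * (varBound r p.2 + 1)) := by
  have hweight : ∀ e ∈ (toLin (wellFormed_reduced p)).eqs, e.weight ≤ p.2 := by
    intro e he
    obtain ⟨e, -, rfl⟩ := List.mem_map.1 he
    exact weight_reduced_le p e.2
  have hvars : (toLin (wellFormed_reduced p)).n ≤ varBound r p.2 := length_vars_reduced_le p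
  have heqs : (toLin (wellFormed_reduced p)).eqs.length ≤ (varBound r p.2 + 1) ^ r := by
    simpa [toLin] using length_eqns_reduced_le p
  refine (length_encLinSystem_le _ hweight).trans ?_
  gcongr

theorem hasBikernelKLogK_maxLinAA (r : ℕ) : HasBikernelKLogK (maxExactSatAA r) (maxLinAA r) :=
  ⟨fun p => (toLin (wellFormed_reduced p), (reduced p).2.2),
    { polyTime := nonempty_tm2ComputableInPolyTime polyTime_linWord fun p =>
        (encPair_toLin (wellFormed_reduced p)).symm
      yes_iff := fun p => (yes_reduced p).symm.trans (yes_toLin (wellFormed_reduced p)).symm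
      param_le := ⟨id, param_reduced_le⟩
      size_le := ⟨fun k => varBound r k + 1 +
          (varBound r k + 1) ^ r * (k + 4 + r * (varBound r k + 1)),
        length_encLinSystem_toLin_le⟩ },
    varBound r, isBigOKLogK_varBound r, length_vars_reduced_le⟩

end MaxExactSat

/-! ### The kernel -/

namespace MaxExactSat

open StackProg LinExcess

section

variable {α : Type}

theorem sum_prod_signings {R : Type*} [CommSemiring R] (P : List α) (f : α × Bool → R) :
    ((signings P.length P).map fun c => (c.map f).prod).sum =
      (P.map fun i => f (i, false) + f (i, true)).prod := by
  induction P with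
  | nil => simp [signings]
  | cons i P ih =>
    have hcons (s : Bool) : ((fun c : List (α × Bool) => (c.map f).prod) ∘ fun c => (i, s) :: c)
        = fun c => f (i, s) * (c.map f).prod := by
      funext c; simp
    simp only [List.length_cons, signings, List.map_append, List.map_map, List.sum_append,
      List.map_cons, List.prod_cons]
    rw [hcons, hcons, List.sum_map_mul_left, List.sum_map_mul_left, ih, add_mul]

theorem length_signings_le (r : ℕ) (P : List α) : (signings r P).length ≤ 2 ^ r := by
  induction r generalizing P with
  | zero => simp [signings]
  | succ r ih =>
    cases P with
    | nil => simpa [signings] using Nat.one_le_two_pow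
    | cons i P =>
      have hP := ih P
      simp only [signings, List.length_append, List.length_map, pow_succ]
      omega

theorem map_fst_of_mem_signings {P : List α} {c : List (α × Bool)}
    (hc : c ∈ signings P.length P) : c.map Prod.fst = P := by
  induction P generalizing c with
  | nil => simp_all [signings]
  | cons i P ih =>
    simp only [List.length_cons, signings, List.mem_append, List.mem_map] at hc
    rcases hc with ⟨c, hc, rfl⟩ | ⟨c, hc, rfl⟩ <;> simp [ih hc]

theorem two_mul_sum_map_filter (l : List α) (p : α → Bool) (f : α → ℤ) :
    2 * ((l.filter p).map f).sum = (l.map fun a => (1 - sgn (toZMod (p a))) * f a).sum := by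
  induction l with
  | nil => rfl
  | cons a l ih =>
    rw [List.map_cons, List.sum_cons, ← ih]
    cases hp : p a
    · simp [hp, toZMod]
    · have hsgn : sgn (toZMod true) = -1 := rfl
      rw [List.filter_cons_of_pos hp, List.map_cons, List.sum_cons, hsgn]
      ring

end

theorem sgn_list_sum (l : List (ZMod 2)) : sgn l.sum = (l.map sgn).prod := by
  induction l with
  | nil => rfl
  | cons a l ih => rw [List.sum_cons, sgn_add, ih, List.map_cons, List.prod_cons]

/-- The sign of the bit `b` if the variable `i` is one of the first `n` variables, and `1` if `i` is
one of the variables with which clauses are padded. -/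
def signBelow (n i : ℕ) (b : Bool) : ℤ := if i < n then sgn (toZMod b) else 1

theorem sgn_keeps (n : ℕ) (b : Bool) (c : List (ℕ × Bool)) :
    sgn (toZMod (keeps n b c)) =
      sgn (toZMod b) * (c.map fun l => signBelow n l.1 (!l.2)).prod := by
  induction c with
  | nil => simp [keeps]
  | cons l c ih =>
    have hcons : keeps n b (l :: c) = Bool.xor (keeps n b c) (decide (l.1 < n) && !l.2) := rfl
    have hsgn : sgn (toZMod (decide (l.1 < n) && !l.2)) = signBelow n l.1 (!l.2) := by
      by_cases hl : l.1 < n <;> simp [hl, signBelow, toZMod]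
    rw [hcons, toZMod_xor, sgn_add, ih, hsgn, List.map_cons, List.prod_cons]
    ring

theorem sum_signBelow {n i : ℕ} (hi : i < n) :
    signBelow n i (!false) + signBelow n i (!true) = 0 := by
  simp only [signBelow, if_pos hi]
  rfl

theorem sum_signBelow_mul (a : ℕ → Bool) (n i : ℕ) :
    signBelow n i (!false) * (if a i = false then 0 else 2) +
      signBelow n i (!true) * (if a i = true then 0 else 2) = 2 * signBelow n i (a i) := by
  cases a i <;> simp [mul_comm]

/-- Twice the sum is the sum over all signings of `1 - sgn (keeps ..)` times the excess. Expanding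
the product, every term is a sum over signings of a product over the variables, which factors; the
term without the assignment vanishes because a variable below `n` contributes `-1 + 1`. -/
theorem two_mul_sum_literalsExcess (a : ℕ → Bool) {n : ℕ} (b : Bool) {P : List ℕ}
    (hP : ∃ i ∈ P, i < n) :
    2 * (((signings P.length P).filter fun c => keeps n b c).map (literalsExcess a)).sum =
      2 ^ P.length * (sgn (toZMod b) * (P.map fun i => signBelow n i (a i)).prod) := by
  set t : ℕ × Bool → ℤ := fun l => if a l.1 = l.2 then 0 else 2 with ht
  set q : ℕ × Bool → ℤ := fun l => signBelow n l.1 (!l.2)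
  have hexpand (c : List (ℕ × Bool)) :
      (1 - sgn (toZMod (keeps n b c))) * literalsExcess a c =
        ((c.map fun _ => (1 : ℤ)).prod + (-1) * (c.map t).prod) + (-sgn (toZMod b) *
          (c.map q).prod + sgn (toZMod b) * (c.map fun l => q l * t l).prod) := by
    rw [sgn_keeps, literalsExcess, List.prod_map_mul]
    simp only [List.map_const', List.prod_replicate, one_pow]
    ring
  have hone_eq : (P.map fun i => t (i, false) + t (i, true)) = P.map fun _ => (1 : ℤ) + 1 :=
    List.map_congr_left fun i _ => by cases h : a i <;> simp [ht, h]
  have hcross : (P.map fun i => q (i, false) + q (i, true)).prod = 0 := by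
    obtain ⟨i, hi, hin⟩ := hP
    exact List.prod_eq_zero (List.mem_map.2 ⟨i, hi, sum_signBelow hin⟩)
  have hmain : (P.map fun i => q (i, false) * t (i, false) + q (i, true) * t (i, true)) =
      P.map fun i => 2 * signBelow n i (a i) :=
    List.map_congr_left fun i _ => sum_signBelow_mul a n i
  rw [two_mul_sum_map_filter, List.map_congr_left fun c _ => hexpand c]
  simp only [List.sum_map_add, List.sum_map_mul_left, sum_prod_signings]
  rw [hone_eq, hcross, hmain, List.prod_map_mul]
  simp only [List.map_const', List.prod_replicate]
  ring

section

variable {r : ℕ} {D S : List Word}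

theorem length_filter_range_lt {t r : ℕ} (h : t ≤ r) :
    ((List.range r).filter fun j => decide (j < t)).length = t := by
  have hperm : ((List.range r).filter fun j => decide (j < t)).Perm (List.range t) :=
    (List.perm_ext_iff_of_nodup (List.nodup_range.filter _) List.nodup_range).2 fun j => by
      simp only [List.mem_filter, List.mem_range, decide_eq_true_eq]
      omega
  rw [hperm.length_eq, List.length_range]

theorem length_padded (hS : S.length ≤ r) : (padded r D S).length = r := by
  rw [padded, List.length_append, List.length_map, List.length_map,
    length_filter_range_lt (Nat.sub_le r _), Nat.add_sub_cancel' hS]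

theorem lt_of_mem_padded (hSD : S ⊆ D) {i : ℕ} (hi : i ∈ padded r D S) : i < D.length + r := by
  simp only [padded, List.mem_append, List.mem_map, List.mem_filter, List.mem_range] at hi
  rcases hi with ⟨v, hv, rfl⟩ | ⟨j, ⟨hj, -⟩, rfl⟩
  · exact (List.idxOf_lt_length_iff.2 (hSD hv)).trans_le (Nat.le_add_right _ _)
  · omega

theorem nodup_padded (hS : S.Nodup) (hSD : S ⊆ D) : (padded r D S).Nodup := by
  refine List.Nodup.append ?_ ?_ ?_
  · exact List.Nodup.map_on (fun v hv v' _ h => (List.idxOf_inj (hSD hv)).1 h) hS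
  · exact (List.nodup_range.filter _).map fun i j h => Nat.add_right_cancel h
  · intro i hi hi'
    obtain ⟨v, hv, rfl⟩ := List.mem_map.1 hi
    obtain ⟨j, -, hj⟩ := List.mem_map.1 hi'
    have hlt := List.idxOf_lt_length_iff.2 (hSD hv)
    omega

theorem prod_signBelow_padded (hSD : S ⊆ D) (a : ℕ → Bool) {z : Word → ZMod 2}
    (hz : ∀ v ∈ D, z v = toZMod (a (D.idxOf v))) :
    ((padded r D S).map fun i => signBelow D.length i (a i)).prod = sgn (S.map z).sum := by
  have hnew : ∀ j : ℕ, signBelow D.length (j + D.length) (a (j + D.length)) = 1 := fun j => by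
    simp [signBelow]
  have hold : ∀ v ∈ S, signBelow D.length (D.idxOf v) (a (D.idxOf v)) = sgn (z v) := by
    intro v hv
    rw [signBelow, if_pos (List.idxOf_lt_length_iff.2 (hSD hv)), hz v (hSD hv)]
  rw [padded, List.map_append, List.prod_append, List.map_map, List.map_map, sgn_list_sum,
    List.map_map]
  simp only [Function.comp_def, ← List.map_congr_left hold, hnew, List.map_const',
    List.prod_replicate, one_pow, mul_one]

end

theorem length_gadget_le (r : ℕ) (D : List Word) (e : NamedEquation) :
    (gadget r D e).length ≤ e.2.2 * 2 ^ r := by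
  have hlength := length_flatMap_le (List.replicate e.2.2 ()) (fun _ =>
    (signings r (padded r D e.1)).filter fun c => keeps D.length e.2.1 c) fun _ _ =>
      (List.length_filter_le _ _).trans (length_signings_le _ _)
  rwa [List.length_replicate] at hlength

section

variable {r : ℕ} {R : NamedSystem} (hR : WellFormed r R)
include hR

theorem map_fst_of_mem_gadget {e : NamedEquation} (he : e ∈ R.1) {c : List (ℕ × Bool)}
    (hc : c ∈ gadget r R.2.1 e) : c.map Prod.fst = padded r R.2.1 e.1 := by
  simp only [gadget, List.mem_flatMap, List.mem_filter] at hc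
  obtain ⟨-, -, hc, -⟩ := hc
  exact map_fst_of_mem_signings (by rwa [length_padded (hR.length_le e he)])

theorem lt_of_mem_gadget {e : NamedEquation} (he : e ∈ R.1) {c : List (ℕ × Bool)}
    (hc : c ∈ gadget r R.2.1 e) (l : ℕ × Bool) (hl : l ∈ c) : l.1 < R.2.1.length + r := by
  refine lt_of_mem_padded (r := r) (hR.subset e he) ?_
  rw [← map_fst_of_mem_gadget hR he hc]
  exact List.mem_map_of_mem hl

theorem sum_gadget {e : NamedEquation} (he : e ∈ R.1) (a : ℕ → Bool) {z : Word → ZMod 2}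
    (hz : ∀ v ∈ R.2.1, z v = toZMod (a (R.2.1.idxOf v))) :
    ((gadget r R.2.1 e).map (literalsExcess a)).sum =
      2 ^ (r - 1) * (e.2.2 * equationSign z e.1 e.2.1) := by
  have hr : 0 < r := (List.length_pos_iff.2 (hR.ne_nil e he)).trans_le (hR.length_le e he)
  have hP : ∃ i ∈ padded r R.2.1 e.1, i < R.2.1.length := by
    obtain ⟨v, hv⟩ := List.exists_mem_of_ne_nil _ (hR.ne_nil e he)
    exact ⟨_, List.mem_append_left _ (List.mem_map_of_mem hv),
      List.idxOf_lt_length_iff.2 (hR.subset e he hv)⟩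
  have hcopy := two_mul_sum_literalsExcess a e.2.1 hP
  rw [length_padded (hR.length_le e he), prod_signBelow_padded (hR.subset e he) a hz, mul_comm
    (sgn (toZMod e.2.1)), ← sgn_add, ← equationSign, ← mul_pow_sub_one hr.ne', mul_assoc] at hcopy
  rw [gadget, sum_map_flatMap, mul_left_cancel₀ two_ne_zero hcopy, List.map_const',
    List.sum_replicate, List.length_replicate, nsmul_eq_mul]
  ring

end

section

variable {r : ℕ} {R : NamedSystem}

/-- A clause of the gadget of an equation, as a clause in the variables of the system and `r` new
variables, which come last. -/
def toClause (hR : WellFormed r R) (e : {e // e ∈ R.1}) (c : {c // c ∈ gadget r R.2.1 e.1}) :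
    Clause r (R.2.1.length + r) where
  lits := c.1.pmap (fun l h => (⟨l.1, h⟩, l.2)) (lt_of_mem_gadget hR e.2 c.2)
  nodup := by
    have hnodup := nodup_padded (r := r) (hR.nodup e.1 e.2) (hR.subset e.1 e.2)
    rw [← map_fst_of_mem_gadget hR e.2 c.2] at hnodup
    refine List.Nodup.of_map (fun i : Fin _ => i.1) ?_
    rw [List.map_map, List.map_pmap]
    exact (List.pmap_eq_map (f := Prod.fst) _).symm ▸ hnodup
  length_eq := by
    rw [List.length_pmap, ← List.length_map Prod.fst, map_fst_of_mem_gadget hR e.2 c.2]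
    exact length_padded (hR.length_le e.1 e.2)

/-- The instance of Max Exact `r`-SAT AA made of the gadgets of a well-formed system. -/
def toSat (hR : WellFormed r R) : Formula r :=
  ⟨R.2.1.length + r, R.1.attach.flatMap fun e =>
    (gadget r R.2.1 e.1).attach.map (toClause hR e)⟩

theorem clauseExcess_toClause (hR : WellFormed r R) (e : {e // e ∈ R.1})
    (c : {c // c ∈ gadget r R.2.1 e.1}) (a : ℕ → Bool) :
    clauseExcess (fun i : Fin _ => a i) (toClause hR e c) = literalsExcess a c.1 := by
  rw [clauseExcess, literalsExcess, toClause, List.map_pmap]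
  exact congrArg (fun l : List ℤ => 1 - l.prod)
    (List.pmap_eq_map (f := fun l : ℕ × Bool => if a l.1 = l.2 then (0 : ℤ) else 2) _)

theorem sum_toSat (hR : WellFormed r R) (a : ℕ → Bool) {z : Word → ZMod 2}
    (hz : ∀ v ∈ R.2.1, z v = toZMod (a (R.2.1.idxOf v))) :
    ((toSat hR).clauses.map (clauseExcess fun i : Fin _ => a i)).sum =
      2 ^ (r - 1) * excess z R.1 := by
  change ((R.1.attach.flatMap fun e => (gadget r R.2.1 e.1).attach.map (toClause hR e)).map
    (clauseExcess fun i : Fin _ => a i)).sum = _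
  rw [sum_map_flatMap, excess, ← List.sum_map_mul_left, ← List.attach_map_val (l := R.1)]
  refine congrArg List.sum (List.map_congr_left fun e _ => ?_)
  rw [← sum_gadget hR e.2 a hz,
    ← List.attach_map_val (l := gadget r R.2.1 e.1), List.map_map]
  exact congrArg List.sum (List.map_congr_left fun c _ => clauseExcess_toClause hR e c a)

theorem yes_toSat (hR : WellFormed r R) : (toSat hR).Yes (2 ^ (r - 1) * R.2.2) ↔ R.Yes := by
  have hscale (x : ℤ) : ((2 ^ (r - 1) * R.2.2 : ℕ) : ℤ) ≤ 2 ^ (r - 1) * x ↔ (R.2.2 : ℤ) ≤ x := by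
    push_cast
    exact mul_le_mul_iff_right₀ (by positivity)
  rw [Formula.yes_iff]
  constructor
  · rintro ⟨a', ha⟩
    let a : ℕ → Bool := fun i => if h : i < R.2.1.length + r then a' ⟨i, h⟩ else false
    have hrestrict : a' = fun i : Fin _ => a i := funext fun i : Fin (R.2.1.length + r) =>
      (dif_pos i.2 : a i = a' ⟨i, i.2⟩).symm
    rw [hrestrict, sum_toSat hR a (z := fun v => toZMod (a (R.2.1.idxOf v))) fun _ _ => rfl,
      hscale] at ha
    exact ⟨_, ha⟩
  · rintro ⟨z, hz⟩
    let a : ℕ → Bool := fun i => decide (z (R.2.1.getD i []) = 1)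
    refine ⟨fun i => a i, ?_⟩
    rwa [sum_toSat hR a (z := z), hscale]
    intro v hv
    have hlt := List.idxOf_lt_length_iff.2 hv
    simp [a, toZMod_decide, hlt]

theorem encClause_toClause (hR : WellFormed r R) (e : {e // e ∈ R.1})
    (c : {c // c ∈ gadget r R.2.1 e.1}) : encClause (toClause hR e c) =
      Γ'.bra :: (c.1.flatMap (fun l => Γ'.bit l.2 :: encNat l.1) ++ [Γ'.ket]) := by
  rw [encClause, toClause, List.flatMap_def, List.flatMap_def, List.map_pmap]
  exact congrArg (fun l : List (List Γ') => Γ'.bra :: (l.flatten ++ [Γ'.ket]))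
    (List.pmap_eq_map (f := fun l : ℕ × Bool => Γ'.bit l.2 :: encNat l.1) _)

theorem encPair_toSat (hR : WellFormed r R) :
    (maxExactSatAA r).encPair (toSat hR, 2 ^ (r - 1) * R.2.2) = satWord r R := by
  change encNat (2 ^ (r - 1) * R.2.2) ++ (encNat (R.2.1.length + r) ++
    (R.1.attach.flatMap fun e =>
      (gadget r R.2.1 e.1).attach.map (toClause hR e)).flatMap encClause) = _
  simp only [satWord, List.flatMap_assoc, List.flatMap_map, encClause_toClause]
  rw [← flatMap_attach R.1]
  simp only [← flatMap_attach (gadget r R.2.1 _)]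

theorem m_toSat_le (hR : WellFormed r R) {w : ℕ} (hw : ∀ e ∈ R.1, e.2.2 ≤ w) :
    (toSat hR).m ≤ R.1.length * (w * 2 ^ r) := by
  rw [← R.1.length_attach]
  refine length_flatMap_le _ _ fun e _ => ?_
  change ((gadget r R.2.1 e.1).attach.map (toClause hR e)).length ≤ _
  rw [List.length_map, List.length_attach]
  exact (length_gadget_le r _ _).trans (Nat.mul_le_mul_right _ (hw e.1 e.2))

end

theorem length_encLit_le {n : ℕ} (l : Literal n) : (encLit l).length ≤ n + 1 := by
  have hlength := length_encNat_le l.1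
  simp only [encLit, List.length_cons]
  omega

theorem length_encClause_le {r n : ℕ} (C : Clause r n) :
    (encClause C).length ≤ r * (n + 1) + 2 := by
  have hlits := length_flatMap_le C.lits encLit fun l _ => length_encLit_le l
  rw [C.length_eq] at hlits
  simpa [encClause] using hlits

theorem length_encFormula_le {r : ℕ} (F : Formula r) :
    (encFormula F).length ≤ F.n + 1 + F.m * (r * (F.n + 1) + 2) := by
  rw [encFormula, List.length_append]
  exact Nat.add_le_add (length_encNat_le _)
    (length_flatMap_le _ _ fun C _ => length_encClause_le C)

theorem n_toSat_reduced_le {r : ℕ} (p : Formula r × ℕ) :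
    (toSat (wellFormed_reduced p)).n ≤ varBound r p.2 + r :=
  Nat.add_le_add_right (length_vars_reduced_le p) r

theorem length_encFormula_toSat_le {r : ℕ} (p : Formula r × ℕ) :
    (encFormula (toSat (wellFormed_reduced p))).length ≤ varBound r p.2 + r + 1 +
      (varBound r p.2 + 1) ^ r * (p.2 * 2 ^ r) * (r * (varBound r p.2 + r + 1) + 2) := by
  have hm : (toSat (wellFormed_reduced p)).m ≤ (varBound r p.2 + 1) ^ r * (p.2 * 2 ^ r) :=
    (m_toSat_le _ fun _ he => weight_reduced_le p he).trans
      (Nat.mul_le_mul_right _ (length_eqns_reduced_le p))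
  have hn := n_toSat_reduced_le p
  refine (length_encFormula_le _).trans ?_
  gcongr

theorem hasKernelKLogK_maxExactSatAA (r : ℕ) : HasKernelKLogK (maxExactSatAA r) :=
  ⟨fun p => (toSat (wellFormed_reduced p), 2 ^ (r - 1) * (reduced p).2.2),
    { polyTime := nonempty_tm2ComputableInPolyTime (polyTime_satWord r) fun p =>
        (encPair_toSat (wellFormed_reduced p)).symm
      yes_iff := fun p => (yes_reduced p).symm.trans (yes_toSat (wellFormed_reduced p)).symm
      param_le := ⟨fun k => 2 ^ (r - 1) * k, fun p => Nat.mul_le_mul_left _ (param_reduced_le p)⟩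
      size_le := ⟨fun k => varBound r k + r + 1 +
          (varBound r k + 1) ^ r * (k * 2 ^ r) * (r * (varBound r k + r + 1) + 2),
        length_encFormula_toSat_le⟩ },
    fun k => varBound r k + r, (isBigOKLogK_varBound r).add (isBigOKLogK_const r),
    n_toSat_reduced_le⟩

end MaxExactSat

/-! ### The decision algorithm -/

namespace MaxExactSat

open StackProg LinExcess

theorem filter_mem_sublistsOf (D : List Word) (p : Word → Bool) : D.filter p ∈ sublistsOf D := by
  induction D with
  | nil => simp [sublistsOf]
  | cons v D ih =>
    rw [sublistsOf_cons, List.mem_append]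
    cases hv : p v
    · left
      rwa [List.filter_cons_of_neg (by simp [hv])]
    · right
      rw [List.filter_cons_of_pos hv]
      exact List.mem_map_of_mem ih

/-- The assignment that sets exactly the variables in `A` to `1`. -/
def indicator (A : List Word) (v : Word) : ZMod 2 := toZMod (decide (v ∈ A))

theorem toZMod_holds (A S : List Word) (b : Bool) (w : ℕ) :
    toZMod (holds A (S, b, w)) = (S.map (indicator A)).sum + toZMod b + 1 := by
  induction S with
  | nil => simp [holds, toZMod_not]
  | cons v S ih =>
    have hcons : holds A (v :: S, b, w) = Bool.xor (holds A (S, b, w)) (decide (v ∈ A)) := rfl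
    rw [hcons, toZMod_xor, ih, List.map_cons, List.sum_cons, indicator]
    ring

theorem equationSign_indicator (A : List Word) (e : NamedEquation) :
    equationSign (indicator A) e.1 e.2.1 = if holds A e then 1 else -1 := by
  obtain ⟨S, b, w⟩ := e
  have hsgn : ∀ (x : ZMod 2) (c : Bool), toZMod c = x + 1 → sgn x = if c then 1 else -1 := by
    decide
  exact hsgn _ _ (toZMod_holds A S b w)

theorem excess_indicator (A : List Word) (M : List NamedEquation) : excess (indicator A) M =
    (((M.filter fun e => holds A e).map fun e => e.2.2).sum : ℕ) -
      (((M.filter fun e => !holds A e).map fun e => e.2.2).sum : ℕ) := by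
  unfold excess
  induction M with
  | nil => rfl
  | cons e M ih =>
    rw [List.map_cons, List.sum_cons, ih, equationSign_indicator]
    cases he : holds A e <;> simp [he] <;> ring

theorem reaches_iff (M : List NamedEquation) (k : ℕ) (A : List Word) :
    reaches M k A = true ↔ (k : ℤ) ≤ excess (indicator A) M := by
  rw [excess_indicator, reaches, decide_eq_true_iff]
  omega

theorem solve_iff {r : ℕ} {R : NamedSystem} (hR : WellFormed r R) : solve R = true ↔ R.Yes := by
  rw [solve, List.any_eq_true]
  constructor
  · rintro ⟨A, -, hA⟩
    exact ⟨indicator A, (reaches_iff _ _ _).1 hA⟩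
  · rintro ⟨z, hz⟩
    refine ⟨_, filter_mem_sublistsOf R.2.1 fun v => decide (z v = 1), (reaches_iff _ _ _).2 ?_⟩
    rwa [excess_congr (z' := z)]
    intro e he v hv
    simp [indicator, hR.subset e he hv, toZMod_decide]

theorem polyTimeIn_solve_reduce (r : ℕ) :
    PolyTimeIn (fun s : List Word × List (List Word) => size s + 2 ^ (reduce r s).2.1.length)
      fun s => solve (reduce r s) := by
  have hreduce := PolyTimeIn.of_polyTime (polyTime_reduce r)
    (PolyBounded.self.mono fun s => Nat.le_add_right (size s) (2 ^ (reduce r s).2.1.length))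
  exact polyTimeIn_solve.comp_of_polyBounded hreduce
    (hreduce.output.add (PolyBounded.self.mono fun s => Nat.le_add_left _ _))

theorem size_foldr_readStep_le (w : List Γ') :
    size (w.foldr readStep ([], [])) ≤ 7 * w.length + 3 := by
  induction w with
  | nil => simp
  | cons a w ih =>
    have hstep := size_readStep_le a (w.foldr readStep ([], []))
    rw [List.foldr_cons, List.length_cons]
    omega

theorem ParamProblem.SolvesIn.mono {L : ParamProblem} {M : TM2ComputableAux Γ' Bool} {x : L.Inst}
    {k t t' : ℕ} (h : L.SolvesIn M x k t) (ht : t ≤ t') : L.SolvesIn M x k t' := by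
  obtain ⟨b, hb, ⟨h⟩⟩ := h
  exact ⟨b, hb, ⟨⟨h.toEvalsTo, h.steps_le_m.trans ht⟩⟩⟩

theorem exists_machine_solvesIn (r : ℕ) : ∃ (M : TM2ComputableAux Γ' Bool) (c : ℕ),
    ∀ (F : Formula r) (k : ℕ), (maxExactSatAA r).SolvesIn M F k
      ((8 * ((maxExactSatAA r).encPair (F, k)).length + 5 + 2 ^ varBound r k) ^ c) := by
  obtain ⟨M, c, hM⟩ := exists_machine_bool polyTime_readStep size_readStep_le ([], [])
    (polyTimeIn_solve_reduce r)
  refine ⟨M, c, fun F k => ?_⟩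
  have hrun := hM ((maxExactSatAA r).encPair (F, k))
  have hsize := size_foldr_readStep_le ((maxExactSatAA r).encPair (F, k))
  have hparsed : ((maxExactSatAA r).encPair (F, k)).foldr readStep ([], []) = parsed (F, k) :=
    foldr_readStep_encPair (F, k)
  rw [hparsed] at hsize
  rw [hparsed, reduce_parsed] at hrun
  refine ParamProblem.SolvesIn.mono
    ⟨_, (solve_iff (wellFormed_reduced (F, k))).trans (yes_reduced (F, k)), hrun⟩
    (Nat.pow_le_pow_left ?_ c)
  have hvars : 2 ^ (reduced (F, k)).2.1.length ≤ 2 ^ varBound r k :=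
    Nat.pow_le_pow_right two_pos (length_vars_reduced_le (F, k))
  omega

theorem Formula.AllOccur.n_le {r : ℕ} {F : Formula r} (hF : F.AllOccur) : F.n ≤ F.m * r := by
  have hsubset : (Finset.univ : Finset (Fin F.n)) ⊆
      (F.clauses.flatMap fun C => C.lits.map Prod.fst).toFinset := fun i _ => by
    rw [List.mem_toFinset, List.mem_flatMap]
    exact hF i
  have hcard := (Finset.card_le_card hsubset).trans (List.toFinset_card_le _)
  rw [Finset.card_univ, Fintype.card_fin] at hcard
  exact hcard.trans (length_flatMap_le _ _ fun C _ => by rw [List.length_map, C.length_eq])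

theorem Formula.AllOccur.length_encPair_le {r : ℕ} {F : Formula r} (hF : F.AllOccur) (k : ℕ) :
    ((maxExactSatAA r).encPair (F, k)).length ≤ k + 2 + (r ^ 2 + 2 * r + 2) * F.m ^ 2 := by
  have hm : F.m ≤ F.m ^ 2 := Nat.le_self_pow two_ne_zero _
  calc ((maxExactSatAA r).encPair (F, k)).length
      ≤ (k + 1) + (F.n + 1 + F.m * (r * (F.n + 1) + 2)) := by
        rw [ParamProblem.encPair, List.length_append]
        exact Nat.add_le_add (length_encNat_le k) (length_encFormula_le F)
    _ ≤ (k + 1) + (F.m * r + 1 + F.m * (r * (F.m * r + 1) + 2)) := by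
        gcongr <;> exact hF.n_le
    _ = k + 2 + (r ^ 2 * F.m ^ 2 + (2 * r + 2) * F.m) := by ring
    _ ≤ k + 2 + (r ^ 2 * F.m ^ 2 + (2 * r + 2) * F.m ^ 2) := by gcongr
    _ = k + 2 + (r ^ 2 + 2 * r + 2) * F.m ^ 2 := by ring

theorem add_pow_le_two_mul (x y c : ℕ) : (x + y) ^ c ≤ (2 * x) ^ c + (2 * y) ^ c := by
  rcases le_total x y with h | h
  · exact (Nat.pow_le_pow_left (by omega) c).trans (Nat.le_add_left _ _)
  · exact (Nat.pow_le_pow_left (by omega) c).trans (Nat.le_add_right _ _)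

theorem two_pow_add_two_pow_le (a b : ℕ) : 2 ^ a + 2 ^ b ≤ 2 ^ (a + b + 1) := by
  have ha : 2 ^ a ≤ 2 ^ (a + b) := Nat.pow_le_pow_right two_pos (Nat.le_add_right a b)
  have hb : 2 ^ b ≤ 2 ^ (a + b) := Nat.pow_le_pow_right two_pos (Nat.le_add_left b a)
  rw [pow_succ]
  omega

theorem mul_pow_pow_le (K N d c : ℕ) : (K * N ^ d) ^ c ≤ 2 ^ (K * c) + N ^ ((K + d) * c) := by
  have hK : K ≤ 2 ^ K := Nat.lt_two_pow_self.le
  rcases le_or_gt N 1 with hN | hN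
  · refine le_trans ?_ (Nat.le_add_right _ _)
    rw [pow_mul]
    exact Nat.pow_le_pow_left
      ((mul_le_of_le_one_right (Nat.zero_le K) (pow_le_one₀ (Nat.zero_le N) hN)).trans hK) c
  · refine le_trans ?_ (Nat.le_add_left _ _)
    rw [pow_mul, pow_add]
    gcongr
    exact hK.trans (Nat.pow_le_pow_left hN K)

theorem mul_pow_add_two_pow_pow_le (K N d y c : ℕ) : (K * N ^ d + 2 ^ y) ^ c ≤
    2 ^ (c * y + ((2 * K + 1) * c + 1)) + N ^ ((2 * K + d) * c) := by
  calc (K * N ^ d + 2 ^ y) ^ c ≤ (2 * K * N ^ d) ^ c + (2 * 2 ^ y) ^ c := by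
        rw [mul_assoc]
        exact add_pow_le_two_mul _ _ c
    _ ≤ (2 ^ (2 * K * c) + N ^ ((2 * K + d) * c)) + 2 ^ ((y + 1) * c) := by
        rw [← pow_succ', ← pow_mul]
        exact Nat.add_le_add_right (mul_pow_pow_le _ _ _ _) _
    _ = (2 ^ (2 * K * c) + 2 ^ ((y + 1) * c)) + N ^ ((2 * K + d) * c) := by ring
    _ ≤ 2 ^ (2 * K * c + (y + 1) * c + 1) + N ^ ((2 * K + d) * c) :=
        Nat.add_le_add_right (two_pow_add_two_pow_le _ _) _
    _ = 2 ^ (c * y + ((2 * K + 1) * c + 1)) + N ^ ((2 * K + d) * c) := by ring_nf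

theorem add_two_pow_le_two_pow (k x : ℕ) : 8 * k + 21 + 2 ^ x ≤ 2 ^ (x + (k + 6)) := by
  have hk : k < 2 ^ k := Nat.lt_two_pow_self
  have hx : 1 ≤ 2 ^ x := Nat.one_le_two_pow
  have hprod : 2 ^ (x + (k + 6)) = 64 * (2 ^ k * 2 ^ x) := by ring
  nlinarith

theorem solvableKLogK (r : ℕ) : SolvableKLogK r := by
  obtain ⟨M, c, hM⟩ := exists_machine_solvesIn r
  set K := 8 * (r ^ 2 + 2 * r + 2) with hK
  refine ⟨M, fun k => c * (varBound r k + (k + 6)) + ((2 * K + 1) * c + 1), (2 * K + 2) * c,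
    (((isBigOKLogK_varBound r).add (isBigOKLogK_id.add (isBigOKLogK_const 6))).const_mul c).add
      (isBigOKLogK_const _), fun F k => ?_⟩
  have hsolves {N : ℕ} (hN : 8 * ((maxExactSatAA r).encPair (F, k)).length ≤
      8 * (k + 2) + K * N ^ 2) : (maxExactSatAA r).SolvesIn M F k
        (2 ^ (c * (varBound r k + (k + 6)) + ((2 * K + 1) * c + 1)) + N ^ ((2 * K + 2) * c)) := by
    have hpow := add_two_pow_le_two_pow k (varBound r k)
    refine (hM F k).mono (le_trans (Nat.pow_le_pow_left ?_ c)
      (mul_pow_add_two_pow_pow_le K N 2 _ c))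
    omega
  refine ⟨hsolves ?_, fun hF => hsolves ?_⟩
  · nlinarith [Nat.le_self_pow two_ne_zero ((maxExactSatAA r).encPair (F, k)).length]
  · rw [hK, mul_assoc 8, ← Nat.mul_add]
    exact Nat.mul_le_mul_left 8 (hF.length_encPair_le k)

end MaxExactSat

theorem mainTheorem8 (r : ℕ) (hr : 2 ≤ r) :
    MaxExactSat.HasBikernelKLogK (MaxExactSat.maxExactSatAA r) (MaxExactSat.maxLinAA r) ∧
    MaxExactSat.HasKernelKLogK (MaxExactSat.maxExactSatAA r) ∧
    MaxExactSat.SolvableKLogK r :=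
  ⟨MaxExactSat.hasBikernelKLogK_maxLinAA r, MaxExactSat.hasKernelKLogK_maxExactSatAA r,
    MaxExactSat.solvableKLogK r⟩
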